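/- **Notation.** For $\lambda>0$ and a positive semidefinite $K\in\mathbb{R}^{n\times n}$ let $s_\lambda(K)=\mathrm{tr}(K(K+\lambda I_n)^{-1})$ be its statistical dimension; $K\preceq K'$ means $x^\top Kx\le x^\top K'x$ for all $x$. A random matrix $\Pi\in\mathbb{R}^{m\times N}$ is an $(\varepsilon,\delta,\mu,N,n)$-*oblivious subspace embedding* if for all $\lambda>0$ and all $A\in\mathbb{R}^{N\times n}$ with $s_\lambda(A^\top A)\le\mu$, $$\Pr\big[(1-\varepsilon)(A^\top A+\lambda I_n)\preceq(\Pi A)^\top\Pi A+\lambda I_n\preceq(1+\varepsilon)(A^\top A+\lambda I_n)\big]\ge 1-\delta .$$ It has the $(\varepsilon,\delta)$-*approximate matrix product property* if for all $k$ and all $C,D\in\mathbb{R}^{N\times k}$, $\Pr[\|C^\top\Pi^\top\Pi D-C^\top D\|_F\le\varepsilon\|C\|_F\|D\|_F]\ge1-\delta$. **The sketch.** Index coordinates from $0$, so $[m]=\{0,\dots,m-1\}$. A *CountSketch* $T\in\mathbb{R}^{m\times d}$ is $T_{r,i}=\sigma(i)\mathbf 1[h(i)=r]$, with $h:[d]\to[m]$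 a 3-wise independent (uniform) hash function and $\sigma:[d]\to\{\pm1\}$ a 4-wise independent (uniform) sign function, independent of each other. A degree-2 *TensorSketch* $S\in\mathbb{R}^{m\times m^2}$ is $S_{r,(i,j)}=\sigma_1(i)\sigma_2(j)\mathbf 1[h_1(i)+h_2(j)\equiv r \bmod m]$, with independent 3-wise independent hash functions $h_1,h_2:[m]\to[m]$ and 4-wise independent sign functions $\sigma_1,\sigma_2:[m]\to\{\pm1\}$. Let $q=2^{\lceil\log_2p\rceil}$, let $T_1,\dots,T_q$ be CountSketches (the leaves of a balanced binary tree) and, for $l=2,4,\dots,q$, let $S^l_1,\dots,S^l_{l/2}$ be TensorSketches (its internal nodes), all drawn independently, and put $$\Pi^q=S^2S^4\cdots S^q\,(T_1\times\cdots\times T_q),\qquad S^l=S^l_1\times\cdots\times S^l_{l/2},\qquad \Pi^p(v)=\Pi^q(v\otimes e_1^{\otimes(q-p)})\ \text{ for } v\in\mathbb{R}^{d^p},$$ where $\times$ is the Kronecker product of matrices and $e_1$ is the first standard basis vector of $\mathbb{R}^d$. **Theorem.** There is an absolute constant $C>0$ such that for all positive integers $n,p,d,m$ the above distribution on sketches $\Pi^p\in\mathbb{R}^{m\times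 d^p}$ exists and, whatever hash and sign families with the stated independence are used, for all $\varepsilon,s_\lambda>0$: (1) if $m\ge C\,p\,s_\lambda^2\,\varepsilon^{-2}$, then $\Pi^p$ is an $(\varepsilon,1/10,s_\lambda,d^p,n)$-oblivious subspace embedding; (2) if $m\ge C\,p\,\varepsilon^{-2}$, then $\Pi^p$ has the $(\varepsilon,1/10)$-approximate matrix product property. Moreover, for every outcome of the random functions and every $X\in\mathbb{R}^{d\times n}$, let $A=X^{\otimes p}\in\mathbb{R}^{d^p\times n}$ be the matrix whose columns are the $p$-fold self-tensorings of the columns of $X$. Then each column of $\Pi^pA$ is what the following procedure computes from the corresponding column $x$ of $X$: put $Y^0_j=T_jx$ for $j\le p$ and $Y^0_j=T_je_1$ for $p<j\le q$; for $l=1,\dots,\log_2q$ put $Y^l_j=S^{q/2^{l-1}}_j(Y^{l-1}_{2j-1}\otimes Y^{l-1}_{2j})$ for $1\le j\le q/2^l$; return $Y^{\log_2q}_1$. The matrix $\Pi^pA$ can be computed, by one fixed program for all inputs, in time $$O\big(p\,(n\,m\,\log_2(2m)+\mathrm{nnz}(X))\big)$$ on a real RAM with unit-cost arithmetic and square roots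 on reals, and unit-cost addition, truncated subtraction, halving and memory access for integers, where $X$ is given in compressed sparse column form and the values of the hash and sign functions are available in tables in memory. -/

import Mathlib

open MeasureTheory

open scoped ENNReal Matrix

noncomputable section

namespace TreeSketch

/-! ### Regularized subspace embeddings and approximate matrix products -/

/-- The `lam`-statistical dimension `tr (K (K + lam I)⁻¹)`. -/
def statDim {n : ℕ} (lam : ℝ) (K : Matrix (Fin n) (Fin n) ℝ) : ℝ :=
  (K * (K + lam • (1 : Matrix (Fin n) (Fin n) ℝ))⁻¹).trace

/-- The spectral inequality: `xᵀ K x ≤ xᵀ K' x` for all vectors `x`. -/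
def SpectralLE {n : ℕ} (K K' : Matrix (Fin n) (Fin n) ℝ) : Prop :=
  ∀ x : Fin n → ℝ, x ⬝ᵥ (K *ᵥ x) ≤ x ⬝ᵥ (K' *ᵥ x)

/-- The random matrix `S`, with rows indexed by `Fin m` and columns indexed by `ι`, is an
`(ε, δ, μ, |ι|, n)`-oblivious subspace embedding. -/
def IsOSE {Ω : Type*} [MeasurableSpace Ω] (P : Measure Ω) {m : ℕ} {ι : Type*} [Fintype ι]
    (S : Ω → Matrix (Fin m) ι ℝ) (ε δ μ : ℝ) (n : ℕ) : Prop :=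
  ∀ lam : ℝ, 0 < lam → ∀ A : Matrix ι (Fin n) ℝ, statDim lam (Aᵀ * A) ≤ μ →
    ENNReal.ofReal (1 - δ) ≤
      P {ω | SpectralLE ((1 - ε) • (Aᵀ * A + lam • (1 : Matrix (Fin n) (Fin n) ℝ)))
                ((S ω * A)ᵀ * (S ω * A) + lam • (1 : Matrix (Fin n) (Fin n) ℝ)) ∧
             SpectralLE ((S ω * A)ᵀ * (S ω * A) + lam • (1 : Matrix (Fin n) (Fin n) ℝ))
                ((1 + ε) • (Aᵀ * A + lam • (1 : Matrix (Fin n) (Fin n) ℝ)))}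

open scoped Matrix.Norms.Frobenius in
/-- The random matrix `S` has the `(ε, δ)`-approximate matrix product property
(the norms are Frobenius norms). -/
def HasApproxMatrixProduct {Ω : Type*} [MeasurableSpace Ω] (P : Measure Ω) {m : ℕ} {ι : Type*}
    [Fintype ι] (S : Ω → Matrix (Fin m) ι ℝ) (ε δ : ℝ) : Prop :=
  ∀ (n : ℕ) (C D : Matrix ι (Fin n) ℝ),
    ENNReal.ofReal (1 - δ) ≤ P {ω | ‖Cᵀ * (S ω)ᵀ * S ω * D - Cᵀ * D‖ ≤ ε * ‖C‖ * ‖D‖}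

/-! ### The base sketches -/

/-- The law `μ` of a random function `α → β` is `k`-wise independent: the values at any
at most `k` distinct points are independent and uniformly distributed on `β`. -/
def IsKWiseIndependent (k : ℕ) {α β : Type*} [Fintype β] [MeasurableSpace β]
    (μ : Measure (α → β)) : Prop :=
  ∀ s : Finset α, s.card ≤ k → ∀ v : α → β,
    μ {f | ∀ x ∈ s, f x = v x} = ((Fintype.card β : ℝ≥0∞)⁻¹) ^ s.card

/-- The two values of a sign function. -/
def sgn (b : Bool) : ℝ := if b then 1 else -1

/-- A hash function `[d] → [m]` and a sign function on `[d]`. -/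
abbrev CountSketchSeed (d m : ℕ) : Type := (Fin d → Fin m) × (Fin d → Bool)

/-- The CountSketch matrix. -/
def countSketch {d m : ℕ} (s : CountSketchSeed d m) : Matrix (Fin m) (Fin d) ℝ :=
  Matrix.of fun r i => sgn (s.2 i) * (if s.1 i = r then 1 else 0)

/-- Two hash functions `[d] → [m]` and two sign functions on `[d]`. -/
abbrev TensorSketchSeed (d m : ℕ) : Type :=
  ((Fin d → Fin m) × (Fin d → Fin m)) × ((Fin d → Bool) × (Fin d → Bool))

/-- The matrix of the TensorSketch of degree two. -/
def tensorSketch {d m : ℕ} (s : TensorSketchSeed d m) : Matrix (Fin m) (Fin d × Fin d) ℝ :=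
  Matrix.of fun r ij => sgn (s.2.1 ij.1) * sgn (s.2.2 ij.2) *
    (if ((s.1.1 ij.1 : ℕ) + (s.1.2 ij.2 : ℕ)) % m = (r : ℕ) then 1 else 0)

/-! ### The tree -/

/-- The positions `2 j` and `2 j + 1` of the children of the `j`-th node of level `k`
of a binary tree. -/
def leftChild {k : ℕ} (j : Fin (2 ^ k)) : Fin (2 ^ (k + 1)) :=
  ⟨2 * (j : ℕ), by have := j.2; rw [pow_succ]; omega⟩

/-- See `leftChild`. -/
def rightChild {k : ℕ} (j : Fin (2 ^ k)) : Fin (2 ^ (k + 1)) :=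
  ⟨2 * (j : ℕ) + 1, by have := j.2; rw [pow_succ]; omega⟩

/-- The tensor product of the `2 ^ k` sketches of level `k` (the matrix `S ^ l`, `l = 2 ^ (k+1)`),
which maps tensors of order `2 ^ (k + 1)` to tensors of order `2 ^ k`. -/
def levelSketch {m k : ℕ} (S : Fin (2 ^ k) → Matrix (Fin m) (Fin m × Fin m) ℝ) :
    Matrix (Fin (2 ^ k) → Fin m) (Fin (2 ^ (k + 1)) → Fin m) ℝ :=
  Matrix.of fun r c => ∏ j, S j (r j) (c (leftChild j), c (rightChild j))

/-- The sketch `Q ^ q = S ^ 2 * S ^ 4 * ⋯ * S ^ q` for `q = 2 ^ L`; `Q ^ 1` is the identity. -/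
def treeSketch {m : ℕ} : (L : ℕ) →
    ((k : Fin L) → Fin (2 ^ (k : ℕ)) → Matrix (Fin m) (Fin m × Fin m) ℝ) →
    Matrix (Fin m) (Fin (2 ^ L) → Fin m) ℝ
  | 0, _ => Matrix.of fun r c => if c 0 = r then 1 else 0
  | L + 1, S => treeSketch L (fun k => S k.castSucc) * levelSketch (k := L) (S (Fin.last L))

/-- The tensor product `T ^ q = T₁ × ⋯ × T_q` of the leaf sketches. -/
def leafSketch {q d m : ℕ} (T : Fin q → Matrix (Fin m) (Fin d) ℝ) :
    Matrix (Fin q → Fin m) (Fin q → Fin d) ℝ :=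
  Matrix.of fun r c => ∏ j, T j (r j) (c j)

/-- The internal nodes of the binary tree with `2 ^ L` leaves: level and position. -/
abbrev Node (L : ℕ) : Type := Σ k : Fin L, Fin (2 ^ (k : ℕ))

/-- The random functions used by the sketch: a CountSketch at each leaf and a TensorSketch
of degree two at each internal node. -/
abbrev Seed (L d m : ℕ) : Type :=
  (Fin (2 ^ L) → CountSketchSeed d m) × (Node L → TensorSketchSeed m m)

/-- The sketch `Π ^ q = Q ^ q * T ^ q` for `q = 2 ^ L`. -/
def fullSketch {L d m : ℕ} (s : Seed L d m) : Matrix (Fin m) (Fin (2 ^ L) → Fin d) ℝ :=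
  treeSketch L (fun k j => tensorSketch (s.2 ⟨k, j⟩)) * leafSketch (fun j => countSketch (s.1 j))

/-- The depth `⌈log₂ p⌉` of the tree for tensors of order `p`. -/
abbrev depth (p : ℕ) : ℕ := Nat.clog 2 p

/-- The index of an entry of `v` inside `v ⊗ e₁ ⊗ ⋯ ⊗ e₁`. -/
def padIndex {d : ℕ} [NeZero d] (p q : ℕ) (i : Fin p → Fin d) : Fin q → Fin d :=
  fun t => if h : (t : ℕ) < p then i ⟨t, h⟩ else 0

/-- The sketch `Π ^ p : ℝ ^ (d ^ p) → ℝ ^ m`, `v ↦ Π ^ q (v ⊗ e₁ ^ (q - p))` where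
`q = 2 ^ ⌈log₂ p⌉`, as a matrix; the columns are indexed by multi-indices. -/
def sketch {p d m : ℕ} [NeZero d] (s : Seed (depth p) d m) : Matrix (Fin m) (Fin p → Fin d) ℝ :=
  (fullSketch s).submatrix id (padIndex p (2 ^ depth p))

/-- The distributions of the hash and sign functions of the base sketches: hash functions are
3-wise independent and sign functions are 4-wise independent. -/
structure HashLaws (d m : ℕ) where
  leafHash : Measure (Fin d → Fin m)
  leafSign : Measure (Fin d → Bool)
  nodeHash₁ : Measure (Fin m → Fin m)
  nodeHash₂ : Measure (Fin m → Fin m)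
  nodeSign₁ : Measure (Fin m → Bool)
  nodeSign₂ : Measure (Fin m → Bool)
  leafHash_indep : IsKWiseIndependent 3 leafHash
  leafSign_indep : IsKWiseIndependent 4 leafSign
  nodeHash₁_indep : IsKWiseIndependent 3 nodeHash₁
  nodeHash₂_indep : IsKWiseIndependent 3 nodeHash₂
  nodeSign₁_indep : IsKWiseIndependent 4 nodeSign₁
  nodeSign₂_indep : IsKWiseIndependent 4 nodeSign₂

/-- The law of the functions of one CountSketch. -/
def HashLaws.leafLaw {d m : ℕ} (H : HashLaws d m) : Measure (CountSketchSeed d m) :=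
  H.leafHash.prod H.leafSign

/-- The law of the functions of one TensorSketch. -/
def HashLaws.nodeLaw {d m : ℕ} (H : HashLaws d m) : Measure (TensorSketchSeed m m) :=
  (H.nodeHash₁.prod H.nodeHash₂).prod (H.nodeSign₁.prod H.nodeSign₂)

/-- The law of all the functions in the tree, which are drawn independently. -/
def HashLaws.seedLaw {d m : ℕ} (H : HashLaws d m) (L : ℕ) : Measure (Seed L d m) :=
  (Measure.pi fun _ => H.leafLaw).prod (Measure.pi fun _ => H.nodeLaw)

/-! ### The algorithm -/

/-- The `p`-fold self-tensoring of a vector. -/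
def selfTensor {d : ℕ} (p : ℕ) (x : Fin d → ℝ) : (Fin p → Fin d) → ℝ :=
  fun i => ∏ t, x (i t)

/-- The matrix whose columns are the `p`-fold self-tensorings of the columns of `X`. -/
def selfTensorMatrix {d n : ℕ} (p : ℕ) (X : Matrix (Fin d) (Fin n) ℝ) :
    Matrix (Fin p → Fin d) (Fin n) ℝ :=
  Matrix.of fun i j => selfTensor p (fun a => X a j) i

/-- The main loop: from the bottom level to the root, replace each pair of
neighbouring vectors `u, w` by the sketch of `u ⊗ w`. -/
def combine {m : ℕ} : (L : ℕ) →
    ((k : Fin L) → Fin (2 ^ (k : ℕ)) → Matrix (Fin m) (Fin m × Fin m) ℝ) →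
    (Fin (2 ^ L) → Fin m → ℝ) → Fin m → ℝ
  | 0, _, Y => Y 0
  | L + 1, S, Y => combine L (fun k => S k.castSucc) fun j =>
      S (Fin.last L) j *ᵥ fun ab => Y (leftChild j) ab.1 * Y (rightChild j) ab.2

/-- The recursive sketch of `x ^ ⊗p`: sketch `x` at the first `p` leaves and `e₁` at the others,
then combine up the tree. -/
def algorithm {p d m : ℕ} [NeZero d] (s : Seed (depth p) d m) (x : Fin d → ℝ) : Fin m → ℝ :=
  combine (depth p) (fun k j => tensorSketch (s.2 ⟨k, j⟩)) fun j =>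
    countSketch (s.1 j) *ᵥ (if (j : ℕ) < p then x else Pi.single 0 1)

/-! ### The machine: a real RAM with a step count

Programs of a small imperative language act on natural-number registers and on finitely many
arrays of natural numbers (used for addresses and counters, with addition, truncated subtraction
and halving) and of real numbers (with arithmetic and square roots). Every elementary operation,
memory access and test costs one step. There is no conversion between the two sorts. -/

/-- A memory state. -/
structure Store where
  reg : ℕ → ℕ
  nat : ℕ → ℕ → ℕ
  real : ℕ → ℕ → ℝ

/-- Natural-number expressions. -/
inductive NExpr where
  | const (c : ℕ)
  | reg (i : ℕ)
  | get (a : ℕ) (e : NExpr)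
  | add (e f : NExpr)
  | sub (e f : NExpr)
  | half (e : NExpr)

/-- Real expressions. -/
inductive RExpr where
  | const (c : ℤ)
  | get (a : ℕ) (e : NExpr)
  | add (e f : RExpr)
  | sub (e f : RExpr)
  | mul (e f : RExpr)
  | div (e f : RExpr)
  | sqrt (e : RExpr)

/-- Tests. -/
inductive Test where
  | natLE (e f : NExpr)
  | realLE (e f : RExpr)

def NExpr.eval (s : Store) : NExpr → ℕ
  | .const c => c
  | .reg i => s.reg i
  | .get a e => s.nat a (e.eval s)
  | .add e f => e.eval s + f.eval s
  | .sub e f => e.eval s - f.eval s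
  | .half e => e.eval s / 2

def NExpr.cost : NExpr → ℕ
  | .const _ => 1
  | .reg _ => 1
  | .get _ e => e.cost + 1
  | .add e f => e.cost + f.cost + 1
  | .sub e f => e.cost + f.cost + 1
  | .half e => e.cost + 1

def RExpr.eval (s : Store) : RExpr → ℝ
  | .const c => c
  | .get a e => s.real a (e.eval s)
  | .add e f => e.eval s + f.eval s
  | .sub e f => e.eval s - f.eval s
  | .mul e f => e.eval s * f.eval s
  | .div e f => e.eval s / f.eval s
  | .sqrt e => Real.sqrt (e.eval s)

def RExpr.cost : RExpr → ℕ
  | .const _ => 1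
  | .get _ e => e.cost + 1
  | .add e f => e.cost + f.cost + 1
  | .sub e f => e.cost + f.cost + 1
  | .mul e f => e.cost + f.cost + 1
  | .div e f => e.cost + f.cost + 1
  | .sqrt e => e.cost + 1

def Test.holds (s : Store) : Test → Prop
  | .natLE e f => e.eval s ≤ f.eval s
  | .realLE e f => e.eval s ≤ f.eval s

def Test.cost : Test → ℕ
  | .natLE e f => e.cost + f.cost + 1
  | .realLE e f => e.cost + f.cost + 1

/-- Programs. -/
inductive Prog where
  | nop
  | setReg (i : ℕ) (e : NExpr)
  | setNat (a : ℕ) (idx e : NExpr)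
  | setReal (a : ℕ) (idx : NExpr) (e : RExpr)
  | seq (c c' : Prog)
  | branch (b : Test) (c c' : Prog)
  | loop (b : Test) (c : Prog)

def Store.writeReg (s : Store) (i v : ℕ) : Store :=
  { s with reg := Function.update s.reg i v }

def Store.writeNat (s : Store) (a k v : ℕ) : Store :=
  { s with nat := Function.update s.nat a (Function.update (s.nat a) k v) }

def Store.writeReal (s : Store) (a k : ℕ) (v : ℝ) : Store :=
  { s with real := Function.update s.real a (Function.update (s.real a) k v) }

/-- `Exec c s t s'`: the program `c`, started in `s`, halts in `s'` after `t` steps. -/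
inductive Exec : Prog → Store → ℕ → Store → Prop
  | nop (s : Store) : Exec .nop s 1 s
  | setReg (s : Store) (i : ℕ) (e : NExpr) :
      Exec (.setReg i e) s (e.cost + 1) (s.writeReg i (e.eval s))
  | setNat (s : Store) (a : ℕ) (idx e : NExpr) :
      Exec (.setNat a idx e) s (idx.cost + e.cost + 1) (s.writeNat a (idx.eval s) (e.eval s))
  | setReal (s : Store) (a : ℕ) (idx : NExpr) (e : RExpr) :
      Exec (.setReal a idx e) s (idx.cost + e.cost + 1) (s.writeReal a (idx.eval s) (e.eval s))
  | seq {c c' : Prog} {s s' s'' : Store} {t t' : ℕ} :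
      Exec c s t s' → Exec c' s' t' s'' → Exec (.seq c c') s (t + t') s''
  | branchTrue {b : Test} {c c' : Prog} {s s' : Store} {t : ℕ} :
      b.holds s → Exec c s t s' → Exec (.branch b c c') s (b.cost + t) s'
  | branchFalse {b : Test} {c c' : Prog} {s s' : Store} {t : ℕ} :
      ¬ b.holds s → Exec c' s t s' → Exec (.branch b c c') s (b.cost + t) s'
  | loopFalse {b : Test} {c : Prog} {s : Store} :
      ¬ b.holds s → Exec (.loop b c) s b.cost s
  | loopTrue {b : Test} {c : Prog} {s s' s'' : Store} {t t' : ℕ} :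
      b.holds s → Exec c s t s' → Exec (.loop b c) s' t' s'' →
      Exec (.loop b c) s (b.cost + t + t') s''

/-- The number of nonzero entries. -/
def nnz {d n : ℕ} (X : Matrix (Fin d) (Fin n) ℝ) : ℕ :=
  Set.ncard {ij : Fin d × Fin n | X ij.1 ij.2 ≠ 0}

/-- The input of the computation is stored in `s`: the parameters in registers, `X` in compressed
sparse column format, and the values of the hash and sign functions in tables. The node at
position `j` of level `k` has number `2 ^ k + j`. The rest of the memory is arbitrary. -/
structure Loaded {n p d m : ℕ} (seed : Seed (depth p) d m) (X : Matrix (Fin d) (Fin n) ℝ)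
    (s : Store) : Prop where
  reg_n : s.reg 0 = n
  reg_p : s.reg 1 = p
  reg_d : s.reg 2 = d
  reg_m : s.reg 3 = m
  /-- Array `nat 0` holds the column pointers. -/
  ptr_zero : s.nat 0 0 = 0
  ptr_mono : ∀ j : Fin n, s.nat 0 (j : ℕ) ≤ s.nat 0 ((j : ℕ) + 1)
  /-- Array `nat 1` holds the row indices of the nonzero entries of each column, in some order. -/
  rows : ∀ j : Fin n, Set.BijOn (s.nat 1) (Set.Ico (s.nat 0 (j : ℕ)) (s.nat 0 ((j : ℕ) + 1)))
    {a | ∃ i : Fin d, (i : ℕ) = a ∧ X i j ≠ 0}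
  /-- Array `real 0` holds the corresponding values. -/
  vals : ∀ j : Fin n, ∀ k ∈ Set.Ico (s.nat 0 (j : ℕ)) (s.nat 0 ((j : ℕ) + 1)), ∀ i : Fin d,
    s.nat 1 k = (i : ℕ) → s.real 0 k = X i j
  leafHash : ∀ (j : Fin (2 ^ depth p)) (i : Fin d),
    s.nat 2 ((j : ℕ) * d + i) = ((seed.1 j).1 i : ℕ)
  leafSign : ∀ (j : Fin (2 ^ depth p)) (i : Fin d),
    s.real 1 ((j : ℕ) * d + i) = sgn ((seed.1 j).2 i)
  nodeHash₁ : ∀ (v : Node (depth p)) (i : Fin m),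
    s.nat 3 ((2 ^ (v.1 : ℕ) + (v.2 : ℕ)) * m + i) = ((seed.2 v).1.1 i : ℕ)
  nodeHash₂ : ∀ (v : Node (depth p)) (i : Fin m),
    s.nat 4 ((2 ^ (v.1 : ℕ) + (v.2 : ℕ)) * m + i) = ((seed.2 v).1.2 i : ℕ)
  nodeSign₁ : ∀ (v : Node (depth p)) (i : Fin m),
    s.real 2 ((2 ^ (v.1 : ℕ) + (v.2 : ℕ)) * m + i) = sgn ((seed.2 v).2.1 i)
  nodeSign₂ : ∀ (v : Node (depth p)) (i : Fin m),
    s.real 3 ((2 ^ (v.1 : ℕ) + (v.2 : ℕ)) * m + i) = sgn ((seed.2 v).2.2 i)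

/-- Array `real 4` of `s` holds the matrix `B`, column by column. -/
def HasOutput {n m : ℕ} (B : Matrix (Fin m) (Fin n) ℝ) (s : Store) : Prop :=
  ∀ (j : Fin n) (r : Fin m), s.real 4 ((j : ℕ) * m + r) = B r j

end TreeSketch

end

noncomputable section

namespace TreeSketch

/-! ### Limited independence -/

section Independence

variable {α β : Type*} [Fintype β] [MeasurableSpace β] {k : ℕ} {μ : Measure (α → β)}

/-! Probability. Everything rests on one property of a random matrix, `MomentBound`: squared norms
are preserved in mean and E|Sx|⁴ ≤ K|x|⁴. For a CountSketch or a TensorSketch, |Sx|² - |x|² is a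
signed sum over colliding pairs of distinct columns. It has mean zero, and its second moment is at
most 1/m times 3|x|⁴ or 9|x|⁴, because a collision has probability at most 1/m and a fourth-order
product of signs has nonzero mean only when its indices pair up. The property multiplies under
products of independent matrices (condition on the inner one), and `1 ⊗ S` keeps the same K, by
Cauchy-Schwarz applied to the blocks. Since S ⊗ T = (S ⊗ 1)(1 ⊗ T), the tree of q leaves and q - 1
internal nodes has K ≤ (1 + 9/m)^(2q-1). As q < 2p, this is 1 + O(p/m) once m ≥ 36p.

With K = 1 + η, polarization gives E(⟨Sx,Sy⟩ - ⟨x,y⟩)² ≤ 2η|x|²|y|². Summing over pairs of columns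
and applying Markov's inequality yields approximate matrix products. For the embedding, write AᵀA +
λI = BᵀB and C = AB⁻¹. Then ‖C‖_F² is the statistical dimension, and an approximate product CᵀC with
relative error ε/s_λ bounds the error of every quadratic form by ε.

Computation. A Kronecker product acts factor by factor on a product tensor, so Πᵖ applied to x^⊗p is
evaluated along the tree (`sketch_mulVec_selfTensor`). A TensorSketch of u ⊗ w is the cyclic
convolution of two CountSketches (`tensorSketch_mulVec`). It comes from a single complex Fourier
transform: u goes into the real part and w into the imaginary part, the transform is squared and
inverted, and half the imaginary part is the convolution (`im_inv_sq_fwd`). The roots of unity are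
built by half-angle square roots. The forward transform is shown to evaluate a polynomial
(`sum_fwd`); the inverse merely undoes it step by step.

The program is verified in a small logic of triples with time bounds, `Runs`. Syntactic write sets
(`Frame`) carry over all untouched memory. Each column costs O(q m log(2m)) for the internal nodes
and O(q (m + nnz)) for the leaves, with nnz counted in that column. -/

theorem IsKWiseIndependent.isProbabilityMeasure [Nonempty β] (h : IsKWiseIndependent k μ) :
    IsProbabilityMeasure μ := by
  constructor
  simpa using h ∅ (by simp) (fun _ => Classical.arbitrary β)

variable [Fintype α] [DecidableEq α] [MeasurableSingletonClass β]

/-- The expectation of a function of few values is the average over all values. -/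
theorem IsKWiseIndependent.integral_eq_sum [DecidableEq β] (h : IsKWiseIndependent k μ)
    [IsProbabilityMeasure μ] (s : Finset α) (hs : s.card ≤ k) (b : β) (F : (α → β) → ℝ)
    (hF : ∀ f g : α → β, (∀ x ∈ s, f x = g x) → F f = F g) :
    ∫ f, F f ∂μ = ((Fintype.card β : ℝ)⁻¹) ^ s.card *
      ∑ v : s → β, F (fun x => if hx : x ∈ s then v ⟨x, hx⟩ else b) := by
  -- The default value `b` outside `s` is immaterial, since `F` depends only on the values on `s`.
  set ext : (s → β) → α → β := fun v x => if hx : x ∈ s then v ⟨x, hx⟩ else b with hext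
  have hdec : ∀ f, F f = ∑ v : s → β,
      Set.indicator {f : α → β | ∀ x ∈ s, f x = ext v x} (fun _ => F (ext v)) f := by
    intro f
    rw [Finset.sum_eq_single (fun x : s => f x)]
    · rw [Set.indicator_of_mem]
      · apply hF
        intro x hx
        simp [hext, hx]
      · intro x hx
        simp [hext, hx]
    · intro v _ hv
      rw [Set.indicator_of_notMem]
      intro hmem
      apply hv
      funext x
      have := hmem x.1 x.2
      simp only [hext, x.2, dif_pos] at this
      exact this.symm
    · simp
  rw [integral_congr_ae (Filter.Eventually.of_forall hdec),
    integral_finsetSum _ (fun _ _ => Integrable.of_finite), Finset.mul_sum]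
  refine Finset.sum_congr rfl fun v _ => ?_
  rw [integral_indicator_const _ (Set.toFinite _).measurableSet, Measure.real, h s hs]
  simp [ext]

/-- Each pair of values has probability |β|⁻², and `R` contains at most one pair for each first
value, hence at most |β| pairs. A general relation replaces equality because collisions of a
TensorSketch, with one hash function fixed, are equalities up to a shift. -/
theorem IsKWiseIndependent.integral_rel_le (h : IsKWiseIndependent k μ) [IsProbabilityMeasure μ]
    (hk : 2 ≤ k) {x y : α} (hxy : x ≠ y) (R : β → β → Prop) [DecidableRel R]
    (hR : ∀ u v v', R u v → R u v' → v = v') :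
    ∫ f, (if R (f x) (f y) then (1 : ℝ) else 0) ∂μ ≤ (Fintype.card β : ℝ)⁻¹ := by
  classical
  have hdec : ∀ f : α → β, (if R (f x) (f y) then (1 : ℝ) else 0) = ∑ u : β, ∑ v : β,
      if R u v then Set.indicator {f : α → β | f x = u ∧ f y = v} (fun _ => (1 : ℝ)) f else 0 := by
    intro f
    rw [Finset.sum_eq_single (f x), Finset.sum_eq_single (f y)]
    · simp
    · intro v _ hv
      rw [Set.indicator_of_notMem, ite_self]
      exact fun hm => hv hm.2.symm
    · simp
    · intro u _ hu
      refine Finset.sum_eq_zero fun v _ => ?_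
      rw [Set.indicator_of_notMem, ite_self]
      exact fun hm => hu hm.1.symm
    · simp
  have hm : ∀ u v : β, μ.real {f : α → β | f x = u ∧ f y = v} = ((Fintype.card β : ℝ)⁻¹) ^ 2 := by
    intro u v
    have h2 := h {x, y} (by rw [Finset.card_pair hxy]; exact hk) (fun z => if z = x then u else v)
    rw [Finset.card_pair hxy] at h2
    have hset : {f : α → β | f x = u ∧ f y = v} =
        {f : α → β | ∀ z ∈ ({x, y} : Finset α), f z = if z = x then u else v} := by
      ext f
      simp [hxy.symm]
    rw [hset, Measure.real, h2]
    simp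
  rw [integral_congr_ae (Filter.Eventually.of_forall hdec),
    integral_finsetSum _ (fun _ _ => Integrable.of_finite)]
  have hu : ∀ u : β, ∫ f : α → β, ∑ v : β,
      (if R u v then Set.indicator {f : α → β | f x = u ∧ f y = v} (fun _ => (1 : ℝ)) f else 0) ∂μ
      ≤ ((Fintype.card β : ℝ)⁻¹) ^ 2 := by
    intro u
    rw [integral_finsetSum _ (fun _ _ => Integrable.of_finite)]
    have : ∀ v : β, ∫ f : α → β,
        (if R u v then Set.indicator {f : α → β | f x = u ∧ f y = v} (fun _ => (1 : ℝ)) f else 0) ∂μ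
        = if R u v then ((Fintype.card β : ℝ)⁻¹) ^ 2 else 0 := by
      intro v
      split_ifs
      · rw [integral_indicator_const _ (Set.toFinite _).measurableSet, hm]
        simp
      · simp
    simp only [this]
    rw [← Finset.sum_filter, Finset.sum_const, nsmul_eq_mul]
    have hc : (Finset.univ.filter (R u)).card ≤ 1 := by
      rw [Finset.card_le_one]
      intro a ha b hb
      simp only [Finset.mem_filter, Finset.mem_univ, true_and] at ha hb
      exact hR u a b ha hb
    have hc' : ((Finset.univ.filter (R u)).card : ℝ) ≤ 1 := by exact_mod_cast hc
    have : 0 ≤ ((Fintype.card β : ℝ)⁻¹) ^ 2 := by positivity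
    nlinarith
  refine (Finset.sum_le_sum fun u _ => hu u).trans ?_
  rw [Finset.sum_const, Finset.card_univ, nsmul_eq_mul, pow_two, ← mul_assoc]
  rcases eq_or_ne (Fintype.card β : ℝ) 0 with h0 | h0
  · simp [h0]
  · rw [mul_inv_cancel₀ h0, one_mul]

end Independence

/-! ### Fourth order products of signs -/

theorem sgn_mul_self (b : Bool) : sgn b * sgn b = 1 := by cases b <;> simp [sgn]

theorem abs_sgn (b : Bool) : |sgn b| = 1 := by cases b <;> simp [sgn]

/-- The number of ways in which four points fall into two pairs of equal points. -/
def pairings {α : Type*} [DecidableEq α] (a b c d : α) : ℝ :=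
  (if a = b ∧ c = d then 1 else 0) + (if a = c ∧ b = d then 1 else 0) +
    (if a = d ∧ b = c then 1 else 0)

theorem pairings_nonneg {α : Type*} [DecidableEq α] (a b c d : α) : 0 ≤ pairings a b c d := by
  unfold pairings
  positivity

theorem one_le_pairings {α : Type*} [DecidableEq α] {a b c d : α}
    (h : (a = b ∧ c = d) ∨ (a = c ∧ b = d) ∨ (a = d ∧ b = c)) : 1 ≤ pairings a b c d := by
  unfold pairings
  have p : ∀ (q : Prop) [Decidable q], (0 : ℝ) ≤ if q then 1 else 0 := by
    intro q _
    positivity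
  rcases h with h | h | h
  · rw [if_pos h]; linarith [p (a = c ∧ b = d), p (a = d ∧ b = c)]
  · rw [if_pos h]; linarith [p (a = b ∧ c = d), p (a = d ∧ b = c)]
  · rw [if_pos h]; linarith [p (a = c ∧ b = d), p (a = b ∧ c = d)]

section Signs

variable {α : Type*} [Fintype α] [DecidableEq α] {μ : Measure (α → Bool)}

/-- Flipping the value at the isolated point `a` is an involution on the assignments that reverses
the sign of the product. -/
theorem IsKWiseIndependent.integral_sgn_eq_zero (h : IsKWiseIndependent 4 μ) {a b c d : α}
    (hb : a ≠ b) (hc : a ≠ c) (hd : a ≠ d) :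
    ∫ f, sgn (f a) * sgn (f b) * sgn (f c) * sgn (f d) ∂μ = 0 := by
  have := h.isProbabilityMeasure
  rw [h.integral_eq_sum {a, b, c, d} Finset.card_le_four false]
  · rw [mul_eq_zero]
    right
    have ha : a ∈ ({a, b, c, d} : Finset α) := by simp
    refine Finset.sum_involution (fun v _ => Function.update v ⟨a, ha⟩ (!v ⟨a, ha⟩)) ?_ ?_
      (fun _ _ => Finset.mem_univ _) ?_
    · intro v _
      have hneg : ∀ t : Bool, sgn (!t) = - sgn t := by intro t; cases t <;> simp [sgn]
      simp [hb.symm, hc.symm, hd.symm, hneg]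
    · intro v _ _ heq
      have := congrFun heq ⟨a, ha⟩
      simp at this
    · intro v _
      simp
  · intro f g hfg
    rw [hfg a (by simp), hfg b (by simp), hfg c (by simp), hfg d (by simp)]

/-- Either the four points split into two equal pairs, and the trivial bound one suffices, or one of
them differs from the other three and the integral vanishes. -/
theorem IsKWiseIndependent.abs_integral_sgn_le (h : IsKWiseIndependent 4 μ) (a b c d : α) :
    |∫ f, sgn (f a) * sgn (f b) * sgn (f c) * sgn (f d) ∂μ| ≤ pairings a b c d := by
  have := h.isProbabilityMeasure
  by_cases hp : (a = b ∧ c = d) ∨ (a = c ∧ b = d) ∨ (a = d ∧ b = c)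
  · refine le_trans ?_ (one_le_pairings hp)
    refine (abs_integral_le_integral_abs).trans ?_
    simp [abs_mul, abs_sgn]
  · have h0 : ∫ f, sgn (f a) * sgn (f b) * sgn (f c) * sgn (f d) ∂μ = 0 := by
      by_cases h1 : a ≠ b ∧ a ≠ c ∧ a ≠ d
      · exact h.integral_sgn_eq_zero h1.1 h1.2.1 h1.2.2
      by_cases h2 : b ≠ a ∧ b ≠ c ∧ b ≠ d
      · rw [← h.integral_sgn_eq_zero h2.1 h2.2.1 h2.2.2]
        congr 1; ext f; ring
      by_cases h3 : c ≠ a ∧ c ≠ b ∧ c ≠ d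
      · rw [← h.integral_sgn_eq_zero h3.1 h3.2.1 h3.2.2]
        congr 1; ext f; ring
      by_cases h4 : d ≠ a ∧ d ≠ b ∧ d ≠ c
      · rw [← h.integral_sgn_eq_zero h4.1 h4.2.1 h4.2.2]
        congr 1; ext f; ring
      -- If each of the four points equals another one, they split into two equal pairs, contrary to
      -- `hp`.
      · exfalso
        grind
    rw [h0, abs_zero]
    exact pairings_nonneg a b c d

end Signs

/-- Each of the three pairings turns the fourfold sum into a product of two inner products, to which
Cauchy-Schwarz applies. Four different functions are allowed so that the bound can be used on slices
of a function of two variables. -/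
theorem sum_pairings_le {α : Type*} [Fintype α] [DecidableEq α] (f g h k : α → ℝ) :
    ∑ a, ∑ b, ∑ c, ∑ d, pairings a b c d * (f a * g b * h c * k d) ≤
      3 * (√(∑ a, f a ^ 2) * √(∑ a, g a ^ 2) * √(∑ a, h a ^ 2) * √(∑ a, k a ^ 2)) := by
  have key : ∑ a, ∑ b, ∑ c, ∑ d, pairings a b c d * (f a * g b * h c * k d) =
      (∑ a, f a * g a) * (∑ c, h c * k c) + (∑ a, f a * h a) * (∑ b, g b * k b) +
      (∑ a, f a * k a) * (∑ b, g b * h b) := by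
    simp only [pairings, add_mul, ite_and, ite_mul, one_mul, zero_mul, Finset.sum_add_distrib,
      Finset.sum_mul_sum]
    congr 1
    · congr 1
      · refine Finset.sum_congr rfl fun a _ => ?_
        rw [Finset.sum_eq_single a]
        · simp only [if_true, Finset.sum_ite_eq, Finset.mem_univ]
          exact Finset.sum_congr rfl fun c _ => by ring
        · intro b _ hb
          simp [hb.symm]
        · simp
      · refine Finset.sum_congr rfl fun a _ => ?_
        refine Finset.sum_congr rfl fun b _ => ?_
        rw [Finset.sum_eq_single a]
        · simp only [if_true, Finset.sum_ite_eq, Finset.mem_univ]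
          ring
        · intro b _ hb
          simp [hb.symm]
        · simp
    · refine Finset.sum_congr rfl fun a _ => ?_
      refine Finset.sum_congr rfl fun b _ => ?_
      rw [Finset.sum_eq_single b]
      · simp only [if_true, Finset.sum_ite_eq, Finset.mem_univ]
        ring
      · intro c _ hc
        simp [hc.symm]
      · simp
  have cs : ∀ u v : α → ℝ, |∑ a, u a * v a| ≤ √(∑ a, u a ^ 2) * √(∑ a, v a ^ 2) := by
    intro u v
    rw [abs_le]
    constructor
    · have := Real.sum_mul_le_sqrt_mul_sqrt Finset.univ (fun a => - u a) v
      simp only [neg_mul, Finset.sum_neg_distrib, neg_sq] at this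
      linarith
    · exact Real.sum_mul_le_sqrt_mul_sqrt Finset.univ u v
  have pr : ∀ u v w z : α → ℝ, (∑ a, u a * v a) * (∑ a, w a * z a) ≤
      (√(∑ a, u a ^ 2) * √(∑ a, v a ^ 2)) * (√(∑ a, w a ^ 2) * √(∑ a, z a ^ 2)) := by
    intro u v w z
    refine (le_abs_self _).trans ?_
    rw [abs_mul]
    exact mul_le_mul (cs u v) (cs w z) (abs_nonneg _) (by positivity)
  rw [key]
  linarith [pr f g h k, pr f h g k, pr f k g h]

/-- With the second coordinates fixed, the one-variable bound applies to four slices of `y` and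
leaves the product of their norms. Applied again to the function `z` of slice norms, it gives 9 = 3
· 3. -/
theorem sum_pairings_mul_pairings_le {α β : Type*} [Fintype α] [DecidableEq α] [Fintype β]
    [DecidableEq β] (y : α × β → ℝ) :
    ∑ a, ∑ b, ∑ c, ∑ d, pairings a.1 b.1 c.1 d.1 * pairings a.2 b.2 c.2 d.2 *
      (y a * y b * y c * y d) ≤ 9 * (∑ a, y a ^ 2) ^ 2 := by
  set z : β → ℝ := fun u => √(∑ i, y (i, u) ^ 2) with hz
  have hre : ∑ a, ∑ b, ∑ c, ∑ d, pairings a.1 b.1 c.1 d.1 * pairings a.2 b.2 c.2 d.2 *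
      (y a * y b * y c * y d) = ∑ a2, ∑ b2, ∑ c2, ∑ d2, pairings a2 b2 c2 d2 *
      ∑ a1, ∑ b1, ∑ c1, ∑ d1, pairings a1 b1 c1 d1 *
        (y (a1, a2) * y (b1, b2) * y (c1, c2) * y (d1, d2)) := by
    simp only [Fintype.sum_prod_type_right, Finset.mul_sum]
    refine Finset.sum_congr rfl fun a2 _ => ?_
    rw [Finset.sum_comm]
    refine Finset.sum_congr rfl fun b2 _ => ?_
    have : ∀ (F : α → α → β → α → β → α → ℝ), ∑ a1, ∑ b1, ∑ c2, ∑ c1, ∑ d2, ∑ d1,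
        F a1 b1 c2 c1 d2 d1 = ∑ c2, ∑ d2, ∑ a1, ∑ b1, ∑ c1, ∑ d1, F a1 b1 c2 c1 d2 d1 := by
      intro F
      calc _ = ∑ a1, ∑ c2, ∑ b1, ∑ c1, ∑ d2, ∑ d1, F a1 b1 c2 c1 d2 d1 :=
            Finset.sum_congr rfl fun a1 _ => Finset.sum_comm
        _ = ∑ c2, ∑ a1, ∑ b1, ∑ c1, ∑ d2, ∑ d1, F a1 b1 c2 c1 d2 d1 := Finset.sum_comm
        _ = ∑ c2, ∑ a1, ∑ b1, ∑ d2, ∑ c1, ∑ d1, F a1 b1 c2 c1 d2 d1 :=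
            Finset.sum_congr rfl fun c2 _ => Finset.sum_congr rfl fun a1 _ =>
              Finset.sum_congr rfl fun b1 _ => Finset.sum_comm
        _ = ∑ c2, ∑ a1, ∑ d2, ∑ b1, ∑ c1, ∑ d1, F a1 b1 c2 c1 d2 d1 :=
            Finset.sum_congr rfl fun c2 _ => Finset.sum_congr rfl fun a1 _ => Finset.sum_comm
        _ = _ := Finset.sum_congr rfl fun c2 _ => Finset.sum_comm
    rw [this]
    refine Finset.sum_congr rfl fun c2 _ => Finset.sum_congr rfl fun d2 _ => ?_
    refine Finset.sum_congr rfl fun a1 _ => Finset.sum_congr rfl fun b1 _ => ?_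
    refine Finset.sum_congr rfl fun c1 _ => Finset.sum_congr rfl fun d1 _ => ?_
    ring
  have hz2 : ∑ u, z u ^ 2 = ∑ a, y a ^ 2 := by
    rw [Fintype.sum_prod_type_right]
    refine Finset.sum_congr rfl fun u _ => ?_
    rw [hz]
    exact Real.sq_sqrt (Finset.sum_nonneg fun _ _ => sq_nonneg _)
  rw [hre]
  calc _ ≤ ∑ a2, ∑ b2, ∑ c2, ∑ d2, pairings a2 b2 c2 d2 * (3 * (z a2 * z b2 * z c2 * z d2)) := by
        refine Finset.sum_le_sum fun a2 _ => Finset.sum_le_sum fun b2 _ =>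
          Finset.sum_le_sum fun c2 _ => Finset.sum_le_sum fun d2 _ => ?_
        exact mul_le_mul_of_nonneg_left (sum_pairings_le _ _ _ _) (pairings_nonneg _ _ _ _)
    _ = 3 * ∑ a2, ∑ b2, ∑ c2, ∑ d2, pairings a2 b2 c2 d2 * (z a2 * z b2 * z c2 * z d2) := by
        simp only [Finset.mul_sum]
        refine Finset.sum_congr rfl fun a2 _ => Finset.sum_congr rfl fun b2 _ =>
          Finset.sum_congr rfl fun c2 _ => Finset.sum_congr rfl fun d2 _ => by ring
    _ ≤ 3 * (3 * (√(∑ u, z u ^ 2) * √(∑ u, z u ^ 2) * √(∑ u, z u ^ 2) * √(∑ u, z u ^ 2))) := by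
        gcongr
        exact sum_pairings_le z z z z
    _ = 9 * (∑ a, y a ^ 2) ^ 2 := by
        rw [hz2, Real.mul_self_sqrt (Finset.sum_nonneg fun _ _ => sq_nonneg _), mul_assoc,
          Real.mul_self_sqrt (Finset.sum_nonneg fun _ _ => sq_nonneg _)]
        ring

theorem sum_pairings_self_le {α : Type*} [Fintype α] [DecidableEq α] (y : α → ℝ) :
    ∑ a, ∑ b, ∑ c, ∑ d, pairings a b c d * (y a * y b * y c * y d) ≤ 3 * (∑ a, y a ^ 2) ^ 2 := by
  refine (sum_pairings_le y y y y).trans_eq ?_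
  rw [Real.mul_self_sqrt (Finset.sum_nonneg fun _ _ => sq_nonneg _), mul_assoc,
    Real.mul_self_sqrt (Finset.sum_nonneg fun _ _ => sq_nonneg _)]
  ring

/-! ### Second and fourth moments of random matrices -/

/-- The random matrix `S` preserves squared norms in expectation, and increases the second
moments of squared norms by a factor of at most `K`. -/
structure MomentBound {Ω : Type*} [MeasurableSpace Ω] (P : Measure Ω) {ρ γ : Type*} [Fintype ρ]
    [Fintype γ] (S : Ω → Matrix ρ γ ℝ) (K : ℝ) : Prop where
  second : ∀ x : γ → ℝ, ∫ ω, (S ω *ᵥ x) ⬝ᵥ (S ω *ᵥ x) ∂P = x ⬝ᵥ x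
  fourth : ∀ x : γ → ℝ, ∫ ω, ((S ω *ᵥ x) ⬝ᵥ (S ω *ᵥ x)) ^ 2 ∂P ≤ K * (x ⬝ᵥ x) ^ 2

theorem dotProduct_self_nonneg' {ι : Type*} [Fintype ι] (x : ι → ℝ) : 0 ≤ x ⬝ᵥ x :=
  Finset.sum_nonneg fun _ _ => mul_self_nonneg _

section SignedHash

variable {Ω₁ Ω₂ α ρ : Type*} [Finite Ω₁] [MeasurableSpace Ω₁] [MeasurableSingletonClass Ω₁]
  [Finite Ω₂] [MeasurableSpace Ω₂] [MeasurableSingletonClass Ω₂] [Fintype α] [DecidableEq α]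
  [Fintype ρ] [DecidableEq ρ]

/-- Two columns overlap exactly when they are hashed to the same row. The diagonal pairs reproduce
the squared norm because signs square to one, so all the noise comes from collisions of distinct
columns. -/
theorem signedHash_dotProduct (h : α → ρ) (s x : α → ℝ) (hs : ∀ a, s a * s a = 1) :
    ((Matrix.of fun r a => s a * if h a = r then 1 else 0) *ᵥ x) ⬝ᵥ
      ((Matrix.of fun r a => s a * if h a = r then 1 else 0) *ᵥ x) =
    x ⬝ᵥ x + ∑ a, ∑ b, (if a ≠ b ∧ h a = h b then 1 else 0) * (s a * s b) * (x a * x b) := by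
  have h1 : ((Matrix.of fun r a => s a * if h a = r then 1 else 0) *ᵥ x) ⬝ᵥ
      ((Matrix.of fun r a => s a * if h a = r then 1 else 0) *ᵥ x) =
      ∑ a, ∑ b, (if h a = h b then 1 else 0) * (s a * s b) * (x a * x b) := by
    simp only [dotProduct, Matrix.mulVec, Matrix.of_apply, Finset.sum_mul_sum]
    rw [Finset.sum_comm]
    refine Finset.sum_congr rfl fun a _ => ?_
    rw [Finset.sum_comm]
    refine Finset.sum_congr rfl fun b _ => ?_
    rw [Finset.sum_eq_single (h a)]
    · by_cases hab : h a = h b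
      · simp [hab]; ring
      · simp [hab, Ne.symm hab]
    · intro r _ hr
      simp [hr.symm]
    · simp
  have h2 : x ⬝ᵥ x = ∑ a, ∑ b, if a = b then x a * x b else 0 := by
    simp [dotProduct]
  rw [h1, h2, ← Finset.sum_add_distrib]
  refine Finset.sum_congr rfl fun a _ => ?_
  rw [← Finset.sum_add_distrib]
  refine Finset.sum_congr rfl fun b _ => ?_
  by_cases hab : a = b
  · subst hab
    simp [hs]
  · simp [hab]

/-- The moments of a matrix with one random sign in a random position of each column. -/
theorem momentBound_signedHash (μ : Measure Ω₁) (ν : Measure Ω₂) [IsProbabilityMeasure μ]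
    [IsProbabilityMeasure ν] (h : Ω₁ → α → ρ) (s : Ω₂ → α → ℝ) (hs : ∀ ω a, s ω a * s ω a = 1)
    (hs2 : ∀ a b, a ≠ b → ∫ ω, s ω a * s ω b ∂ν = 0) (w : α → α → α → α → ℝ)
    (hw : ∀ a b c d, |∫ ω, s ω a * s ω b * (s ω c * s ω d) ∂ν| ≤ w a b c d) {κ δ : ℝ}
    (hδ : 0 ≤ δ)
    (hκ : ∀ y : α → ℝ, ∑ a, ∑ b, ∑ c, ∑ d, w a b c d * (y a * y b * y c * y d) ≤
      κ * (∑ a, y a ^ 2) ^ 2)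
    (hh : ∀ a b, a ≠ b → ∫ ω, (if h ω a = h ω b then (1 : ℝ) else 0) ∂μ ≤ δ) :
    MomentBound (μ.prod ν)
      (fun ω => Matrix.of fun r a => s ω.2 a * if h ω.1 a = r then 1 else 0) (1 + κ * δ) := by
  set N : Ω₁ → α → α → ℝ := fun ω a b => if a ≠ b ∧ h ω a = h ω b then 1 else 0 with hN
  have hN0 : ∀ ω a b, 0 ≤ N ω a b := by
    intro ω a b
    simp only [hN]
    positivity
  have hN1 : ∀ ω a b, N ω a b ≤ 1 := by
    intro ω a b
    simp only [hN]
    split_ifs <;> norm_num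
  have hNE : ∀ a b, ∫ ω, N ω a b ∂μ ≤ δ := by
    intro a b
    by_cases hab : a = b
    · simpa [hN, hab] using hδ
    · simpa [hN, hab] using hh a b hab
  -- The noise has mean zero: positions and signs are independent, and the signs of distinct columns
  -- are uncorrelated. Hence the mixed term of the squared norm also vanishes below.
  have hZ : ∀ x : α → ℝ, ∫ ω, ∑ a, ∑ b, N ω.1 a b * (s ω.2 a * s ω.2 b) * (x a * x b)
      ∂(μ.prod ν) = 0 := by
    intro x
    rw [integral_finsetSum _ fun _ _ => Integrable.of_finite]
    refine Finset.sum_eq_zero fun a _ => ?_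
    rw [integral_finsetSum _ fun _ _ => Integrable.of_finite]
    refine Finset.sum_eq_zero fun b _ => ?_
    rw [integral_mul_const, integral_prod_mul (fun ω => N ω a b) (fun ω => s ω a * s ω b)]
    by_cases hab : a = b
    · simp [hN, hab]
    · rw [hs2 a b hab]; simp
  have hdot : ∀ (x : α → ℝ) (ω : Ω₁ × Ω₂), _ = _ := fun x ω =>
    signedHash_dotProduct (h ω.1) (s ω.2) x (hs ω.2)
  refine ⟨fun x => ?_, fun x => ?_⟩
  · simp only [hdot]
    rw [integral_add Integrable.of_finite Integrable.of_finite]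
    have := hZ x
    simp only [hN] at this
    rw [this]
    simp
  · have hsq : ∀ ω : Ω₁ × Ω₂, (((Matrix.of fun r a => s ω.2 a * if h ω.1 a = r then 1 else 0) *ᵥ x)
        ⬝ᵥ ((Matrix.of fun r a => s ω.2 a * if h ω.1 a = r then 1 else 0) *ᵥ x)) ^ 2 =
        (x ⬝ᵥ x) ^ 2 + 2 * (x ⬝ᵥ x) *
          (∑ a, ∑ b, N ω.1 a b * (s ω.2 a * s ω.2 b) * (x a * x b)) +
        ∑ a, ∑ b, ∑ c, ∑ d, (N ω.1 a b * N ω.1 c d) *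
          (s ω.2 a * s ω.2 b * (s ω.2 c * s ω.2 d)) * (x a * x b * (x c * x d)) := by
      intro ω
      rw [hdot x ω]
      have : (∑ a, ∑ b, N ω.1 a b * (s ω.2 a * s ω.2 b) * (x a * x b)) ^ 2 =
          ∑ a, ∑ b, ∑ c, ∑ d, (N ω.1 a b * N ω.1 c d) *
          (s ω.2 a * s ω.2 b * (s ω.2 c * s ω.2 d)) * (x a * x b * (x c * x d)) := by
        rw [pow_two]
        simp only [Finset.sum_mul, Finset.mul_sum]
        refine Finset.sum_congr rfl fun a _ => Finset.sum_congr rfl fun b _ =>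
          Finset.sum_congr rfl fun c _ => Finset.sum_congr rfl fun d _ => by ring
      rw [← this]
      simp only [hN]
      ring
    simp only [hsq]
    rw [integral_add Integrable.of_finite Integrable.of_finite,
      integral_add Integrable.of_finite Integrable.of_finite, integral_const_mul, hZ x]
    -- The product of two collision indicators is at most the first one, whose mean is at most `δ`,
    -- so no joint collision probability is needed. Absolute values of the entries appear because
    -- the sign moments are bounded only in absolute value.
    have h4 : ∫ ω : Ω₁ × Ω₂, ∑ a, ∑ b, ∑ c, ∑ d, (N ω.1 a b * N ω.1 c d) *
          (s ω.2 a * s ω.2 b * (s ω.2 c * s ω.2 d)) * (x a * x b * (x c * x d)) ∂(μ.prod ν) ≤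
        ∑ a, ∑ b, ∑ c, ∑ d, δ * (w a b c d * (|x a| * |x b| * |x c| * |x d|)) := by
      rw [integral_finsetSum _ fun _ _ => Integrable.of_finite]
      refine Finset.sum_le_sum fun a _ => ?_
      rw [integral_finsetSum _ fun _ _ => Integrable.of_finite]
      refine Finset.sum_le_sum fun b _ => ?_
      rw [integral_finsetSum _ fun _ _ => Integrable.of_finite]
      refine Finset.sum_le_sum fun c _ => ?_
      rw [integral_finsetSum _ fun _ _ => Integrable.of_finite]
      refine Finset.sum_le_sum fun d _ => ?_
      rw [integral_mul_const, integral_prod_mul (fun ω => N ω a b * N ω c d)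
        (fun ω => s ω a * s ω b * (s ω c * s ω d))]
      refine (le_abs_self _).trans ?_
      have hNN0 : 0 ≤ ∫ ω, N ω a b * N ω c d ∂μ :=
        integral_nonneg fun ω => mul_nonneg (hN0 ω a b) (hN0 ω c d)
      have hNN : ∫ ω, N ω a b * N ω c d ∂μ ≤ δ :=
        (integral_mono Integrable.of_finite Integrable.of_finite
          fun ω => mul_le_of_le_one_right (hN0 ω a b) (hN1 ω c d)).trans (hNE a b)
      rw [abs_mul, abs_mul, abs_of_nonneg hNN0]
      have e : |x a * x b * (x c * x d)| = |x a| * |x b| * |x c| * |x d| := by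
        simp only [abs_mul]; ring
      rw [e, ← mul_assoc δ]
      gcongr
      exact hw a b c d
    have h5 := hκ fun a => |x a|
    simp only [sq_abs] at h5
    simp only [← Finset.mul_sum] at h4
    have h6 : x ⬝ᵥ x = ∑ a, x a ^ 2 := by simp [dotProduct, pow_two]
    rw [← h6] at h5
    have h7 := mul_le_mul_of_nonneg_left h5 hδ
    simp only [integral_const, probReal_univ, smul_eq_mul, one_mul, mul_zero, add_zero]
    linarith

end SignedHash

/-! ### Moments of CountSketch and TensorSketch. -/

theorem momentBound_countSketch {d m : ℕ} (hm : 0 < m) {μ : Measure (Fin d → Fin m)}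
    {ν : Measure (Fin d → Bool)} (hμ : IsKWiseIndependent 3 μ) (hν : IsKWiseIndependent 4 ν) :
    MomentBound (μ.prod ν) (fun s : CountSketchSeed d m => countSketch s) (1 + 3 * (m : ℝ)⁻¹) := by
  have : Nonempty (Fin m) := ⟨⟨0, hm⟩⟩
  have := hμ.isProbabilityMeasure
  have := hν.isProbabilityMeasure
  refine momentBound_signedHash μ ν (fun h => h) (fun f a => sgn (f a))
    (fun _ _ => sgn_mul_self _) ?_ pairings ?_ (by positivity) (fun y => sum_pairings_self_le y) ?_
  · intro a b hab
    -- A second-order moment is a fourth-order one with `b` taken three times, since signs square to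
    -- one.
    have := hν.integral_sgn_eq_zero hab hab hab
    rw [← this]
    congr 1
    ext f
    rw [mul_assoc, mul_assoc, sgn_mul_self, mul_one]
  · intro a b c d
    simpa only [mul_assoc] using hν.abs_integral_sgn_le a b c d
  · intro a b hab
    have := hμ.integral_rel_le (by norm_num) hab (fun u v => u = v) (by
      rintro u v v' rfl rfl; rfl)
    simpa using this

/-- For a fixed second hash function, a collision says that the two values of the first one differ
by a given shift modulo m, so each value determines the other. -/
theorem integral_add_mod_le {d m : ℕ} {μ₁ μ₂ : Measure (Fin d → Fin m)}
    [IsProbabilityMeasure μ₁] [IsProbabilityMeasure μ₂] (h₁ : IsKWiseIndependent 3 μ₁)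
    {a b : Fin d × Fin d} (hab : a.1 ≠ b.1) :
    ∫ h, (if ((h.1 a.1 : ℕ) + (h.2 a.2 : ℕ)) % m = ((h.1 b.1 : ℕ) + (h.2 b.2 : ℕ)) % m
      then (1 : ℝ) else 0) ∂(μ₁.prod μ₂) ≤ (m : ℝ)⁻¹ := by
  rw [integral_prod_symm _ Integrable.of_finite]
  have hy : ∀ y : Fin d → Fin m, ∫ x : Fin d → Fin m,
      (if ((x a.1 : ℕ) + (y a.2 : ℕ)) % m = ((x b.1 : ℕ) + (y b.2 : ℕ)) % m
        then (1 : ℝ) else 0) ∂μ₁ ≤ (m : ℝ)⁻¹ := by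
    intro y
    have := h₁.integral_rel_le (by norm_num) hab
      (fun u v => ((u : ℕ) + (y a.2 : ℕ)) % m = ((v : ℕ) + (y b.2 : ℕ)) % m) (by
        intro u v v' h h'
        have e : (v : ℕ) + (y b.2 : ℕ) ≡ (v' : ℕ) + (y b.2 : ℕ) [MOD m] := h.symm.trans h'
        have e' : (v : ℕ) ≡ (v' : ℕ) [MOD m] := Nat.ModEq.add_right_cancel' _ e
        exact Fin.ext (Nat.ModEq.eq_of_lt_of_lt e' v.2 v'.2))
    simpa using this
  refine (integral_mono Integrable.of_finite Integrable.of_finite hy).trans ?_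
  simp

/-- A TensorSketch is a signed hash on pairs, with hash h₁ + h₂ mod m and sign σ₁σ₂. The sign
moments factor over the two coordinates, which accounts for the product of two pairing counts. -/
theorem momentBound_tensorSketch {d m : ℕ} (hm : 0 < m) {μ₁ μ₂ : Measure (Fin d → Fin m)}
    {ν₁ ν₂ : Measure (Fin d → Bool)} (hμ₁ : IsKWiseIndependent 3 μ₁)
    (hμ₂ : IsKWiseIndependent 3 μ₂) (hν₁ : IsKWiseIndependent 4 ν₁)
    (hν₂ : IsKWiseIndependent 4 ν₂) :
    MomentBound ((μ₁.prod μ₂).prod (ν₁.prod ν₂))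
      (fun s : TensorSketchSeed d m => tensorSketch s) (1 + 9 * (m : ℝ)⁻¹) := by
  have : Nonempty (Fin m) := ⟨⟨0, hm⟩⟩
  have := hμ₁.isProbabilityMeasure
  have := hμ₂.isProbabilityMeasure
  have := hν₁.isProbabilityMeasure
  have := hν₂.isProbabilityMeasure
  have key := momentBound_signedHash (μ₁.prod μ₂) (ν₁.prod ν₂)
    (fun (h : (Fin d → Fin m) × (Fin d → Fin m)) (a : Fin d × Fin d) =>
      (⟨((h.1 a.1 : ℕ) + (h.2 a.2 : ℕ)) % m, Nat.mod_lt _ hm⟩ : Fin m))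
    (fun (f : (Fin d → Bool) × (Fin d → Bool)) (a : Fin d × Fin d) =>
      sgn (f.1 a.1) * sgn (f.2 a.2)) (κ := 9) (δ := (m : ℝ)⁻¹)
    (fun f a => by
      have h1 := sgn_mul_self (f.1 a.1)
      have h2 := sgn_mul_self (f.2 a.2)
      calc _ = (sgn (f.1 a.1) * sgn (f.1 a.1)) * (sgn (f.2 a.2) * sgn (f.2 a.2)) := by ring
        _ = 1 := by rw [h1, h2, one_mul])
    ?_ (fun a b c d => pairings a.1 b.1 c.1 d.1 * pairings a.2 b.2 c.2 d.2) ?_ (by positivity)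
    (fun y => sum_pairings_mul_pairings_le y) ?_
  · simpa only [tensorSketch, Fin.ext_iff] using key
  · intro a b hab
    have hsplit : ∫ f : (Fin d → Bool) × (Fin d → Bool),
        sgn (f.1 a.1) * sgn (f.2 a.2) * (sgn (f.1 b.1) * sgn (f.2 b.2)) ∂(ν₁.prod ν₂) =
        (∫ f, sgn (f a.1) * sgn (f b.1) ∂ν₁) * (∫ f, sgn (f a.2) * sgn (f b.2) ∂ν₂) := by
      rw [← integral_prod_mul]
      congr 1
      ext f
      ring
    have h2 : ∀ {ν : Measure (Fin d → Bool)}, IsKWiseIndependent 4 ν → ∀ {i j : Fin d}, i ≠ j →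
        ∫ f, sgn (f i) * sgn (f j) ∂ν = 0 := by
      intro ν hν i j hij
      rw [← hν.integral_sgn_eq_zero hij hij hij]
      congr 1
      ext f
      rw [mul_assoc, mul_assoc, sgn_mul_self, mul_one]
    rw [hsplit]
    by_cases h1 : a.1 = b.1
    · rw [h2 hν₂ (fun h => hab (Prod.ext h1 h)), mul_zero]
    · rw [h2 hν₁ h1, zero_mul]
  · intro a b c e
    have hsplit : ∫ f : (Fin d → Bool) × (Fin d → Bool),
        sgn (f.1 a.1) * sgn (f.2 a.2) * (sgn (f.1 b.1) * sgn (f.2 b.2)) *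
          (sgn (f.1 c.1) * sgn (f.2 c.2) * (sgn (f.1 e.1) * sgn (f.2 e.2))) ∂(ν₁.prod ν₂) =
        (∫ f, sgn (f a.1) * sgn (f b.1) * sgn (f c.1) * sgn (f e.1) ∂ν₁) *
        (∫ f, sgn (f a.2) * sgn (f b.2) * sgn (f c.2) * sgn (f e.2) ∂ν₂) := by
      rw [← integral_prod_mul]
      congr 1
      ext f
      ring
    rw [hsplit, abs_mul]
    exact mul_le_mul (hν₁.abs_integral_sgn_le _ _ _ _) (hν₂.abs_integral_sgn_le _ _ _ _)
      (abs_nonneg _) (pairings_nonneg _ _ _ _)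
  · intro a b hab
    simp only [Fin.ext_iff]
    -- Distinct pairs differ in some coordinate, and the randomness of the hash function of that
    -- coordinate is used. The case of the second coordinate reduces to the first by swapping.
    by_cases h1 : a.1 = b.1
    · have h2 : a.2 ≠ b.2 := fun h => hab (Prod.ext h1 h)
      have := integral_add_mod_le (μ₂ := μ₁) hμ₂ (a := a.swap) (b := b.swap) h2
      rw [← integral_prod_swap] at this
      simpa [add_comm] using this
    · exact integral_add_mod_le hμ₁ h1

/-! ### Products and tensor products of independent random matrices -/

open scoped Kronecker

theorem MomentBound.mono {Ω ρ γ : Type*} [MeasurableSpace Ω] [Fintype ρ] [Fintype γ]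
    {P : Measure Ω} {K K' : ℝ} {S : Ω → Matrix ρ γ ℝ} (h : MomentBound P S K) (hK : K ≤ K') :
    MomentBound P S K' :=
  ⟨h.second, fun x => (h.fourth x).trans (by gcongr)⟩

section Operations

set_option linter.unusedSectionVars false

variable {Ω Ω' ρ γ τ : Type*} [Finite Ω] [MeasurableSpace Ω] [MeasurableSingletonClass Ω]
  [Finite Ω'] [MeasurableSpace Ω'] [MeasurableSingletonClass Ω'] [Fintype ρ] [Fintype γ]
  [Fintype τ] {P : Measure Ω} {P' : Measure Ω'} [IsProbabilityMeasure P] [IsProbabilityMeasure P']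
  {K K' : ℝ}

theorem MomentBound.comp_measurePreserving {S : Ω → Matrix ρ γ ℝ} (h : MomentBound P S K)
    {f : Ω' → Ω} (hf : MeasurePreserving f P' P) : MomentBound P' (fun ω => S (f ω)) K := by
  have key : ∀ F : Ω → ℝ, ∫ ω, F (f ω) ∂P' = ∫ ω, F ω ∂P := by
    intro F
    rw [← hf.map_eq, integral_map hf.measurable.aemeasurable]
    rw [hf.map_eq]
    exact (Integrable.of_finite (μ := P)).aestronglyMeasurable
  refine ⟨fun x => ?_, fun x => ?_⟩
  · rw [key fun ω => (S ω *ᵥ x) ⬝ᵥ (S ω *ᵥ x)]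
    exact h.second x
  · rw [key fun ω => ((S ω *ᵥ x) ⬝ᵥ (S ω *ᵥ x)) ^ 2]
    exact h.fourth x

/-- With the value of `T` fixed, the bounds for `S` apply to the deterministic vector `T x`; then
those for `T` apply to `x`. -/
theorem MomentBound.mul {S : Ω → Matrix ρ γ ℝ} {T : Ω' → Matrix γ τ ℝ} (hS : MomentBound P S K)
    (hT : MomentBound P' T K') (hK : 0 ≤ K) :
    MomentBound (P.prod P') (fun ω => S ω.1 * T ω.2) (K * K') := by
  refine ⟨fun x => ?_, fun x => ?_⟩
  · rw [integral_prod_symm _ Integrable.of_finite]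
    simp only [← Matrix.mulVec_mulVec, hS.second, hT.second]
  · rw [integral_prod_symm _ Integrable.of_finite]
    simp only [← Matrix.mulVec_mulVec]
    refine (integral_mono Integrable.of_finite Integrable.of_finite
      fun y => hS.fourth (T y *ᵥ x)).trans ?_
    rw [integral_const_mul, mul_assoc]
    exact mul_le_mul_of_nonneg_left (hT.fourth x) hK

/-- Selecting columns amounts to extending the vector by zero, which preserves its norm. This
handles both reindexing and the padding by unit vectors. -/
theorem MomentBound.submatrix_injective {S : Ω → Matrix ρ γ ℝ} (h : MomentBound P S K)
    {f : τ → γ} (hf : Function.Injective f) :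
    MomentBound P (fun ω => (S ω).submatrix id f) K := by
  have h1 : ∀ (M : Matrix ρ γ ℝ) (x : τ → ℝ),
      M.submatrix id f *ᵥ x = M *ᵥ Function.extend f x 0 := by
    intro M x
    funext r
    simp only [Matrix.mulVec, dotProduct, Matrix.submatrix_apply, id]
    refine Fintype.sum_of_injective f hf _ _ ?_ ?_
    · intro c hc
      rw [Function.extend_apply' _ _ _ (by simpa using hc)]
      simp
    · intro c
      rw [hf.extend_apply]
  have h2 : ∀ x : τ → ℝ, Function.extend f x 0 ⬝ᵥ Function.extend f x 0 = x ⬝ᵥ x := by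
    intro x
    refine (Fintype.sum_of_injective f hf _ _ ?_ ?_).symm
    · intro c hc
      rw [Function.extend_apply' _ _ _ (by simpa using hc)]
      simp
    · intro c
      rw [hf.extend_apply]
  refine ⟨fun x => ?_, fun x => ?_⟩
  · simp only [h1]
    rw [h.second, h2]
  · simp only [h1]
    refine (h.fourth _).trans_eq ?_
    rw [h2]

theorem MomentBound.submatrix_equiv {S : Ω → Matrix ρ γ ℝ} (h : MomentBound P S K) (e : τ ≃ ρ) :
    MomentBound P (fun ω => (S ω).submatrix e id) K := by
  have h1 : ∀ (M : Matrix ρ γ ℝ) (x : γ → ℝ),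
      (M.submatrix e id *ᵥ x) ⬝ᵥ (M.submatrix e id *ᵥ x) = (M *ᵥ x) ⬝ᵥ (M *ᵥ x) := by
    intro M x
    exact e.sum_comp fun r => (M *ᵥ x) r * (M *ᵥ x) r
  exact ⟨fun x => by simpa only [h1] using h.second x,
    fun x => by simpa only [h1] using h.fourth x⟩

theorem one_kronecker_dotProduct [DecidableEq τ] (M : Matrix ρ γ ℝ) (x : τ × γ → ℝ) :
    (((1 : Matrix τ τ ℝ) ⊗ₖ M) *ᵥ x) ⬝ᵥ (((1 : Matrix τ τ ℝ) ⊗ₖ M) *ᵥ x) =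
      ∑ i, (M *ᵥ fun c => x (i, c)) ⬝ᵥ (M *ᵥ fun c => x (i, c)) := by
  have : ∀ i r, (((1 : Matrix τ τ ℝ) ⊗ₖ M) *ᵥ x) (i, r) = (M *ᵥ fun c => x (i, c)) r := by
    intro i r
    simp [Matrix.mulVec, dotProduct, Fintype.sum_prod_type, Matrix.one_apply]
  simp only [dotProduct, Fintype.sum_prod_type, this]

/-- The squared norm is a sum of terms g_i, one for each block v_i of `x`, all using the same `S`.
Cauchy-Schwarz gives E g_i g_j ≤ K|v_i|²|v_j|², and these bounds sum to K|x|⁴ whatever the number of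
blocks. -/
theorem MomentBound.one_kronecker [DecidableEq τ] {S : Ω → Matrix ρ γ ℝ} (h : MomentBound P S K)
    (hK : 0 ≤ K) : MomentBound P (fun ω => (1 : Matrix τ τ ℝ) ⊗ₖ S ω) K := by
  have hx : ∀ x : τ × γ → ℝ, x ⬝ᵥ x = ∑ i, (fun c => x (i, c)) ⬝ᵥ (fun c => x (i, c)) := by
    intro x
    simp only [dotProduct, Fintype.sum_prod_type]
  refine ⟨fun x => ?_, fun x => ?_⟩
  · simp only [one_kronecker_dotProduct]
    rw [integral_finsetSum _ fun _ _ => Integrable.of_finite, hx]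
    simp only [h.second]
  · simp only [one_kronecker_dotProduct]
    set v : τ → γ → ℝ := fun i c => x (i, c) with hv
    set g : τ → Ω → ℝ := fun i ω => (S ω *ᵥ v i) ⬝ᵥ (S ω *ᵥ v i) with hg
    have hcross : ∀ i j, ∫ ω, g i ω * g j ω ∂P ≤ K * ((v i ⬝ᵥ v i) * (v j ⬝ᵥ v j)) := by
      intro i j
      set a := v i ⬝ᵥ v i
      set b := v j ⬝ᵥ v j
      have ha : 0 ≤ a := dotProduct_self_nonneg' _
      have hb : 0 ≤ b := dotProduct_self_nonneg' _
      have h0 : ∀ l, v l ⬝ᵥ v l = 0 → ∀ ω, g l ω = 0 := by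
        intro l hl ω
        rw [dotProduct_self_eq_zero] at hl
        simp [hg, hl]
      rcases ha.eq_or_lt with ha0 | ha0
      · simp only [h0 i ha0.symm, zero_mul, integral_zero]
        positivity
      rcases hb.eq_or_lt with hb0 | hb0
      · simp only [h0 j hb0.symm, mul_zero, integral_zero]
        positivity
      -- This is Cauchy-Schwarz in the form of a weighted arithmetic-geometric mean inequality. The
      -- weights make both fourth moments contribute K a b / 2; zero blocks were set aside to permit
      -- the division.
      have hamgm : ∀ ω, g i ω * g j ω ≤ b / (2 * a) * g i ω ^ 2 + a / (2 * b) * g j ω ^ 2 := by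
        intro ω
        have : b / (2 * a) * g i ω ^ 2 + a / (2 * b) * g j ω ^ 2 - g i ω * g j ω =
            (b * g i ω - a * g j ω) ^ 2 / (2 * a * b) := by
          field_simp
          ring
        have h2 : 0 ≤ (b * g i ω - a * g j ω) ^ 2 / (2 * a * b) := by positivity
        linarith
      refine (integral_mono Integrable.of_finite Integrable.of_finite hamgm).trans ?_
      rw [integral_add Integrable.of_finite Integrable.of_finite, integral_const_mul,
        integral_const_mul]
      have e1 : b / (2 * a) * ∫ ω, g i ω ^ 2 ∂P ≤ b / (2 * a) * (K * a ^ 2) :=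
        mul_le_mul_of_nonneg_left (h.fourth (v i)) (by positivity)
      have e2 : a / (2 * b) * ∫ ω, g j ω ^ 2 ∂P ≤ a / (2 * b) * (K * b ^ 2) :=
        mul_le_mul_of_nonneg_left (h.fourth (v j)) (by positivity)
      have e3 : b / (2 * a) * (K * a ^ 2) + a / (2 * b) * (K * b ^ 2) = K * (a * b) := by
        field_simp
        ring
      linarith
    have hexp : ∀ ω, (∑ i, g i ω) ^ 2 = ∑ i, ∑ j, g i ω * g j ω := by
      intro ω
      rw [pow_two, Finset.sum_mul_sum]
    change ∫ ω, (∑ i, g i ω) ^ 2 ∂P ≤ _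
    simp only [hexp]
    rw [integral_finsetSum _ fun _ _ => Integrable.of_finite, hx x, pow_two, Finset.sum_mul_sum,
      Finset.mul_sum]
    refine Finset.sum_le_sum fun i _ => ?_
    rw [integral_finsetSum _ fun _ _ => Integrable.of_finite, Finset.mul_sum]
    exact Finset.sum_le_sum fun j _ => hcross i j

theorem MomentBound.kronecker_one [DecidableEq τ] {S : Ω → Matrix ρ γ ℝ} (h : MomentBound P S K)
    (hK : 0 ≤ K) : MomentBound P (fun ω => S ω ⊗ₖ (1 : Matrix τ τ ℝ)) K := by
  have := ((h.one_kronecker (τ := τ) hK).submatrix_injective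
    (Equiv.prodComm γ τ).injective).submatrix_equiv (Equiv.prodComm ρ τ)
  convert this using 2 with ω
  ext ⟨r, i⟩ ⟨c, j⟩
  simp [mul_comm]

/-- Factor S ⊗ T = (S ⊗ 1)(1 ⊗ T) as a product of independent matrices. -/
theorem MomentBound.kronecker {ρ' γ' : Type*} [Fintype ρ'] [Fintype γ'] [DecidableEq ρ]
    [DecidableEq γ'] [DecidableEq γ] [DecidableEq ρ']
    {S : Ω → Matrix ρ γ ℝ} {T : Ω' → Matrix ρ' γ' ℝ} (hS : MomentBound P S K)
    (hT : MomentBound P' T K') (hK : 0 ≤ K) (hK' : 0 ≤ K') :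
    MomentBound (P.prod P') (fun ω => S ω.1 ⊗ₖ T ω.2) (K * K') := by
  have := (hS.kronecker_one (τ := ρ') hK).mul (hT.one_kronecker (τ := γ) hK') hK
  simpa only [← Matrix.mul_kronecker_mul, mul_one, one_mul, Matrix.mul_one, Matrix.one_mul]
    using this

/-- The tensor product of independent random matrices. -/
theorem MomentBound.pi [DecidableEq ρ] [DecidableEq γ] {S : Ω → Matrix ρ γ ℝ}
    (h : MomentBound P S K) (hK : 0 ≤ K) (q : ℕ) :
    MomentBound (Measure.pi fun _ : Fin q => P)
      (fun ω => Matrix.of fun (r : Fin q → ρ) (c : Fin q → γ) => ∏ j, S (ω j) (r j) (c j))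
      (K ^ q) := by
  induction q with
  | zero =>
    constructor <;> intro x <;> simp [dotProduct, Matrix.mulVec]
  | succ q ih =>
    have h1 := (((h.kronecker ih hK (by positivity)).comp_measurePreserving
      (measurePreserving_piFinSuccAbove (fun _ : Fin (q + 1) => P) 0)).submatrix_injective
      (Fin.consEquiv fun _ : Fin (q + 1) => γ).symm.injective).submatrix_equiv
      (Fin.consEquiv fun _ : Fin (q + 1) => ρ).symm
    rw [pow_succ']
    convert h1 using 2 with ω
    ext r c
    simp [Fin.prod_univ_succ, Fin.consEquiv, MeasurableEquiv.piFinSuccAbove, Fin.tail]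

end Operations

/-- The restrictions of an independent family to two complementary index sets are independent. -/
theorem measurePreserving_pi_split {ι ι₁ ι₂ Ω : Type*} [Fintype ι] [Fintype ι₁] [Fintype ι₂]
    [Finite Ω] [MeasurableSpace Ω] [MeasurableSingletonClass Ω] (P : Measure Ω)
    [IsProbabilityMeasure P] (f₁ : ι₁ → ι) (f₂ : ι₂ → ι)
    (hf : Function.Bijective (Sum.elim f₁ f₂)) :
    MeasurePreserving (fun ω : ι → Ω => ((fun i => ω (f₁ i)), (fun i => ω (f₂ i))))
      (Measure.pi fun _ => P) ((Measure.pi fun _ => P).prod (Measure.pi fun _ => P)) := by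
  refine ⟨measurable_of_finite _, ?_⟩
  -- The spaces are finite, so singletons suffice; the preimage of a singleton is a singleton, and
  -- its mass is a product over `ι` that splits along `e`.
  refine Measure.ext_of_singleton fun uv => ?_
  obtain ⟨u, v⟩ := uv
  rw [Measure.map_apply (measurable_of_finite _) (Set.toFinite _).measurableSet]
  set e := Equiv.ofBijective _ hf
  have hpre : (fun ω : ι → Ω => ((fun i => ω (f₁ i)), (fun i => ω (f₂ i)))) ⁻¹' {(u, v)} =
      {fun i => Sum.elim u v (e.symm i)} := by
    ext ω
    simp only [Set.mem_preimage, Set.mem_singleton_iff, Prod.mk.injEq]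
    constructor
    · rintro ⟨rfl, rfl⟩
      funext i
      obtain ⟨s, rfl⟩ := e.surjective i
      rw [e.symm_apply_apply]
      rcases s with s | s <;> rfl
    · rintro rfl
      constructor
      · funext i
        have : f₁ i = e (Sum.inl i) := rfl
        simp [this]
      · funext i
        have : f₂ i = e (Sum.inr i) := rfl
        simp [this]
  rw [hpre, Measure.pi_singleton, ← Set.singleton_prod_singleton, Measure.prod_prod,
    Measure.pi_singleton, Measure.pi_singleton, ← e.prod_comp, Fintype.prod_sum_type]
  simp

/-! ### The moments of the tree sketch -/

/-- A position is determined by its half and its parity. Regrouping indices in this way shows a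
level of the tree to be a Kronecker power of matrices whose columns are pairs. -/
theorem leftChild_rightChild_bijective (k : ℕ) {γ : Type*} : Function.Bijective
    (fun (c : Fin (2 ^ (k + 1)) → γ) (j : Fin (2 ^ k)) => (c (leftChild j), c (rightChild j))) := by
  have hp := pow_succ 2 k
  constructor
  · intro c c' h
    funext i
    have hi : (i : ℕ) / 2 < 2 ^ k := by have := i.2; omega
    have := congrFun h ⟨(i : ℕ) / 2, hi⟩
    simp only [Prod.mk.injEq] at this
    rcases Nat.mod_two_eq_zero_or_one i with hm | hm
    · have e : leftChild (⟨(i : ℕ) / 2, hi⟩ : Fin (2 ^ k)) = i :=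
        Fin.ext (by simp only [leftChild]; omega)
      rw [e] at this
      exact this.1
    · have e : rightChild (⟨(i : ℕ) / 2, hi⟩ : Fin (2 ^ k)) = i :=
        Fin.ext (by simp only [rightChild]; omega)
      rw [e] at this
      exact this.2
  · intro w
    refine ⟨fun i => if (i : ℕ) % 2 = 0 then (w ⟨(i : ℕ) / 2, by have := i.2; omega⟩).1
      else (w ⟨(i : ℕ) / 2, by have := i.2; omega⟩).2, ?_⟩
    funext j
    have e1 : ((leftChild j : Fin (2 ^ (k + 1))) : ℕ) % 2 = 0 := by simp [leftChild]
    have e2 : ¬ ((rightChild j : Fin (2 ^ (k + 1))) : ℕ) % 2 = 0 := by simp [rightChild]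
    simp only [e1, e2, if_true, if_false]
    have e3 : (⟨(leftChild j : ℕ) / 2, by have := (leftChild j).2; omega⟩ : Fin (2 ^ k)) = j :=
      Fin.ext (by simp [leftChild])
    have e4 : (⟨(rightChild j : ℕ) / 2, by have := (rightChild j).2; omega⟩ : Fin (2 ^ k)) = j :=
      Fin.ext (by simp only [rightChild]; omega)
    rw [e3, e4]

theorem momentBound_levelSketch {m k : ℕ} {Ω : Type*} [Finite Ω] [MeasurableSpace Ω]
    [MeasurableSingletonClass Ω] {P : Measure Ω} [IsProbabilityMeasure P]
    {S : Ω → Matrix (Fin m) (Fin m × Fin m) ℝ} {K : ℝ} (h : MomentBound P S K) (hK : 0 ≤ K) :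
    MomentBound (Measure.pi fun _ : Fin (2 ^ k) => P)
      (fun ω => levelSketch fun j => S (ω j)) (K ^ 2 ^ k) :=
  (h.pi hK (2 ^ k)).submatrix_injective (leftChild_rightChild_bijective k).1

/-- The exponent counts the internal nodes: each level is an independent matrix factor, and a level
with 2^L nodes contributes K^(2^L). -/
theorem momentBound_treeSketch {m : ℕ} {Ω : Type*} [Finite Ω] [MeasurableSpace Ω]
    [MeasurableSingletonClass Ω] {P : Measure Ω} [IsProbabilityMeasure P]
    {S : Ω → Matrix (Fin m) (Fin m × Fin m) ℝ} {K : ℝ} (h : MomentBound P S K) (hK : 0 ≤ K)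
    (L : ℕ) :
    MomentBound (Measure.pi fun _ : Node L => P)
      (fun ω => treeSketch L fun k j => S (ω ⟨k, j⟩)) (K ^ (2 ^ L - 1)) := by
  induction L with
  | zero =>
    -- At depth zero the matrix merely identifies functions on a one-point set with their value, so
    -- it is an isometry.
    have hx : ∀ x : (Fin (2 ^ 0) → Fin m) → ℝ,
        ((Matrix.of fun (r : Fin m) (c : Fin (2 ^ 0) → Fin m) =>
          if c 0 = r then (1 : ℝ) else 0) *ᵥ x) ⬝ᵥ
        ((Matrix.of fun (r : Fin m) (c : Fin (2 ^ 0) → Fin m) =>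
          if c 0 = r then (1 : ℝ) else 0) *ᵥ x) = x ⬝ᵥ x := by
      intro x
      have h1 : ∀ r, ((Matrix.of fun (r : Fin m) (c : Fin (2 ^ 0) → Fin m) =>
          if c 0 = r then (1 : ℝ) else 0) *ᵥ x) r = x (fun _ => r) := by
        intro r
        simp only [Matrix.mulVec, dotProduct, Matrix.of_apply]
        rw [Finset.sum_eq_single fun _ => r]
        · simp
        · intro c _ hc
          rw [if_neg, zero_mul]
          intro h
          apply hc
          funext i
          rw [← h]
          congr 1
          exact Fin.ext (by have := i.2; simp at this ⊢)
        · simp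
      simp only [dotProduct, h1]
      exact (Equiv.funUnique (Fin 1) (Fin m)).symm.sum_comp fun c => x c * x c
    constructor <;> intro x
    · simp only [treeSketch, hx]
      simp
    · simp only [treeSketch, hx]
      simp
  | succ L ih =>
    -- The nodes of the deeper tree are those of the smaller tree together with the last level.
    have hsplit := measurePreserving_pi_split P
      (fun v : Node L => (⟨v.1.castSucc, v.2⟩ : Node (L + 1)))
      (fun j : Fin (2 ^ L) => (⟨Fin.last L, j⟩ : Node (L + 1))) (by
        constructor
        · rintro (⟨k, i⟩ | i) (⟨l, j⟩ | j) hij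
          · simp only [Sum.elim_inl, Sigma.mk.injEq, Fin.castSucc_inj] at hij
            obtain ⟨rfl, hij⟩ := hij
            rw [eq_of_heq hij]
          · simp only [Sum.elim_inl, Sum.elim_inr, Sigma.mk.injEq] at hij
            exact absurd hij.1 (Fin.castSucc_ne_last k)
          · simp only [Sum.elim_inl, Sum.elim_inr, Sigma.mk.injEq] at hij
            exact absurd hij.1.symm (Fin.castSucc_ne_last l)
          · simp only [Sum.elim_inr, Sigma.mk.injEq, true_and] at hij
            rw [eq_of_heq hij]
        · rintro ⟨k, i⟩
          induction k using Fin.lastCases with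
          | last => exact ⟨Sum.inr i, rfl⟩
          | cast k => exact ⟨Sum.inl ⟨k, i⟩, rfl⟩)
    have := ((ih.mul (momentBound_levelSketch (k := L) h hK)
      (by positivity)).comp_measurePreserving hsplit)
    have hpow : K ^ (2 ^ (L + 1) - 1) = K ^ (2 ^ L - 1) * K ^ 2 ^ L := by
      rw [← pow_add]
      congr 1
      have : 0 < 2 ^ L := by positivity
      rw [pow_succ]
      omega
    rw [hpow]
    exact this

theorem padIndex_injective {d : ℕ} [NeZero d] {p q : ℕ} (h : p ≤ q) :
    Function.Injective (padIndex (d := d) p q) := by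
  intro i j hij
  funext t
  have := congrFun hij ⟨t, t.2.trans_le h⟩
  simpa [padIndex] using this

/-! ### The law of the seeds and the moments of the complete sketch. -/

theorem HashLaws.isProbabilityMeasure_leafLaw {d m : ℕ} (hm : 0 < m) (H : HashLaws d m) :
    IsProbabilityMeasure H.leafLaw := by
  have : Nonempty (Fin m) := ⟨⟨0, hm⟩⟩
  have := H.leafHash_indep.isProbabilityMeasure
  have := H.leafSign_indep.isProbabilityMeasure
  unfold HashLaws.leafLaw
  infer_instance

theorem HashLaws.isProbabilityMeasure_nodeLaw {d m : ℕ} (hm : 0 < m) (H : HashLaws d m) :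
    IsProbabilityMeasure H.nodeLaw := by
  have : Nonempty (Fin m) := ⟨⟨0, hm⟩⟩
  have := H.nodeHash₁_indep.isProbabilityMeasure
  have := H.nodeHash₂_indep.isProbabilityMeasure
  have := H.nodeSign₁_indep.isProbabilityMeasure
  have := H.nodeSign₂_indep.isProbabilityMeasure
  unfold HashLaws.nodeLaw
  infer_instance

theorem HashLaws.isProbabilityMeasure_seedLaw {d m : ℕ} (hm : 0 < m) (H : HashLaws d m) (L : ℕ) :
    IsProbabilityMeasure (H.seedLaw L) := by
  have := H.isProbabilityMeasure_leafLaw hm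
  have := H.isProbabilityMeasure_nodeLaw hm
  unfold HashLaws.seedLaw
  infer_instance

/-- By minimality of the ceiling logarithm, half of the power lies below p. This converts the number
of leaves, and later the transform length, into the given parameters. -/
theorem two_pow_clog_lt {p : ℕ} (hp : 0 < p) : 2 ^ Nat.clog 2 p < 2 * p := by
  rcases Nat.lt_or_ge 1 p with h | h
  · have := Nat.pow_pred_clog_lt_self one_lt_two h
    have hpos := Nat.clog_pos one_lt_two h
    have e : 2 ^ Nat.clog 2 p = 2 * 2 ^ (Nat.clog 2 p).pred := by
      rw [← pow_succ', Nat.pred_eq_sub_one, Nat.sub_add_cancel hpos]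
    omega
  · have : p = 1 := by omega
    subst this
    simp

/-- There are q leaves and q - 1 internal nodes, each contributing a factor of at most 1 + 9/m, and
2q - 1 ≤ 4p because q < 2p. -/
theorem momentBound_sketch {p d m : ℕ} [NeZero d] (hp : 0 < p) (hm : 0 < m) (H : HashLaws d m) :
    MomentBound (H.seedLaw (depth p)) (sketch (p := p) (d := d) (m := m))
      ((1 + 9 * (m : ℝ)⁻¹) ^ (4 * p)) := by
  have := H.isProbabilityMeasure_leafLaw hm
  have := H.isProbabilityMeasure_nodeLaw hm
  have := H.isProbabilityMeasure_seedLaw hm (depth p)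
  have hm0 : (0 : ℝ) ≤ (m : ℝ)⁻¹ := by positivity
  have h1 : MomentBound H.leafLaw (fun s => countSketch s) (1 + 9 * (m : ℝ)⁻¹) :=
    (momentBound_countSketch hm H.leafHash_indep H.leafSign_indep).mono (by linarith)
  have h2 : MomentBound H.nodeLaw (fun s => tensorSketch s) (1 + 9 * (m : ℝ)⁻¹) :=
    momentBound_tensorSketch hm H.nodeHash₁_indep H.nodeHash₂_indep H.nodeSign₁_indep
      H.nodeSign₂_indep
  have h3 := (momentBound_treeSketch h2 (by positivity) (depth p)).mul
    (h1.pi (by positivity) (2 ^ depth p)) (by positivity)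
  have h4 := (h3.comp_measurePreserving Measure.measurePreserving_swap).submatrix_injective
    (padIndex_injective (d := d) (Nat.le_pow_clog one_lt_two p))
  refine MomentBound.mono h4 ?_
  rw [← pow_add]
  refine pow_le_pow_right₀ (by linarith) ?_
  have : 2 ^ depth p < 2 * p := two_pow_clog_lt hp
  omega

/-! ### Factorization of positive definite matrices. -/

section

open scoped MatrixOrder Matrix.Norms.L2Operator

/-- The operator norm serves only to view matrices as a C*-algebra, where strictly positive elements
have this form. It is confined to this section because the Frobenius norm is used afterwards. -/
theorem exists_isUnit_eq_transpose_mul_self {n : ℕ} {K : Matrix (Fin n) (Fin n) ℝ}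
    (hK : K.PosDef) : ∃ B : Matrix (Fin n) (Fin n) ℝ, IsUnit B ∧ K = Bᵀ * B := by
  obtain ⟨B, hB, h⟩ := CStarAlgebra.isStrictlyPositive_iff_eq_star_mul_self.1 hK.isStrictlyPositive
  exact ⟨B, hB, h⟩

end

/-! ### Approximate matrix products and subspace embeddings from moments -/

section Frobenius

open scoped Matrix.Norms.Frobenius

theorem frobenius_norm_sq {ρ γ : Type*} [Fintype ρ] [Fintype γ] (A : Matrix ρ γ ℝ) :
    ‖A‖ ^ 2 = ∑ i, ∑ j, A i j ^ 2 := by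
  rw [Matrix.frobenius_norm_def, ← Real.sqrt_eq_rpow, Real.sq_sqrt (by positivity)]
  simp

theorem frobenius_norm_sq_eq_sum_col {ρ γ : Type*} [Fintype ρ] [Fintype γ] (A : Matrix ρ γ ℝ) :
    ‖A‖ ^ 2 = ∑ j, A.col j ⬝ᵥ A.col j := by
  rw [frobenius_norm_sq, Finset.sum_comm]
  simp [dotProduct, pow_two, Matrix.col]

/-- The quadratic form is the entrywise inner product of `E` with y yᵀ, whose Frobenius norm is
|y|². -/
theorem abs_dotProduct_mulVec_le {n : ℕ} (E : Matrix (Fin n) (Fin n) ℝ) (y : Fin n → ℝ) :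
    |y ⬝ᵥ (E *ᵥ y)| ≤ ‖E‖ * (y ⬝ᵥ y) := by
  apply abs_le_of_sq_le_sq
  · have h1 : y ⬝ᵥ (E *ᵥ y) = ∑ ij : Fin n × Fin n, E ij.1 ij.2 * (y ij.1 * y ij.2) := by
      simp only [dotProduct, Matrix.mulVec, Finset.mul_sum, Fintype.sum_prod_type]
      exact Finset.sum_congr rfl fun i _ => Finset.sum_congr rfl fun j _ => by ring
    have h2 : ‖E‖ ^ 2 = ∑ ij : Fin n × Fin n, E ij.1 ij.2 ^ 2 := by
      rw [frobenius_norm_sq, Fintype.sum_prod_type]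
    have h3 : (y ⬝ᵥ y) ^ 2 = ∑ ij : Fin n × Fin n, (y ij.1 * y ij.2) ^ 2 := by
      simp only [dotProduct, pow_two, Finset.sum_mul_sum, Fintype.sum_prod_type]
      exact Finset.sum_congr rfl fun i _ => Finset.sum_congr rfl fun j _ => by ring
    rw [mul_pow, h1, h2, h3]
    exact Finset.sum_mul_sq_le_sq_mul_sq _ _ _
  · exact mul_nonneg (norm_nonneg _) (dotProduct_self_nonneg' y)

end Frobenius

section

variable {Ω γ : Type*} [Finite Ω] [MeasurableSpace Ω] [MeasurableSingletonClass Ω] {P : Measure Ω}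
  [IsProbabilityMeasure P] [Fintype γ] {m : ℕ} {S : Ω → Matrix (Fin m) γ ℝ} {η : ℝ}

/-- Markov's inequality. -/
theorem ofReal_le_measure_of_integral_le (f : Ω → ℝ) (hf : ∀ ω, 0 ≤ f ω) {θ : ℝ} (hθ : 0 < θ)
    (h : ∫ ω, f ω ∂P ≤ θ / 10) : ENNReal.ofReal (1 - 1 / 10) ≤ P {ω | f ω ≤ θ} := by
  have h1 := mul_meas_ge_le_integral_of_nonneg (Filter.Eventually.of_forall hf)
    (Integrable.of_finite (μ := P)) θ
  have h2 : P.real {ω | θ ≤ f ω} ≤ 1 / 10 := by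
    have : θ * P.real {ω | θ ≤ f ω} ≤ θ * (1 / 10) := by linarith
    exact le_of_mul_le_mul_left this hθ
  have h3 : P.real {ω | f ω ≤ θ} + P.real {ω | θ ≤ f ω} ≥ 1 := by
    have := measureReal_union_le (μ := P) {ω | f ω ≤ θ} {ω | θ ≤ f ω}
    have hu : {ω | f ω ≤ θ} ∪ {ω | θ ≤ f ω} = Set.univ := by
      ext ω
      simpa using le_total (f ω) θ
    rw [hu, probReal_univ] at this
    linarith
  apply ENNReal.ofReal_le_of_le_toReal
  change _ ≤ P.real _
  linarith

/-- Polarization expresses the error of the bilinear form through the errors `W` of the squared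
norms of x ± y. The parallelogram law then gives a bound by (|x|² + |y|²)², and rescaling to equal
norms turns it into a bound by |x|²|y|². -/
theorem MomentBound.integral_sq_dotProduct_sub_le (h : MomentBound P S (1 + η)) (hη : 0 ≤ η)
    (x y : γ → ℝ) :
    ∫ ω, ((S ω *ᵥ x) ⬝ᵥ (S ω *ᵥ y) - x ⬝ᵥ y) ^ 2 ∂P ≤ 2 * η * ((x ⬝ᵥ x) * (y ⬝ᵥ y)) := by
  set W : (γ → ℝ) → Ω → ℝ := fun z ω => (S ω *ᵥ z) ⬝ᵥ (S ω *ᵥ z) - z ⬝ᵥ z with hW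
  -- Since the mean of |Sz|² is exactly |z|², its variance is the second moment minus |z|⁴.
  have hvar : ∀ z, ∫ ω, W z ω ^ 2 ∂P ≤ η * (z ⬝ᵥ z) ^ 2 := by
    intro z
    have e : ∀ ω, W z ω ^ 2 = ((S ω *ᵥ z) ⬝ᵥ (S ω *ᵥ z)) ^ 2 -
        2 * (z ⬝ᵥ z) * ((S ω *ᵥ z) ⬝ᵥ (S ω *ᵥ z)) + (z ⬝ᵥ z) ^ 2 := by
      intro ω
      simp only [hW]
      ring
    simp only [e]
    rw [integral_add Integrable.of_finite Integrable.of_finite,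
      integral_sub Integrable.of_finite Integrable.of_finite, integral_const_mul, h.second]
    have := h.fourth z
    simp only [integral_const, probReal_univ, smul_eq_mul, one_mul]
    linarith
  have hbal : ∀ x y : γ → ℝ, ∫ ω, ((S ω *ᵥ x) ⬝ᵥ (S ω *ᵥ y) - x ⬝ᵥ y) ^ 2 ∂P ≤
      η / 2 * (x ⬝ᵥ x + y ⬝ᵥ y) ^ 2 := by
    intro x y
    have hpt : ∀ ω, ((S ω *ᵥ x) ⬝ᵥ (S ω *ᵥ y) - x ⬝ᵥ y) ^ 2 ≤
        1 / 8 * W (x + y) ω ^ 2 + 1 / 8 * W (x - y) ω ^ 2 := by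
      intro ω
      have e : (S ω *ᵥ x) ⬝ᵥ (S ω *ᵥ y) - x ⬝ᵥ y = (W (x + y) ω - W (x - y) ω) / 4 := by
        simp only [hW, Matrix.mulVec_add, Matrix.mulVec_sub, add_dotProduct, dotProduct_add,
          sub_dotProduct, dotProduct_sub]
        rw [dotProduct_comm y x, dotProduct_comm (S ω *ᵥ y) (S ω *ᵥ x)]
        ring
      rw [e]
      nlinarith [sq_nonneg (W (x + y) ω + W (x - y) ω)]
    refine (integral_mono Integrable.of_finite Integrable.of_finite hpt).trans ?_
    rw [integral_add Integrable.of_finite Integrable.of_finite, integral_const_mul,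
      integral_const_mul]
    have h1 := hvar (x + y)
    have h2 := hvar (x - y)
    have e : (x + y) ⬝ᵥ (x + y) + (x - y) ⬝ᵥ (x - y) = 2 * (x ⬝ᵥ x + y ⬝ᵥ y) := by
      simp only [add_dotProduct, dotProduct_add, sub_dotProduct, dotProduct_sub]
      ring
    have p1 := dotProduct_self_nonneg' (x + y)
    have p2 := dotProduct_self_nonneg' (x - y)
    have e2 : ((x + y) ⬝ᵥ (x + y)) ^ 2 + ((x - y) ⬝ᵥ (x - y)) ^ 2 ≤
        (2 * (x ⬝ᵥ x + y ⬝ᵥ y)) ^ 2 := by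
      rw [← e]
      nlinarith [mul_nonneg p1 p2]
    have e3 := mul_le_mul_of_nonneg_left e2 hη
    linarith
  set a := x ⬝ᵥ x with ha
  set b := y ⬝ᵥ y with hb
  have ha0 : 0 ≤ a := dotProduct_self_nonneg' x
  have hb0 : 0 ≤ b := dotProduct_self_nonneg' y
  rcases ha0.eq_or_lt with h0 | ha1
  · have : x = 0 := dotProduct_self_eq_zero.1 h0.symm
    simp [this, ← h0]
  rcases hb0.eq_or_lt with h0 | hb1
  · have : y = 0 := dotProduct_self_eq_zero.1 h0.symm
    simp [this, ← h0]
  have hs := Real.mul_self_sqrt ha0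
  have hr := Real.mul_self_sqrt hb0
  -- Both rescaled vectors have squared norm a b, so the bound becomes 2η(ab)², from which one
  -- factor a b cancels.
  have key := hbal (√b • x) (√a • y)
  have e1 : ∀ ω, ((S ω *ᵥ (√b • x)) ⬝ᵥ (S ω *ᵥ (√a • y)) - (√b • x) ⬝ᵥ (√a • y)) ^ 2 =
      (a * b) * ((S ω *ᵥ x) ⬝ᵥ (S ω *ᵥ y) - x ⬝ᵥ y) ^ 2 := by
    intro ω
    simp only [Matrix.mulVec_smul, smul_dotProduct, dotProduct_smul, smul_eq_mul]
    calc _ = (√a * √a) * (√b * √b) * ((S ω *ᵥ x) ⬝ᵥ (S ω *ᵥ y) - x ⬝ᵥ y) ^ 2 := by ring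
      _ = _ := by rw [hs, hr]
  have e2 : (√b • x) ⬝ᵥ (√b • x) + (√a • y) ⬝ᵥ (√a • y) = 2 * (a * b) := by
    simp only [smul_dotProduct, dotProduct_smul, smul_eq_mul, ← ha, ← hb, ← mul_assoc, hs, hr]
    ring
  rw [e2] at key
  simp only [e1] at key
  rw [integral_const_mul] at key
  have hab : 0 < a * b := mul_pos ha1 hb1
  refine le_of_mul_le_mul_left (key.trans_eq ?_) hab
  ring

open scoped Matrix.Norms.Frobenius

/-- The entries of the error matrix are bilinear errors of pairs of columns, and the sum of their
bounds factors into the two Frobenius norms. -/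
theorem MomentBound.integral_norm_sq_le (h : MomentBound P S (1 + η)) (hη : 0 ≤ η) {k : ℕ}
    (C D : Matrix γ (Fin k) ℝ) :
    ∫ ω, ‖Cᵀ * (S ω)ᵀ * S ω * D - Cᵀ * D‖ ^ 2 ∂P ≤ 2 * η * (‖C‖ ^ 2 * ‖D‖ ^ 2) := by
  have he : ∀ ω i j, (Cᵀ * (S ω)ᵀ * S ω * D - Cᵀ * D) i j =
      (S ω *ᵥ C.col i) ⬝ᵥ (S ω *ᵥ D.col j) - C.col i ⬝ᵥ D.col j := by
    intro ω i j
    have e : Cᵀ * (S ω)ᵀ * S ω * D = (S ω * C)ᵀ * (S ω * D) := by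
      rw [Matrix.transpose_mul]
      simp only [Matrix.mul_assoc]
    rw [e]
    rfl
  simp only [frobenius_norm_sq_eq_sum_col C, frobenius_norm_sq_eq_sum_col D, frobenius_norm_sq, he]
  rw [integral_finsetSum _ fun _ _ => Integrable.of_finite, Finset.sum_mul_sum, Finset.mul_sum]
  refine Finset.sum_le_sum fun i _ => ?_
  rw [integral_finsetSum _ fun _ _ => Integrable.of_finite, Finset.mul_sum]
  exact Finset.sum_le_sum fun j _ => h.integral_sq_dotProduct_sub_le hη _ _

theorem MomentBound.integral_norm_mul_sq (h : MomentBound P S η) {k : ℕ}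
    (C : Matrix γ (Fin k) ℝ) : ∫ ω, ‖S ω * C‖ ^ 2 ∂P = ‖C‖ ^ 2 := by
  simp only [frobenius_norm_sq_eq_sum_col]
  rw [integral_finsetSum _ fun _ _ => Integrable.of_finite]
  exact Finset.sum_congr rfl fun j _ => h.second (C.col j)

/-- Markov's inequality for the squared error needs 2η ≤ ε²/10. Zero matrices are treated apart
because the threshold has to be positive. -/
theorem MomentBound.hasApproxMatrixProduct (h : MomentBound P S (1 + η)) (hη : 0 ≤ η) {ε : ℝ}
    (hε : 0 < ε) (hηε : 20 * η ≤ ε ^ 2) : HasApproxMatrixProduct P S ε (1 / 10) := by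
  intro k C D
  by_cases hC : C = 0
  · simp [hC]
  by_cases hD : D = 0
  · simp [hD]
  have hC' : 0 < ‖C‖ := norm_pos_iff.2 hC
  have hD' : 0 < ‖D‖ := norm_pos_iff.2 hD
  refine (ofReal_le_measure_of_integral_le (P := P)
    (fun ω => ‖Cᵀ * (S ω)ᵀ * S ω * D - Cᵀ * D‖ ^ 2) (fun ω => sq_nonneg _)
    (θ := (ε * ‖C‖ * ‖D‖) ^ 2) (by positivity) ?_).trans (measure_mono fun ω hω => ?_)
  · refine (h.integral_norm_sq_le hη C D).trans ?_
    have : 0 ≤ ‖C‖ ^ 2 * ‖D‖ ^ 2 := by positivity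
    nlinarith
  · exact (sq_le_sq₀ (norm_nonneg _) (by positivity)).1 hω

/-- For large ε the number of rows need not exceed 36p and K may be huge, but the mean of ‖SC‖²
suffices. With probability 9/10 the normalized squares of ‖SC‖ and ‖SD‖ sum to at most 20, so
‖SC‖‖SD‖ ≤ 10‖C‖‖D‖. Adding ‖CᵀD‖ ≤ ‖C‖‖D‖ gives 11. -/
theorem MomentBound.hasApproxMatrixProduct_of_large {K : ℝ} (h : MomentBound P S K) {ε : ℝ}
    (hε : 11 ≤ ε) : HasApproxMatrixProduct P S ε (1 / 10) := by
  intro k C D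
  by_cases hC : C = 0
  · simp [hC]
  by_cases hD : D = 0
  · simp [hD]
  have hC' : 0 < ‖C‖ := norm_pos_iff.2 hC
  have hD' : 0 < ‖D‖ := norm_pos_iff.2 hD
  refine (ofReal_le_measure_of_integral_le (P := P)
    (fun ω => ‖D‖ ^ 2 * ‖S ω * C‖ ^ 2 + ‖C‖ ^ 2 * ‖S ω * D‖ ^ 2) (fun ω => by positivity)
    (θ := 20 * (‖C‖ ^ 2 * ‖D‖ ^ 2)) (by positivity) ?_).trans (measure_mono fun ω hω => ?_)
  · rw [integral_add Integrable.of_finite Integrable.of_finite, integral_const_mul,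
      integral_const_mul, h.integral_norm_mul_sq, h.integral_norm_mul_sq]
    linarith
  · simp only [Set.mem_ofPred_eq] at hω ⊢
    have e : Cᵀ * (S ω)ᵀ * S ω * D = (S ω * C)ᵀ * (S ω * D) := by
      rw [Matrix.transpose_mul]
      simp only [Matrix.mul_assoc]
    have h1 : ‖(S ω * C)ᵀ * (S ω * D)‖ ≤ ‖S ω * C‖ * ‖S ω * D‖ := by
      refine (Matrix.frobenius_norm_mul _ _).trans_eq ?_
      rw [Matrix.frobenius_norm_transpose]
    have h2 : ‖Cᵀ * D‖ ≤ ‖C‖ * ‖D‖ := by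
      refine (Matrix.frobenius_norm_mul _ _).trans_eq ?_
      rw [Matrix.frobenius_norm_transpose]
    have h3 : ‖S ω * C‖ * ‖S ω * D‖ ≤ 10 * (‖C‖ * ‖D‖) := by
      have hcd : 0 < ‖C‖ * ‖D‖ := by positivity
      refine le_of_mul_le_mul_left ?_ hcd
      nlinarith [sq_nonneg (‖D‖ * ‖S ω * C‖ - ‖C‖ * ‖S ω * D‖)]
    rw [e]
    have hcd : 0 ≤ ‖C‖ * ‖D‖ := by positivity
    have h4 := norm_sub_le ((S ω * C)ᵀ * (S ω * D)) (Cᵀ * D)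
    nlinarith

end

open scoped Matrix.Norms.Frobenius in
-- After the change of variables y = Bx with K = BᵀB, the claim is |yᵀEy| ≤ ε|y|², where E is the
-- error of the product CᵀC and C = AB⁻¹. Since ‖C‖_F² is the statistical dimension, accuracy ε/μ
-- yields ‖E‖_F ≤ ε.
theorem HasApproxMatrixProduct.isOSE {Ω γ : Type*} [MeasurableSpace Ω] {P : Measure Ω} [Fintype γ]
    {m : ℕ} {S : Ω → Matrix (Fin m) γ ℝ} {ε δ μ : ℝ} (hμ : 0 < μ) (hε : 0 < ε)
    (h : HasApproxMatrixProduct P S (ε / μ) δ) (n : ℕ) : IsOSE P S ε δ μ n := by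
  intro lam hlam A hA
  set K := Aᵀ * A + lam • (1 : Matrix (Fin n) (Fin n) ℝ) with hK
  have hpd : K.PosDef := by
    have h1 : (Aᵀ * A).PosSemidef := by
      simpa using Matrix.posSemidef_conjTranspose_mul_self A
    exact Matrix.PosDef.posSemidef_add h1 (Matrix.PosDef.one.smul hlam)
  obtain ⟨B, hB, hKB⟩ := exists_isUnit_eq_transpose_mul_self hpd
  have hBdet : IsUnit B.det := (Matrix.isUnit_iff_isUnit_det B).1 hB
  have hBB : B * B⁻¹ = 1 := Matrix.mul_nonsing_inv B hBdet
  have hBB' : B⁻¹ * B = 1 := Matrix.nonsing_inv_mul B hBdet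
  set C := A * B⁻¹ with hC
  have hAC : A = C * B := by rw [hC, Matrix.mul_assoc, hBB', Matrix.mul_one]
  -- Cyclicity of the trace identifies tr(CᵀC) with tr(AᵀA K⁻¹).
  have hnorm : ‖C‖ ^ 2 ≤ μ := by
    refine le_trans (le_of_eq ?_) hA
    have e1 : ‖C‖ ^ 2 = (Cᵀ * C).trace := by
      rw [frobenius_norm_sq_eq_sum_col]
      rfl
    have e2 : K⁻¹ = B⁻¹ * (B⁻¹)ᵀ := by
      rw [hKB, Matrix.mul_inv_rev, Matrix.transpose_nonsing_inv]
    rw [e1, statDim, ← hK, e2, hC, Matrix.transpose_mul, Matrix.trace_mul_comm,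
      Matrix.mul_assoc Aᵀ A, Matrix.trace_mul_comm Aᵀ]
    simp only [Matrix.mul_assoc]
  refine (h n C C).trans (measure_mono fun ω hω => ?_)
  simp only [Set.mem_ofPred_eq] at hω ⊢
  set E := Cᵀ * (S ω)ᵀ * S ω * C - Cᵀ * C with hE
  have hE' : ‖E‖ ≤ ε := by
    refine hω.trans ?_
    rw [mul_assoc, ← pow_two, div_mul_eq_mul_div, div_le_iff₀ hμ]
    exact mul_le_mul_of_nonneg_left hnorm hε.le
  -- The regularization cancels in the difference, leaving the quadratic form of E at Bx.
  have hdiff : ∀ x : Fin n → ℝ, x ⬝ᵥ (((S ω * A)ᵀ * (S ω * A) +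
      lam • (1 : Matrix (Fin n) (Fin n) ℝ)) *ᵥ x) - x ⬝ᵥ (K *ᵥ x) =
      (B *ᵥ x) ⬝ᵥ (E *ᵥ (B *ᵥ x)) := by
    intro x
    rw [← dotProduct_sub, ← Matrix.sub_mulVec]
    have e1 : (S ω * A)ᵀ * (S ω * A) + lam • (1 : Matrix (Fin n) (Fin n) ℝ) - K =
        Bᵀ * (E * B) := by
      rw [hK, add_sub_add_right_eq_sub, hE, hAC]
      simp only [Matrix.transpose_mul, Matrix.mul_sub, Matrix.sub_mul, Matrix.mul_assoc]
    rw [e1, ← Matrix.mulVec_mulVec, ← Matrix.mulVec_mulVec, Matrix.dotProduct_mulVec,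
      Matrix.vecMul_transpose]
  have hKx : ∀ x : Fin n → ℝ, x ⬝ᵥ (K *ᵥ x) = (B *ᵥ x) ⬝ᵥ (B *ᵥ x) := by
    intro x
    rw [hKB, ← Matrix.mulVec_mulVec, Matrix.dotProduct_mulVec, Matrix.vecMul_transpose]
  have habs : ∀ x : Fin n → ℝ, |(B *ᵥ x) ⬝ᵥ (E *ᵥ (B *ᵥ x))| ≤ ε * (x ⬝ᵥ (K *ᵥ x)) := by
    intro x
    rw [hKx]
    exact (abs_dotProduct_mulVec_le E (B *ᵥ x)).trans
      (mul_le_mul_of_nonneg_right hE' (dotProduct_self_nonneg' _))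
  constructor <;> intro x
  · have h1 := hdiff x
    have h2 := abs_le.1 (habs x)
    rw [Matrix.smul_mulVec, dotProduct_smul, smul_eq_mul]
    linarith [h2.1]
  · have h1 := hdiff x
    have h2 := abs_le.1 (habs x)
    rw [Matrix.smul_mulVec, dotProduct_smul, smul_eq_mul]
    linarith [h2.2]

/-- Use 1 + t ≤ eᵗ, and then eᵗ ≤ 1 + 2t at t = 36p/m ≤ 1. -/
theorem one_add_inv_pow_le {p m : ℕ} (hm : 0 < m) (h : 36 * p ≤ m) :
    (1 + 9 * (m : ℝ)⁻¹) ^ (4 * p) ≤ 1 + 72 * (p / m) := by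
  have hm' : (0 : ℝ) < m := by exact_mod_cast hm
  have h' : (36 * p : ℝ) ≤ m := by exact_mod_cast h
  have h1 : (1 + 9 * (m : ℝ)⁻¹) ^ (4 * p) ≤ Real.exp (9 * (m : ℝ)⁻¹) ^ (4 * p) := by
    refine pow_le_pow_left₀ (by positivity) ?_ _
    linarith [Real.add_one_le_exp (9 * (m : ℝ)⁻¹)]
  rw [← Real.exp_nat_mul] at h1
  have e : ((4 * p : ℕ) : ℝ) * (9 * (m : ℝ)⁻¹) = 36 * (p / m) := by
    push_cast
    field_simp
    ring
  rw [e] at h1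
  have h0 : 0 ≤ 36 * ((p : ℝ) / m) := by positivity
  have h2 : 36 * ((p : ℝ) / m) ≤ 1 := by
    rw [← mul_div_assoc, div_le_one hm']
    exact h'
  have h3 := Real.abs_exp_sub_one_le (x := 36 * ((p : ℝ) / m)) (by rwa [abs_of_nonneg h0])
  rw [abs_of_nonneg h0] at h3
  have h4 := (abs_le.1 h3).2
  linarith

/-- The sketch has the approximate matrix product property. -/
theorem sketch_hasApproxMatrixProduct {p d m : ℕ} [NeZero d] (hp : 0 < p) (hm : 0 < m)
    (H : HashLaws d m) {ε : ℝ} (hε : 0 < ε) (hmε : 5000 * (p / ε ^ 2) ≤ m) :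
    HasApproxMatrixProduct (H.seedLaw (depth p)) (sketch (p := p) (d := d) (m := m)) ε
      (1 / 10) := by
  have := H.isProbabilityMeasure_seedLaw hm (depth p)
  have hM := momentBound_sketch (d := d) hp hm H
  rcases le_total 11 ε with h | h
  · exact hM.hasApproxMatrixProduct_of_large h
  · have hm' : (0 : ℝ) < m := by exact_mod_cast hm
    have hp' : (0 : ℝ) < p := by exact_mod_cast hp
    rw [← mul_div_assoc, div_le_iff₀ (by positivity)] at hmε
    -- For ε ≤ 11 the constant 5000 gives m ≥ 5000p/121 ≥ 36p, and it also exceeds 20 · 72, as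
    -- Markov's inequality requires.
    have hε2 : ε ^ 2 ≤ 121 := by nlinarith
    have h36 : (36 * p : ℝ) ≤ m := by nlinarith
    refine (hM.mono (one_add_inv_pow_le hm (by exact_mod_cast h36))).hasApproxMatrixProduct
      (by positivity) hε ?_
    rw [← mul_assoc, ← mul_div_assoc, div_le_iff₀ hm']
    linarith

/-- The sketch is an oblivious subspace embedding. -/
theorem sketch_isOSE {p d m : ℕ} [NeZero d] (hp : 0 < p) (hm : 0 < m) (H : HashLaws d m)
    {ε μ : ℝ} (hε : 0 < ε) (hμ : 0 < μ) (hmε : 5000 * (p * μ ^ 2 / ε ^ 2) ≤ m) (n : ℕ) :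
    IsOSE (H.seedLaw (depth p)) (sketch (p := p) (d := d) (m := m)) ε (1 / 10) μ n := by
  refine HasApproxMatrixProduct.isOSE hμ hε (sketch_hasApproxMatrixProduct hp hm H
    (by positivity) (le_trans (le_of_eq ?_) hmε)) n
  field_simp

/-! ### Existence of the hash families -/

theorem isKWiseIndependent_uniform (k : ℕ) (α β : Type*) [Fintype α] [Fintype β] [Nonempty β]
    [MeasurableSpace β] [MeasurableSingletonClass β] :
    IsKWiseIndependent k
      (Measure.pi fun _ : α => (PMF.uniformOfFintype β).toMeasure) := by
  classical
  intro s _ v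
  have : {f : α → β | ∀ x ∈ s, f x = v x} =
      Set.pi Set.univ fun x => if x ∈ s then {v x} else Set.univ := by
    ext f
    simp only [Set.mem_ofPred_eq, Set.mem_pi, Set.mem_univ, true_implies]
    refine forall_congr' fun x => ?_
    by_cases hx : x ∈ s <;> simp [hx]
  rw [this, Measure.pi_pi]
  have h : ∀ x, (PMF.uniformOfFintype β).toMeasure (if x ∈ s then {v x} else Set.univ) =
      if x ∈ s then (Fintype.card β : ℝ≥0∞)⁻¹ else 1 := by
    intro x
    split_ifs
    · rw [PMF.toMeasure_apply_singleton _ _ (measurableSet_singleton _)]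
      simp
    · simp
  simp [h]

theorem nonempty_hashLaws {d m : ℕ} (hm : 0 < m) : Nonempty (HashLaws d m) := by
  have : Nonempty (Fin m) := ⟨⟨0, hm⟩⟩
  exact ⟨⟨_, _, _, _, _, _, isKWiseIndependent_uniform 3 _ _, isKWiseIndependent_uniform 4 _ _,
    isKWiseIndependent_uniform 3 _ _, isKWiseIndependent_uniform 3 _ _,
    isKWiseIndependent_uniform 4 _ _, isKWiseIndependent_uniform 4 _ _⟩⟩

/-! ### The recursive computation of the sketch of a product tensor -/

/-- The tensor product of the vectors `y t`. -/
def tensorVec {q : ℕ} {γ : Type*} (y : Fin q → γ → ℝ) : (Fin q → γ) → ℝ :=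
  fun c => ∏ t, y t (c t)

/-- By distributivity, a sum over multi-indices of a product is the product of the sums. -/
theorem tensor_mulVec_tensorVec {q : ℕ} {ρ γ : Type*} [Fintype γ] [DecidableEq γ]
    (T : Fin q → Matrix ρ γ ℝ) (y : Fin q → γ → ℝ) :
    (Matrix.of fun (r : Fin q → ρ) (c : Fin q → γ) => ∏ j, T j (r j) (c j)) *ᵥ tensorVec y =
      tensorVec fun t => T t *ᵥ y t := by
  funext r
  simp only [Matrix.mulVec, dotProduct, tensorVec, Matrix.of_apply, ← Finset.prod_mul_distrib]
  rw [Finset.prod_univ_sum, Fintype.piFinset_univ]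

theorem sum_elim_leftChild_rightChild_bijective (k : ℕ) :
    Function.Bijective (Sum.elim (leftChild (k := k)) (rightChild (k := k))) := by
  rw [Fintype.bijective_iff_injective_and_card]
  constructor
  · rintro (i | i) (j | j) h <;>
      simp only [Sum.elim_inl, Sum.elim_inr, leftChild, rightChild, Fin.mk.injEq] at h
    · rw [Fin.ext (show (i : ℕ) = j by omega)]
    · omega
    · omega
    · rw [Fin.ext (show (i : ℕ) = j by omega)]
  · simp [pow_succ, mul_two]

theorem levelSketch_mulVec_tensorVec {m k : ℕ} (S : Fin (2 ^ k) → Matrix (Fin m) (Fin m × Fin m) ℝ)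
    (Y : Fin (2 ^ (k + 1)) → Fin m → ℝ) :
    levelSketch S *ᵥ tensorVec Y = tensorVec fun j =>
      S j *ᵥ fun ab => Y (leftChild j) ab.1 * Y (rightChild j) ab.2 := by
  rw [← tensor_mulVec_tensorVec]
  funext r
  simp only [Matrix.mulVec, dotProduct, levelSketch, Matrix.of_apply]
  rw [← (leftChild_rightChild_bijective k (γ := Fin m)).sum_comp]
  refine Finset.sum_congr rfl fun c _ => ?_
  congr 1
  simp only [tensorVec]
  rw [← (sum_elim_leftChild_rightChild_bijective k).prod_comp, Fintype.prod_sum_type,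
    Finset.prod_mul_distrib]
  rfl

theorem treeSketch_mulVec_tensorVec {m : ℕ} (L : ℕ)
    (S : (k : Fin L) → Fin (2 ^ (k : ℕ)) → Matrix (Fin m) (Fin m × Fin m) ℝ)
    (Y : Fin (2 ^ L) → Fin m → ℝ) : treeSketch L S *ᵥ tensorVec Y = combine L S Y := by
  induction L with
  | zero =>
    funext r
    simp only [treeSketch, combine, Matrix.mulVec, dotProduct, Matrix.of_apply, tensorVec]
    rw [Finset.sum_eq_single fun _ => r]
    · simp only [if_true, one_mul]
      exact Fin.prod_univ_one _
    · intro c _ hc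
      rw [if_neg, zero_mul]
      intro h
      apply hc
      funext i
      rw [← h]
      congr 1
      exact Fin.ext (by have := i.2; simp at this ⊢)
    · simp
  | succ L ih =>
    rw [treeSketch, ← Matrix.mulVec_mulVec, levelSketch_mulVec_tensorVec, ih, combine]

/-- If the vectors at the nodes of the tree, numbered in heap order, are computed from their
children, then the vector at the root is the output of the main loop. -/
theorem combine_eq_root {m : ℕ} (L : ℕ)
    (S : (k : Fin L) → Fin (2 ^ (k : ℕ)) → Matrix (Fin m) (Fin m × Fin m) ℝ)
    (Y : ℕ → Fin m → ℝ)
    (hY : ∀ (k : Fin L) (j : Fin (2 ^ (k : ℕ))), Y (2 ^ (k : ℕ) + j) =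
      S k j *ᵥ fun ab => Y (2 * (2 ^ (k : ℕ) + j)) ab.1 * Y (2 * (2 ^ (k : ℕ) + j) + 1) ab.2) :
    combine L S (fun j => Y (2 ^ L + j)) = Y 1 := by
  induction L with
  | zero => rfl
  | succ L ih =>
    rw [combine, ← ih (fun k => S k.castSucc) fun k j => hY k.castSucc j]
    congr 1
    funext j
    have := hY (Fin.last L) j
    simp only [Fin.val_last] at this
    rw [this]
    have e1 : 2 ^ (L + 1) + ((leftChild j : Fin (2 ^ (L + 1))) : ℕ) = 2 * (2 ^ L + j) := by
      simp only [leftChild]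
      ring
    have e2 : 2 ^ (L + 1) + ((rightChild j : Fin (2 ^ (L + 1))) : ℕ) = 2 * (2 ^ L + j) + 1 := by
      simp only [rightChild]
      ring
    rw [e1, e2]

/-- The entries of the padded tensor vanish outside the range of `padIndex`, where some trailing
index is not zero; on that range the trailing factors are one. -/
theorem mulVec_selfTensor {p q d : ℕ} [NeZero d] {ρ : Type*} (h : p ≤ q)
    (M : Matrix ρ (Fin q → Fin d) ℝ) (x : Fin d → ℝ) :
    M.submatrix id (padIndex p q) *ᵥ selfTensor p x =
      M *ᵥ tensorVec fun t : Fin q => if (t : ℕ) < p then x else Pi.single 0 1 := by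
  funext r
  simp only [Matrix.mulVec, dotProduct, Matrix.submatrix_apply, id]
  refine Fintype.sum_of_injective _ (padIndex_injective (d := d) h) _ _ ?_ ?_
  · intro c hc
    rw [mul_eq_zero]
    right
    by_contra hne
    apply hc
    have hne' := Finset.prod_ne_zero_iff.1 hne
    refine ⟨fun t => c ⟨t, t.2.trans_le h⟩, ?_⟩
    funext t
    by_cases ht : (t : ℕ) < p
    · simp [padIndex, ht]
    · have := hne' t (Finset.mem_univ t)
      simp only [if_neg ht] at this
      have h0 : c t = 0 := by
        by_contra hct
        exact this (Pi.single_eq_of_ne hct 1)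
      simp [padIndex, ht, h0]
  · intro i
    congr 1
    refine Fintype.prod_of_injective (Fin.castLE h) (Fin.castLE_injective h) _ _ ?_ ?_
    · intro t ht
      have : ¬ (t : ℕ) < p := fun hlt => ht ⟨⟨t, hlt⟩, rfl⟩
      simp [padIndex, this]
    · intro t
      simp [padIndex]

theorem sketch_mulVec_selfTensor {p d m : ℕ} [NeZero d] (seed : Seed (depth p) d m)
    (x : Fin d → ℝ) : sketch seed *ᵥ selfTensor p x = algorithm seed x := by
  rw [sketch, mulVec_selfTensor (Nat.le_pow_clog one_lt_two p), fullSketch, ← Matrix.mulVec_mulVec,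
    leafSketch, tensor_mulVec_tensorVec, treeSketch_mulVec_tensorVec, algorithm]

theorem sketch_mul_selfTensorMatrix {p d m n : ℕ} [NeZero d] (seed : Seed (depth p) d m)
    (X : Matrix (Fin d) (Fin n) ℝ) (j : Fin n) (r : Fin m) :
    (sketch seed * selfTensorMatrix p X) r j = algorithm seed (fun a => X a j) r := by
  rw [← sketch_mulVec_selfTensor]
  rfl

/-! ### The fast Fourier transform

The transform works on the residues of a polynomial modulo `z ^ (N / 2 ^ k) - w`, where `w` runs
through the squares of the twiddle factors with numbers `2 ^ k, …, 2 ^ (k + 1) - 1`. -/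

/-- The square root with nonnegative coordinates of a point of the upper unit half circle. -/
def halfAngle (z : ℂ) : ℂ := ⟨√((1 + z.re) / 2), √((1 - z.re) / 2)⟩

/-- The twiddle factors: the numbers `2 t` and `2 t + 1` are the square roots in the upper half
plane of the number `t` and of its negative. -/
def twiddle (t : ℕ) : ℂ :=
  if t ≤ 1 then 1
  else if t % 2 = 0 then halfAngle (twiddle (t / 2))
  else Complex.I * halfAngle (twiddle (t / 2))
termination_by t
decreasing_by all_goals omega

theorem twiddle_one : twiddle 1 = 1 := by
  rw [twiddle]
  simp

theorem twiddle_even {t : ℕ} (ht : 1 ≤ t) : twiddle (2 * t) = halfAngle (twiddle t) := by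
  rw [twiddle, if_neg (by omega), if_pos (by omega), Nat.mul_div_cancel_left t two_pos]

theorem twiddle_odd {t : ℕ} (ht : 1 ≤ t) :
    twiddle (2 * t + 1) = Complex.I * halfAngle (twiddle t) := by
  rw [twiddle, if_neg (by omega), if_neg (by omega), show (2 * t + 1) / 2 = t by omega]

/-- These are the half-angle formulas. The nonnegative imaginary part makes the product of the two
roots equal to Im z / 2 and not its negative. -/
theorem halfAngle_sq {z : ℂ} (hz : Complex.normSq z = 1) (him : 0 ≤ z.im) :
    halfAngle z ^ 2 = z := by
  rw [Complex.normSq_apply] at hz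
  have h1 : 0 ≤ (1 + z.re) / 2 := by nlinarith
  have h2 : 0 ≤ (1 - z.re) / 2 := by nlinarith
  apply Complex.ext
  · simp only [halfAngle, pow_two, Complex.mul_re, Real.mul_self_sqrt h1, Real.mul_self_sqrt h2]
    ring
  · simp only [halfAngle, pow_two, Complex.mul_im]
    have : √((1 + z.re) / 2) * √((1 - z.re) / 2) = z.im / 2 := by
      rw [← Real.sqrt_mul h1, show (1 + z.re) / 2 * ((1 - z.re) / 2) = (z.im / 2) ^ 2 by nlinarith]
      exact Real.sqrt_sq (by linarith)
    linarith

theorem normSq_halfAngle {z : ℂ} (hz : Complex.normSq z = 1) :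
    Complex.normSq (halfAngle z) = 1 := by
  rw [Complex.normSq_apply] at hz
  have h1 : 0 ≤ (1 + z.re) / 2 := by nlinarith [mul_self_nonneg z.im]
  have h2 : 0 ≤ (1 - z.re) / 2 := by nlinarith [mul_self_nonneg z.im]
  simp only [halfAngle, Complex.normSq_apply, Real.mul_self_sqrt h1, Real.mul_self_sqrt h2]
  ring

/-- This is the invariant that makes `halfAngle_sq` applicable at every stage: `halfAngle` has
nonnegative coordinates, and multiplication by i keeps such a point in the upper half plane. -/
theorem twiddle_spec (t : ℕ) : Complex.normSq (twiddle t) = 1 ∧ 0 ≤ (twiddle t).im := by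
  induction t using Nat.strong_induction_on with
  | _ t ih =>
    rw [twiddle]
    split_ifs with h1 h2
    · simp
    · exact ⟨normSq_halfAngle (ih _ (by omega)).1, Real.sqrt_nonneg _⟩
    · refine ⟨?_, ?_⟩
      · rw [Complex.normSq_mul, normSq_halfAngle (ih _ (by omega)).1]
        simp
      · simp only [halfAngle, Complex.mul_im, Complex.I_re, Complex.I_im, zero_mul, one_mul, zero_add]
        exact Real.sqrt_nonneg _

theorem twiddle_even_sq {t : ℕ} (ht : 1 ≤ t) : twiddle (2 * t) ^ 2 = twiddle t := by
  rw [twiddle_even ht, halfAngle_sq (twiddle_spec t).1 (twiddle_spec t).2]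

theorem twiddle_odd_sq {t : ℕ} (ht : 1 ≤ t) : twiddle (2 * t + 1) ^ 2 = - twiddle t := by
  rw [twiddle_odd ht, mul_pow, halfAngle_sq (twiddle_spec t).1 (twiddle_spec t).2, Complex.I_sq]
  ring

theorem twiddle_mul_conj (t : ℕ) : twiddle t * (starRingEnd ℂ) (twiddle t) = 1 := by
  rw [Complex.mul_conj, (twiddle_spec t).1]
  simp

/-- One step of the transform of length `2 * H`, from level `k` to level `k + 1`. -/
def fwdStep (H k : ℕ) (a : ℕ → ℂ) (i : ℕ) : ℂ :=
  if i % 2 = 0 then a (i / 2) + twiddle (2 ^ k + i / 2 % 2 ^ k) * a (i / 2 + H)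
  else a (i / 2) - twiddle (2 ^ k + i / 2 % 2 ^ k) * a (i / 2 + H)

/-- One step of the inverse transform of length `2 * H`, from level `k + 1` to level `k`. -/
def invStep (H k : ℕ) (a : ℕ → ℂ) (i : ℕ) : ℂ :=
  if i < H then (a (2 * i) + a (2 * i + 1)) / 2
  else (a (2 * (i - H)) - a (2 * (i - H) + 1)) / 2 *
    (starRingEnd ℂ) (twiddle (2 ^ k + (i - H) % 2 ^ k))

/-- The first `k` levels of the transform. -/
def fwd (H : ℕ) (a : ℕ → ℂ) : ℕ → ℕ → ℂ
  | 0 => a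
  | k + 1 => fwdStep H k (fwd H a k)

/-- The inverse of the first `k` levels of the transform. -/
def inv (H : ℕ) : ℕ → (ℕ → ℂ) → ℕ → ℂ
  | 0, a => a
  | k + 1, a => inv H k (invStep H k a)

/-- The half sum and half difference of a + wb and a - wb are a and wb, and the conjugate of w is
its inverse. Only indices below the length are considered, because the rest of an array in memory is
arbitrary. -/
theorem invStep_fwdStep {H k : ℕ} {a o : ℕ → ℂ} (h : ∀ i < 2 * H, o i = fwdStep H k a i) :
    ∀ i < 2 * H, invStep H k o i = a i := by
  have h0 : ∀ e < H, o (2 * e) = a e + twiddle (2 ^ k + e % 2 ^ k) * a (e + H) := by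
    intro e he
    rw [h _ (by omega), fwdStep, if_pos (by omega), Nat.mul_div_cancel_left e two_pos]
  have h1 : ∀ e < H, o (2 * e + 1) = a e - twiddle (2 ^ k + e % 2 ^ k) * a (e + H) := by
    intro e he
    rw [h _ (by omega), fwdStep, if_neg (by omega), show (2 * e + 1) / 2 = e by omega]
  intro i hi
  rw [invStep]
  split_ifs with hiH
  · rw [h0 i hiH, h1 i hiH]
    ring
  · rw [h0 _ (by omega), h1 _ (by omega), show i - H + H = i by omega]
    linear_combination a i * twiddle_mul_conj (2 ^ k + (i - H) % 2 ^ k)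

theorem inv_fwd {H : ℕ} (k : ℕ) {a o : ℕ → ℂ} (h : ∀ i < 2 * H, o i = fwd H a k i) :
    ∀ i < 2 * H, inv H k o i = a i := by
  induction k generalizing o with
  | zero => exact h
  | succ k ih => exact ih (invStep_fwdStep h)

/-- At level k the entries at i · 2^k + b are the coefficients of the polynomial reduced modulo
z^(2^l) - w², with w the twiddle factor of number 2^k + b, so they give the right value wherever
z^(2^l) = w². In the induction, residue b comes from residue b/2 one level earlier, where z^(2^l) is
plus or minus the twiddle factor used by the butterfly; the parity of b is the sign. -/
theorem sum_fwd {κ : ℕ} (a : ℕ → ℂ) (k l : ℕ) (hk : k + l = κ + 1) (b : ℕ) (hb : b < 2 ^ k) (z : ℂ)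
    (hz : z ^ 2 ^ l = twiddle (2 ^ k + b) ^ 2) :
    ∑ i ∈ Finset.range (2 ^ l), fwd (2 ^ κ) a k (i * 2 ^ k + b) * z ^ i =
      ∑ i ∈ Finset.range (2 ^ (κ + 1)), a i * z ^ i := by
  induction k generalizing l b with
  | zero =>
    have : b = 0 := by simpa using hb
    subst this
    rw [zero_add] at hk
    subst hk
    simp [fwd]
  | succ k ih =>
    have hb2 : b / 2 < 2 ^ k := by
      rw [pow_succ] at hb
      omega
    have h1 : 1 ≤ 2 ^ k + b / 2 := by
      have : 0 < 2 ^ k := by positivity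
      omega
    have hH : 2 ^ κ = 2 ^ l * 2 ^ k := by
      rw [← pow_add]
      congr 1
      omega
    have hpos : ∀ i, (i * 2 ^ (k + 1) + b) / 2 = i * 2 ^ k + b / 2 := by
      intro i
      rw [pow_succ, ← mul_assoc]
      omega
    have hmod : ∀ i, (i * 2 ^ k + b / 2) % 2 ^ k = b / 2 := by
      intro i
      rw [mul_comm, Nat.mul_add_mod, Nat.mod_eq_of_lt hb2]
    have hpar : ∀ i, (i * 2 ^ (k + 1) + b) % 2 = b % 2 := by
      intro i
      rw [pow_succ, ← mul_assoc]
      omega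
    -- Shifting the address by half the length, 2^κ = 2^l · 2^k, moves from coefficient i to
    -- coefficient i + 2^l of the same residue.
    have hterm : ∀ i, fwd (2 ^ κ) a (k + 1) (i * 2 ^ (k + 1) + b) =
        fwd (2 ^ κ) a k (i * 2 ^ k + b / 2) +
          z ^ 2 ^ l * fwd (2 ^ κ) a k ((2 ^ l + i) * 2 ^ k + b / 2) := by
      intro i
      have hadd : i * 2 ^ k + b / 2 + 2 ^ κ = (2 ^ l + i) * 2 ^ k + b / 2 := by
        rw [hH]
        ring
      rw [fwd, fwdStep, hpar, hpos, hmod, hadd, hz]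
      split_ifs with he
      · rw [show 2 ^ (k + 1) + b = 2 * (2 ^ k + b / 2) by rw [pow_succ]; omega, twiddle_even_sq h1]
      · rw [show 2 ^ (k + 1) + b = 2 * (2 ^ k + b / 2) + 1 by rw [pow_succ]; omega,
          twiddle_odd_sq h1]
        ring
    have hz' : z ^ 2 ^ (l + 1) = twiddle (2 ^ k + b / 2) ^ 2 := by
      rw [pow_succ, pow_mul, hz]
      rcases Nat.mod_two_eq_zero_or_one b with he | he
      · rw [show 2 ^ (k + 1) + b = 2 * (2 ^ k + b / 2) by rw [pow_succ]; omega, twiddle_even_sq h1]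
      · rw [show 2 ^ (k + 1) + b = 2 * (2 ^ k + b / 2) + 1 by rw [pow_succ]; omega,
          twiddle_odd_sq h1]
        ring
    rw [← ih (l + 1) (by omega) (b / 2) hb2 hz', pow_succ 2 l, mul_two, Finset.sum_range_add,
      ← Finset.sum_add_distrib]
    refine Finset.sum_congr rfl fun i _ => ?_
    rw [hterm, pow_add]
    ring

/-- The transform evaluates a polynomial. -/
theorem fwd_eq_sum {κ : ℕ} (a : ℕ → ℂ) {b : ℕ} (hb : b < 2 ^ (κ + 1)) :
    fwd (2 ^ κ) a (κ + 1) b =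
      ∑ i ∈ Finset.range (2 ^ (κ + 1)), a i * (twiddle (2 ^ (κ + 1) + b) ^ 2) ^ i := by
  rw [← sum_fwd a (κ + 1) 0 rfl b hb _ (by simp)]
  simp

/-- The `k`-th coefficient of the product of two polynomials of degree less than `m`. -/
def conv {R : Type*} [CommRing R] (m : ℕ) (f g : ℕ → R) (k : ℕ) : R :=
  ∑ i ∈ Finset.range m, ∑ j ∈ Finset.range m, if i + j = k then f i * g j else 0

theorem sum_conv_mul_pow {R : Type*} [CommRing R] {m N : ℕ} (h : 2 * m ≤ N) (f g : ℕ → R) (z : R) :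
    ∑ k ∈ Finset.range N, conv m f g k * z ^ k =
      (∑ i ∈ Finset.range m, f i * z ^ i) * (∑ i ∈ Finset.range m, g i * z ^ i) := by
  simp only [conv, Finset.sum_mul]
  rw [Finset.sum_comm]
  refine Finset.sum_congr rfl fun i hi => ?_
  rw [Finset.sum_comm, Finset.mul_sum]
  refine Finset.sum_congr rfl fun j hj => ?_
  rw [Finset.mem_range] at hi hj
  rw [Finset.sum_eq_single (i + j)]
  · rw [if_pos rfl, pow_add]
    ring
  · intro k _ hk
    rw [if_neg hk.symm, zero_mul]
  · intro hn
    rw [Finset.mem_range] at hn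
    omega

/-- The convolution of two real vectors by one transform of a complex vector. -/
theorem im_inv_sq_fwd {κ m : ℕ} (hm : 2 * m ≤ 2 ^ (κ + 1)) {u w : ℕ → ℝ} {f o : ℕ → ℂ}
    (hf : ∀ i < 2 ^ (κ + 1), f i = if i < m then ⟨u i, w i⟩ else 0)
    (ho : ∀ i < 2 ^ (κ + 1), o i = fwd (2 ^ κ) f (κ + 1) i ^ 2) {k : ℕ} (hk : k < 2 ^ (κ + 1)) :
    (inv (2 ^ κ) (κ + 1) o k).im / 2 = conv m u w k := by
  have hN : 2 ^ (κ + 1) = 2 * 2 ^ κ := by rw [pow_succ]; ring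
  have hsum : ∀ z : ℂ, ∑ i ∈ Finset.range (2 ^ (κ + 1)), f i * z ^ i =
      ∑ i ∈ Finset.range m, f i * z ^ i := by
    intro z
    symm
    refine Finset.sum_subset (Finset.range_mono (by omega)) fun i hi hi' => ?_
    rw [Finset.mem_range] at hi hi'
    rw [hf i hi, if_neg hi', zero_mul]
  -- The squared transform is the transform of the self-convolution: both evaluate the same
  -- polynomial at the same points, and the length of at least 2m prevents wraparound.
  have h1 : ∀ i < 2 * 2 ^ κ, o i = fwd (2 ^ κ) (conv m f f) (κ + 1) i := by
    intro i hi
    rw [← hN] at hi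
    rw [ho i hi, fwd_eq_sum _ hi, fwd_eq_sum _ hi, sum_conv_mul_pow hm, hsum, pow_two]
  rw [inv_fwd _ h1 k (by omega), conv, conv]
  have hfi : ∀ i ∈ Finset.range m, f i = ⟨u i, w i⟩ := by
    intro i hi
    rw [Finset.mem_range] at hi
    rw [hf i (by omega), if_pos hi]
  have h2 : ∑ i ∈ Finset.range m, ∑ j ∈ Finset.range m, (if i + j = k then f i * f j else 0) =
      ∑ i ∈ Finset.range m, ∑ j ∈ Finset.range m,
        if i + j = k then (⟨u i, w i⟩ * ⟨u j, w j⟩ : ℂ) else 0 := by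
    refine Finset.sum_congr rfl fun i hi => Finset.sum_congr rfl fun j hj => ?_
    rw [hfi i hi, hfi j hj]
  rw [h2]
  simp only [Complex.im_sum, apply_ite Complex.im, Complex.mul_im, Complex.zero_im]
  -- The imaginary part of a product is u w' + w u'. By symmetry of the convolution both terms
  -- contribute equally, hence the division by two.
  have h3 : ∀ i j, (if i + j = k then u i * w j + w i * u j else 0) =
      (if i + j = k then u i * w j else 0) + (if j + i = k then u j * w i else 0) := by
    intro i j
    rw [add_comm j i]
    split_ifs <;> ring
  simp only [h3, Finset.sum_add_distrib]
  rw [Finset.sum_comm (f := fun i j => if j + i = k then u j * w i else 0)]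
  ring

/-! ### Sketches as cyclic convolutions -/

/-- The entry in position `r` of the sum of the signed values `v` hashed by `h`. -/
def hashSum {m d : ℕ} (h : Fin d → Fin m) (σ : Fin d → Bool) (v : Fin d → ℝ) (r : ℕ) : ℝ :=
  ∑ i, if (h i : ℕ) = r then sgn (σ i) * v i else 0

theorem countSketch_mulVec {d m : ℕ} (s : CountSketchSeed d m) (v : Fin d → ℝ) (r : Fin m) :
    (countSketch s *ᵥ v) r = hashSum s.1 s.2 v r := by
  simp only [Matrix.mulVec, dotProduct, countSketch, hashSum, Matrix.of_apply, Fin.ext_iff]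
  refine Finset.sum_congr rfl fun i _ => ?_
  split_ifs <;> ring

/-- Two hash values below m have a sum below 2m, so residue r arises only from r and r + m. The
cyclic convolution is thus the linear one folded once. -/
theorem tensorSketch_mulVec {m : ℕ} (s : TensorSketchSeed m m) (u w : Fin m → ℝ) (r : Fin m) :
    (tensorSketch s *ᵥ fun ab => u ab.1 * w ab.2) r =
      conv m (hashSum s.1.1 s.2.1 u) (hashSum s.1.2 s.2.2 w) r +
      conv m (hashSum s.1.1 s.2.1 u) (hashSum s.1.2 s.2.2 w) (r + m) := by
  have hmul : ∀ i j, hashSum s.1.1 s.2.1 u i * hashSum s.1.2 s.2.2 w j =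
      ∑ a, ∑ b, if (s.1.1 a : ℕ) = i ∧ (s.1.2 b : ℕ) = j then
        sgn (s.2.1 a) * u a * (sgn (s.2.2 b) * w b) else 0 := by
    intro i j
    rw [hashSum, hashSum, Finset.sum_mul_sum]
    refine Finset.sum_congr rfl fun a _ => Finset.sum_congr rfl fun b _ => ?_
    rw [ite_and]
    split_ifs <;> simp
  have hconv : ∀ k, conv m (hashSum s.1.1 s.2.1 u) (hashSum s.1.2 s.2.2 w) k =
      ∑ a, ∑ b, if (s.1.1 a : ℕ) + (s.1.2 b : ℕ) = k then
        sgn (s.2.1 a) * u a * (sgn (s.2.2 b) * w b) else 0 := by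
    intro k
    have h1 : conv m (hashSum s.1.1 s.2.1 u) (hashSum s.1.2 s.2.2 w) k =
        ∑ i ∈ Finset.range m, ∑ j ∈ Finset.range m, ∑ a, ∑ b,
          if i + j = k ∧ (s.1.1 a : ℕ) = i ∧ (s.1.2 b : ℕ) = j then
          sgn (s.2.1 a) * u a * (sgn (s.2.2 b) * w b) else 0 := by
      rw [conv]
      refine Finset.sum_congr rfl fun i _ => Finset.sum_congr rfl fun j _ => ?_
      rw [hmul]
      by_cases h : i + j = k <;> simp [h]
    rw [h1]
    simp only [Finset.sum_comm (s := Finset.range m) (t := Finset.univ)]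
    refine Finset.sum_congr rfl fun a _ => Finset.sum_congr rfl fun b _ => ?_
    rw [Finset.sum_eq_single (s.1.1 a : ℕ), Finset.sum_eq_single (s.1.2 b : ℕ)]
    · simp
    · intro j _ hj
      rw [if_neg]
      exact fun h => hj h.2.2.symm
    · intro hn
      exact absurd (Finset.mem_range.2 (s.1.2 b).2) hn
    · intro i _ hi
      refine Finset.sum_eq_zero fun j _ => ?_
      rw [if_neg]
      exact fun h => hi h.2.1.symm
    · intro hn
      exact absurd (Finset.mem_range.2 (s.1.1 a).2) hn
  rw [hconv, hconv, ← Finset.sum_add_distrib]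
  simp only [Matrix.mulVec, dotProduct, tensorSketch, Matrix.of_apply, Fintype.sum_prod_type]
  refine Finset.sum_congr rfl fun a _ => ?_
  rw [← Finset.sum_add_distrib]
  refine Finset.sum_congr rfl fun b _ => ?_
  have ha := (s.1.1 a).2
  have hb := (s.1.2 b).2
  have hr := r.2
  have hiff : ((s.1.1 a : ℕ) + (s.1.2 b : ℕ)) % m = (r : ℕ) ↔
      (s.1.1 a : ℕ) + (s.1.2 b : ℕ) = r ∨ (s.1.1 a : ℕ) + (s.1.2 b : ℕ) = r + m := by
    rcases Nat.lt_or_ge ((s.1.1 a : ℕ) + (s.1.2 b : ℕ)) m with hlt | hge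
    · rw [Nat.mod_eq_of_lt hlt]
      omega
    · rw [Nat.mod_eq_sub_mod hge, Nat.mod_eq_of_lt (by omega)]
      omega
  by_cases h1 : (s.1.1 a : ℕ) + (s.1.2 b : ℕ) = r
  · rw [if_pos (hiff.2 (Or.inl h1)), if_pos h1, if_neg (by omega)]
    ring
  · by_cases h2 : (s.1.1 a : ℕ) + (s.1.2 b : ℕ) = r + m
    · rw [if_pos (hiff.2 (Or.inr h2)), if_neg h1, if_pos h2]
      ring
    · rw [if_neg (fun h => (hiff.1 h).elim h1 h2), if_neg h1, if_neg h2]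
      ring

/-! ### Program logic -/

@[simp] theorem writeReg_reg (s : Store) (i v j : ℕ) :
    (s.writeReg i v).reg j = if j = i then v else s.reg j := by
  simp [Store.writeReg, Function.update_apply]

@[simp] theorem writeReg_nat (s : Store) (i v : ℕ) : (s.writeReg i v).nat = s.nat := rfl

@[simp] theorem writeReg_real (s : Store) (i v : ℕ) : (s.writeReg i v).real = s.real := rfl

@[simp] theorem writeReal_reg (s : Store) (a k : ℕ) (v : ℝ) : (s.writeReal a k v).reg = s.reg := rfl

@[simp] theorem writeReal_nat (s : Store) (a k : ℕ) (v : ℝ) : (s.writeReal a k v).nat = s.nat := rfl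

@[simp] theorem writeReal_real (s : Store) (a k : ℕ) (v : ℝ) (b i : ℕ) :
    (s.writeReal a k v).real b i = if b = a ∧ i = k then v else s.real b i := by
  simp only [Store.writeReal, Function.update_apply]
  by_cases h : b = a <;> simp [h, Function.update_apply]

/-- The registers that a program may change. -/
def Prog.regs : Prog → List ℕ
  | .setReg i _ => [i]
  | .seq c c' => c.regs ++ c'.regs
  | .branch _ c c' => c.regs ++ c'.regs
  | .loop _ c => c.regs
  | _ => []

/-- The arrays of natural numbers that a program may change. -/
def Prog.nats : Prog → List ℕ
  | .setNat a _ _ => [a]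
  | .seq c c' => c.nats ++ c'.nats
  | .branch _ c c' => c.nats ++ c'.nats
  | .loop _ c => c.nats
  | _ => []

/-- The arrays of real numbers that a program may change. -/
def Prog.reals : Prog → List ℕ
  | .setReal a _ _ => [a]
  | .seq c c' => c.reals ++ c'.reals
  | .branch _ c c' => c.reals ++ c'.reals
  | .loop _ c => c.reals
  | _ => []

/-- Two states agree except where the program `c` may write. -/
structure Frame (c : Prog) (s s' : Store) : Prop where
  reg : ∀ i, i ∉ c.regs → s'.reg i = s.reg i
  nat : ∀ a, a ∉ c.nats → s'.nat a = s.nat a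
  real : ∀ a, a ∉ c.reals → s'.real a = s.real a

theorem Frame.refl (c : Prog) (s : Store) : Frame c s s :=
  ⟨fun _ _ => rfl, fun _ _ => rfl, fun _ _ => rfl⟩

theorem Frame.trans {c : Prog} {s s' s'' : Store} (h : Frame c s s') (h' : Frame c s' s'') :
    Frame c s s'' :=
  ⟨fun i hi => (h'.reg i hi).trans (h.reg i hi), fun a ha => (h'.nat a ha).trans (h.nat a ha),
    fun a ha => (h'.real a ha).trans (h.real a ha)⟩

/-- Since the possible writes can be read off the program text, invariants need only mention the
memory they concern; everything else is carried over by `decide` on lists of numbers. -/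
theorem Exec.frame {c : Prog} {s s' : Store} {t : ℕ} (h : Exec c s t s') : Frame c s s' := by
  induction h with
  | nop s => exact Frame.refl _ _
  | setReg s i e =>
    refine ⟨fun j hj => ?_, fun _ _ => rfl, fun _ _ => rfl⟩
    simp only [Prog.regs, List.mem_singleton] at hj
    simp [hj]
  | setNat s a idx e =>
    refine ⟨fun _ _ => rfl, fun b hb => ?_, fun _ _ => rfl⟩
    simp only [Prog.nats, List.mem_singleton] at hb
    simp [Store.writeNat, hb]
  | setReal s a idx e =>
    refine ⟨fun _ _ => rfl, fun _ _ => rfl, fun b hb => ?_⟩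
    simp only [Prog.reals, List.mem_singleton] at hb
    simp [Store.writeReal, hb]
  | seq _ _ h1 h2 =>
    refine Frame.trans (s' := _) ⟨fun i hi => h1.reg i ?_, fun a ha => h1.nat a ?_,
      fun a ha => h1.real a ?_⟩ ⟨fun i hi => h2.reg i ?_, fun a ha => h2.nat a ?_,
      fun a ha => h2.real a ?_⟩ <;>
    simp_all [Prog.regs, Prog.nats, Prog.reals]
  | branchTrue _ _ h1 =>
    refine ⟨fun i hi => h1.reg i ?_, fun a ha => h1.nat a ?_, fun a ha => h1.real a ?_⟩ <;>
    simp_all [Prog.regs, Prog.nats, Prog.reals]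
  | branchFalse _ _ h1 =>
    refine ⟨fun i hi => h1.reg i ?_, fun a ha => h1.nat a ?_, fun a ha => h1.real a ?_⟩ <;>
    simp_all [Prog.regs, Prog.nats, Prog.reals]
  | loopFalse _ => exact Frame.refl _ _
  | loopTrue _ _ _ h1 h2 => exact Frame.trans ⟨h1.reg, h1.nat, h1.real⟩ h2

/-- Started in `s`, the program `c` halts after at most `T` steps in a state that satisfies `Q`. -/
def Runs (c : Prog) (s : Store) (T : ℕ) (Q : Store → Prop) : Prop :=
  ∃ t s', Exec c s t s' ∧ t ≤ T ∧ Q s'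

theorem Runs.mono {c : Prog} {s : Store} {T T' : ℕ} {Q Q' : Store → Prop} (h : Runs c s T Q)
    (hT : T ≤ T') (hQ : ∀ s', Frame c s s' → Q s' → Q' s') : Runs c s T' Q' := by
  obtain ⟨t, s', he, ht, hs⟩ := h
  exact ⟨t, s', he, ht.trans hT, hQ s' he.frame hs⟩

theorem Runs.seq {c c' : Prog} {s : Store} {T T' : ℕ} {Q R : Store → Prop} (h : Runs c s T R)
    (h' : ∀ s', Frame c s s' → R s' → Runs c' s' T' Q) : Runs (.seq c c') s (T + T') Q := by
  obtain ⟨t, s', he, ht, hs⟩ := h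
  obtain ⟨t', s'', he', ht', hs'⟩ := h' s' he.frame hs
  exact ⟨t + t', s'', .seq he he', by omega, hs'⟩

theorem Runs.branch {b : Test} {c c' : Prog} {s : Store} {T : ℕ} {Q : Store → Prop}
    (h : b.holds s → Runs c s T Q) (h' : ¬ b.holds s → Runs c' s T Q) :
    Runs (.branch b c c') s (b.cost + T) Q := by
  by_cases hb : b.holds s
  · obtain ⟨t, s', he, ht, hs⟩ := h hb
    exact ⟨b.cost + t, s', .branchTrue hb he, by omega, hs⟩
  · obtain ⟨t, s', he, ht, hs⟩ := h' hb
    exact ⟨b.cost + t, s', .branchFalse hb he, by omega, hs⟩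

/-- A loop with `n` iterations. -/
theorem Runs.loop {b : Test} {c : Prog} {s : Store} (n : ℕ) (T : ℕ → ℕ) (I : ℕ → Store → Prop)
    (h0 : I 0 s) (hn : ∀ s', Frame c s s' → I n s' → ¬ b.holds s')
    (hstep : ∀ k < n, ∀ s', Frame c s s' → I k s' → b.holds s' ∧ Runs c s' (T k) (I (k + 1))) :
    Runs (.loop b c) s (∑ k ∈ Finset.range n, (b.cost + T k) + b.cost) (I n) := by
  have key : ∀ l k s', k + l = n → Frame c s s' → I k s' →
      Runs (.loop b c) s' (∑ k ∈ Finset.Ico k n, (b.cost + T k) + b.cost) (I n) := by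
    intro l
    induction l with
    | zero =>
      intro k s' hk hf hI
      obtain rfl : k = n := hk
      exact ⟨b.cost, s', .loopFalse (hn s' hf hI), by omega, hI⟩
    | succ l ih =>
      intro k s' hk hf hI
      obtain ⟨hb, t, s'', he, ht, hI'⟩ := hstep k (by omega) s' hf hI
      obtain ⟨t', s₃, he', ht', hQ⟩ := ih (k + 1) s'' (by omega) (hf.trans he.frame) hI'
      refine ⟨_, s₃, .loopTrue hb he he', ?_, hQ⟩
      rw [Finset.sum_eq_sum_Ico_succ_bot (by omega : k < n)]
      omega
  rw [Finset.range_eq_Ico]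
  exact key n 0 s (by omega) (Frame.refl _ _) h0

/-- The effect of a program without loops. -/
def Prog.run : Prog → Store → Store
  | .nop, s => s
  | .setReg i e, s => s.writeReg i (e.eval s)
  | .setNat a idx e, s => s.writeNat a (idx.eval s) (e.eval s)
  | .setReal a idx e, s => s.writeReal a (idx.eval s) (e.eval s)
  | .seq c c', s => c'.run (c.run s)
  | .branch b c c', s => open scoped Classical in if b.holds s then c.run s else c'.run s
  | .loop _ _, s => s

/-- A bound for the number of steps of a program without loops. -/
def Prog.bound : Prog → ℕ
  | .nop => 1
  | .setReg _ e => e.cost + 1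
  | .setNat _ idx e => idx.cost + e.cost + 1
  | .setReal _ idx e => idx.cost + e.cost + 1
  | .seq c c' => c.bound + c'.bound
  | .branch b c c' => b.cost + (c.bound + c'.bound)
  | .loop _ _ => 0

/-- There are no loops. -/
def Prog.loopFree : Prog → Bool
  | .seq c c' => c.loopFree && c'.loopFree
  | .branch _ c c' => c.loopFree && c'.loopFree
  | .loop _ _ => false
  | _ => true

theorem exec_run {c : Prog} (hc : c.loopFree = true) (s : Store) :
    ∃ t ≤ c.bound, Exec c s t (c.run s) := by
  induction c generalizing s with
  | nop => exact ⟨_, le_rfl, .nop s⟩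
  | setReg i e => exact ⟨_, le_rfl, .setReg s i e⟩
  | setNat a idx e => exact ⟨_, le_rfl, .setNat s a idx e⟩
  | setReal a idx e => exact ⟨_, le_rfl, .setReal s a idx e⟩
  | seq c c' ih ih' =>
    simp only [Prog.loopFree, Bool.and_eq_true] at hc
    obtain ⟨t, ht, he⟩ := ih hc.1 s
    obtain ⟨t', ht', he'⟩ := ih' hc.2 (c.run s)
    exact ⟨t + t', Nat.add_le_add ht ht', .seq he he'⟩
  | branch b c c' ih ih' =>
    simp only [Prog.loopFree, Bool.and_eq_true] at hc
    obtain ⟨t, ht, he⟩ := ih hc.1 s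
    obtain ⟨t', ht', he'⟩ := ih' hc.2 s
    by_cases hb : b.holds s
    · refine ⟨b.cost + t, by simp only [Prog.bound]; omega, ?_⟩
      rw [Prog.run, if_pos hb]
      exact .branchTrue hb he
    · refine ⟨b.cost + t', by simp only [Prog.bound]; omega, ?_⟩
      rw [Prog.run, if_neg hb]
      exact .branchFalse hb he'
  | loop b c => simp [Prog.loopFree] at hc

theorem Runs.of_run {c : Prog} (hc : c.loopFree = true) {s : Store} {T : ℕ} (hT : c.bound ≤ T)
    {Q : Store → Prop} (h : Q (c.run s)) : Runs c s T Q := by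
  obtain ⟨t, ht, he⟩ := exec_run hc s
  exact ⟨t, _, he, ht.trans hT, h⟩

/-- Let register `i` run from its present value to the value of register `hi`. -/
def forUp (i hi : ℕ) (c : Prog) : Prog :=
  .loop (.natLE (.add (.reg i) (.const 1)) (.reg hi))
    (.seq c (.setReg i (.add (.reg i) (.const 1))))

/-- The body has to establish the invariant for the store with the counter already advanced, so the
increment is dealt with once, here. The overhead 9 is 5 for the test and 4 for the increment; the
last 5 is the failing test. -/
theorem Runs.forUp {i hi : ℕ} {c : Prog} {s : Store} {a b : ℕ} (T : ℕ → ℕ)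
    (I : ℕ → Store → Prop) (hic : i ∉ c.regs) (hhc : hi ∉ c.regs) (hne : hi ≠ i)
    (ha : s.reg i = a) (hb : s.reg hi = b) (hab : a ≤ b) (h0 : I a s)
    (hstep : ∀ k, a ≤ k → k < b → ∀ s', Frame (forUp i hi c) s s' → s'.reg i = k → I k s' →
      Runs c s' (T k) fun s'' => I (k + 1) (s''.writeReg i (k + 1))) :
    Runs (forUp i hi c) s (∑ k ∈ Finset.Ico a b, (T k + 9) + 5) (I b) := by
  have hregs : ∀ s', Frame (.seq c (.setReg i (.add (.reg i) (.const 1)))) s s' →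
      s'.reg hi = b := by
    intro s' hf
    rw [hf.reg hi (by simp [Prog.regs, hhc, hne]), hb]
  have key := Runs.loop (b := .natLE (.add (.reg i) (.const 1)) (.reg hi))
    (c := .seq c (.setReg i (.add (.reg i) (.const 1)))) (s := s) (b - a) (fun k => T (a + k) + 4)
    (fun k s' => s'.reg i = a + k ∧ I (a + k) s') ⟨by simpa using ha, by simpa using h0⟩ ?_ ?_
  · refine key.mono ?_ fun s' _ h => ?_
    · rw [Finset.sum_Ico_eq_sum_range]
      refine Nat.add_le_add (Finset.sum_le_sum fun k _ => ?_) le_rfl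
      change 5 + (T (a + k) + 4) ≤ T (a + k) + 9
      omega
    · have := h.2
      rwa [Nat.add_sub_cancel' hab] at this
  · intro s' hf hI
    simp only [Test.holds, NExpr.eval, hregs s' hf, hI.1]
    omega
  · intro k hk s' hf hI
    refine ⟨?_, ?_⟩
    · simp only [Test.holds, NExpr.eval, hregs s' hf, hI.1]
      omega
    · refine Runs.seq (hstep (a + k) (by omega) (by omega) s' ⟨hf.reg, hf.nat, hf.real⟩ hI.1 hI.2)
        fun s'' hf' h' => Runs.of_run rfl le_rfl ?_
      have hi'' : s''.reg i = a + k := by rw [hf'.reg i hic, hI.1]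
      simp only [Prog.run, NExpr.eval, hi'']
      exact ⟨by simp [add_assoc], h'⟩

/-- A loop whose body takes a bounded number of steps. -/
theorem Runs.forUp_const {i hi : ℕ} {c : Prog} {s : Store} {a b : ℕ} (T : ℕ)
    (I : ℕ → Store → Prop) (hic : i ∉ c.regs) (hhc : hi ∉ c.regs) (hne : hi ≠ i)
    (ha : s.reg i = a) (hb : s.reg hi = b) (hab : a ≤ b) (h0 : I a s)
    (hstep : ∀ k, a ≤ k → k < b → ∀ s', Frame (TreeSketch.forUp i hi c) s s' → s'.reg i = k →
      I k s' → Runs c s' T fun s'' => I (k + 1) (s''.writeReg i (k + 1))) :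
    Runs (TreeSketch.forUp i hi c) s ((b - a) * (T + 9) + 5) (I b) := by
  have := Runs.forUp (fun _ => T) I hic hhc hne ha hb hab h0 hstep
  simpa using this

/-- Let register `i` run from `0` to the value of register `hi`. -/
def forZero (i hi : ℕ) (c : Prog) : Prog := .seq (.setReg i (.const 0)) (forUp i hi c)

theorem Runs.forZero {i hi : ℕ} {c : Prog} {s : Store} {b : ℕ} (T : ℕ)
    (I : ℕ → Store → Prop) (hic : i ∉ c.regs) (hhc : hi ∉ c.regs) (hne : hi ≠ i)
    (hb : s.reg hi = b) (h0 : I 0 (s.writeReg i 0))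
    (hstep : ∀ k < b, ∀ s', Frame (TreeSketch.forZero i hi c) s s' → s'.reg i = k →
      I k s' → Runs c s' T fun s'' => I (k + 1) (s''.writeReg i (k + 1))) :
    Runs (TreeSketch.forZero i hi c) s (b * (T + 9) + 7) (I b) := by
  have h1 : Runs (.setReg i (.const 0)) s 2 (fun s' => s' = s.writeReg i 0) :=
    Runs.of_run rfl le_rfl rfl
  refine (h1.seq fun s' hf hs' => ?_).mono (T := 2 + (b * (T + 9) + 5)) (by omega)
    fun _ _ h => h
  subst hs'
  refine Runs.forUp_const T I hic hhc hne (by simp) (by simp [hne, hb]) (Nat.zero_le b) h0 ?_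
  intro k _ hk s' hf' hi' hI
  refine hstep k hk s' ⟨fun j hj => ?_, fun a ha => ?_, fun a ha => ?_⟩ hi' hI
  · simp only [TreeSketch.forZero, Prog.regs, List.mem_append, not_or] at hj
    rw [hf'.reg j hj.2, hf.reg j hj.1]
  · simp only [TreeSketch.forZero, Prog.nats, List.nil_append] at ha
    rw [hf'.nat a ha]
    rfl
  · simp only [TreeSketch.forZero, Prog.reals, List.nil_append] at ha
    rw [hf'.real a ha]
    rfl

/-! ### The program for one internal node

Registers `0` to `3` hold the parameters `n, p, d, m`. The length of the transform is kept in
register `7`, half of it in register `6`, and the number of its levels in register `8`. The real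
arrays `6` and `7` hold a complex vector, `8` and `9` a second one, and `10` and `11` the twiddle
factors. Array `5` holds the vectors at the nodes, in heap order. -/

/-- The complex vector held by two real arrays. -/
def cvec (a b : ℕ) (s : Store) (i : ℕ) : ℂ := ⟨s.real a i, s.real b i⟩

/-- The sizes and the twiddle factors are available. -/
structure Ready (m κ : ℕ) (s : Store) : Prop where
  size : s.reg 3 = m
  half : s.reg 6 = 2 ^ κ
  length : s.reg 7 = 2 ^ (κ + 1)
  levels : s.reg 8 = κ + 1
  table : ∀ t, 1 ≤ t → t < 2 ^ (κ + 1) → cvec 10 11 s t = twiddle t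

theorem Ready.of_frame {m κ : ℕ} {c : Prog} {s s' : Store} (h : Ready m κ s) (hf : Frame c s s')
    (h3 : 3 ∉ c.regs) (h6 : 6 ∉ c.regs) (h7 : 7 ∉ c.regs) (h8 : 8 ∉ c.regs)
    (h10 : 10 ∉ c.reals) (h11 : 11 ∉ c.reals) : Ready m κ s' := by
  refine ⟨by rw [hf.reg _ h3, h.size], by rw [hf.reg _ h6, h.half], by rw [hf.reg _ h7, h.length],
    by rw [hf.reg _ h8, h.levels], fun t h1 ht => ?_⟩
  rw [← h.table t h1 ht, cvec, cvec, hf.real _ h10, hf.real _ h11]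

/-- Move the second complex vector to the first. -/
def copyBack : Prog :=
  forZero 20 7 (.seq (.setReal 6 (.reg 20) (.get 8 (.reg 20)))
    (.setReal 7 (.reg 20) (.get 9 (.reg 20))))

theorem runs_copyBack {m κ : ℕ} {s : Store} (h : Ready m κ s) :
    Runs copyBack s (24 * 2 ^ (κ + 1)) fun s' => ∀ i < 2 ^ (κ + 1), cvec 6 7 s' i = cvec 8 9 s i := by
  refine (Runs.forZero 8 (fun k s' => ∀ i < k, cvec 6 7 s' i = cvec 8 9 s i) (by decide)
    (by decide) (by decide) h.length (by simp) ?_).mono ?_ fun _ _ h => h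
  · intro k _ s' hf hk hI
    refine Runs.of_run rfl (by decide) ?_
    intro i hi
    have h8 := hf.real 8 (by decide)
    have h9 := hf.real 9 (by decide)
    simp only [cvec, Prog.run, NExpr.eval, RExpr.eval, hk, h8, h9, writeReg_real,
      writeReal_real, writeReal_reg] at hI ⊢
    rcases Nat.lt_succ_iff_lt_or_eq.1 hi with h | rfl
    · simpa [h.ne] using hI i h
    · simp
  · have : 1 ≤ 2 ^ (κ + 1) := Nat.one_le_two_pow
    omega

theorem add_one_mod_eq (k n : ℕ) (hn : 0 < n) :
    (k + 1) % n = if k % n + 1 = n then 0 else k % n + 1 := by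
  have h1 := Nat.mod_lt k hn
  rw [← Nat.mod_add_mod]
  split_ifs with h
  · rw [h, Nat.mod_self]
  · exact Nat.mod_eq_of_lt (by omega)

/-- Move the number of the twiddle factor cyclically. -/
def nextTwiddle : Prog :=
  .seq (.setReg 22 (.add (.reg 22) (.const 1)))
    (.branch (.natLE (.add (.reg 23) (.reg 23)) (.reg 22)) (.setReg 22 (.reg 23)) .nop)

/-- In the absence of a remainder operation, register `22` runs cyclically from 2^l to 2^(l+1) - 1
and is reset on reaching twice register `23`. -/
theorem runs_nextTwiddle {s : Store} {k l : ℕ} (h22 : s.reg 22 = 2 ^ l + k % 2 ^ l)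
    (h23 : s.reg 23 = 2 ^ l) : Runs nextTwiddle s 20 fun s' =>
      s'.reg 22 = 2 ^ l + (k + 1) % 2 ^ l ∧ s'.real = s.real := by
  refine Runs.of_run rfl (by decide) ?_
  have hpos : 0 < 2 ^ l := by positivity
  have hlt := Nat.mod_lt k hpos
  rw [add_one_mod_eq k _ hpos]
  simp only [nextTwiddle, Prog.run, Test.holds, NExpr.eval, writeReg_reg, h22, h23]
  split_ifs <;> simp_all <;> omega

/-- The index of an entry in the second half of the vector. -/
def upperHalf : NExpr := .add (.reg 21) (.reg 6)

theorem fwdStep_even (H l : ℕ) (a : ℕ → ℂ) (k : ℕ) :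
    fwdStep H l a (k + k) = a k + twiddle (2 ^ l + k % 2 ^ l) * a (k + H) := by
  rw [fwdStep, if_pos (by omega), show (k + k) / 2 = k by omega]

theorem fwdStep_odd (H l : ℕ) (a : ℕ → ℂ) (k : ℕ) :
    fwdStep H l a (k + k + 1) = a k - twiddle (2 ^ l + k % 2 ^ l) * a (k + H) := by
  rw [fwdStep, if_neg (by omega), show (k + k + 1) / 2 = k by omega]

/-- The body of `stepForward`. -/
def butterfly : Prog :=
  .seq (.setReal 8 (.add (.reg 21) (.reg 21)) (.add (.get 6 (.reg 21))
      (.sub (.mul (.get 10 (.reg 22)) (.get 6 upperHalf))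
        (.mul (.get 11 (.reg 22)) (.get 7 upperHalf)))))
  (.seq (.setReal 9 (.add (.reg 21) (.reg 21)) (.add (.get 7 (.reg 21))
      (.add (.mul (.get 10 (.reg 22)) (.get 7 upperHalf))
        (.mul (.get 11 (.reg 22)) (.get 6 upperHalf)))))
  (.seq (.setReal 8 (.add (.add (.reg 21) (.reg 21)) (.const 1)) (.sub (.get 6 (.reg 21))
      (.sub (.mul (.get 10 (.reg 22)) (.get 6 upperHalf))
        (.mul (.get 11 (.reg 22)) (.get 7 upperHalf)))))
  (.setReal 9 (.add (.add (.reg 21) (.reg 21)) (.const 1)) (.sub (.get 7 (.reg 21))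
      (.add (.mul (.get 10 (.reg 22)) (.get 7 upperHalf))
        (.mul (.get 11 (.reg 22)) (.get 6 upperHalf)))))))

/-- One step of the transform; register `23` holds the number of blocks. -/
def stepForward : Prog :=
  .seq (.setReg 22 (.reg 23)) (forZero 21 6 (.seq butterfly nextTwiddle))

theorem twiddle_index_lt {κ l k : ℕ} (hl : l ≤ κ) : 2 ^ l + k % 2 ^ l < 2 ^ (κ + 1) := by
  have h1 := Nat.mod_lt k (show 0 < 2 ^ l by positivity)
  have h2 : 2 ^ l ≤ 2 ^ κ := Nat.pow_le_pow_right two_pos hl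
  rw [pow_succ]
  omega

theorem runs_stepForward {m κ l : ℕ} {s : Store} (h : Ready m κ s) (hl : l ≤ κ)
    (h23 : s.reg 23 = 2 ^ l) :
    Runs stepForward s (100 * 2 ^ (κ + 1)) fun s' => ∀ i < 2 ^ (κ + 1),
      cvec 8 9 s' i = fwdStep (2 ^ κ) l (cvec 6 7 s) i := by
  have h1 : Runs (.setReg 22 (.reg 23)) s 2 (fun s' => s' = s.writeReg 22 (2 ^ l)) :=
    Runs.of_run rfl le_rfl (by simp [Prog.run, NExpr.eval, h23])
  have hN : 2 ^ (κ + 1) = 2 * 2 ^ κ := by rw [pow_succ]; ring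
  refine (h1.seq (T' := 2 ^ κ * (150 + 9) + 7) (Q := fun s' => ∀ i < 2 ^ (κ + 1),
      cvec 8 9 s' i = fwdStep (2 ^ κ) l (cvec 6 7 s) i) fun s' _ hs' => ?_).mono ?_ fun _ _ h => h
  · subst hs'
    -- Iteration k reads entries k and k + H of the first vector and writes entries 2k and 2k + 1 of
    -- the second, so the inputs stay intact.
    refine (Runs.forZero 150 (fun k s' => s'.reg 22 = 2 ^ l + k % 2 ^ l ∧ ∀ i < 2 * k,
      cvec 8 9 s' i = fwdStep (2 ^ κ) l (cvec 6 7 s) i) (by decide) (by decide) (by decide)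
      (by simp [h.half]) (by simp) ?_).mono le_rfl fun _ _ h => by rw [hN]; exact h.2
    intro k hk s' hf h21 hI
    have r6 : s'.reg 6 = 2 ^ κ := by rw [hf.reg 6 (by decide)]; simp [h.half]
    have r23 : s'.reg 23 = 2 ^ l := by rw [hf.reg 23 (by decide)]; simp [h23]
    have a6 : s'.real 6 = s.real 6 := by rw [hf.real 6 (by decide)]; rfl
    have a7 : s'.real 7 = s.real 7 := by rw [hf.real 7 (by decide)]; rfl
    have a10 : s'.real 10 = s.real 10 := by rw [hf.real 10 (by decide)]; rfl
    have a11 : s'.real 11 = s.real 11 := by rw [hf.real 11 (by decide)]; rfl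
    have htw := h.table (2 ^ l + k % 2 ^ l)
      (by have : 0 < 2 ^ l := by positivity
          omega) (twiddle_index_lt hl)
    have hbf : Runs butterfly s' 120 fun s'' => ∀ i < 2 * (k + 1),
        cvec 8 9 s'' i = fwdStep (2 ^ κ) l (cvec 6 7 s) i := by
      refine Runs.of_run rfl (by decide) ?_
      intro i hi
      simp only [butterfly, upperHalf, Prog.run, NExpr.eval, RExpr.eval, h21, hI.1, r6, a6, a7, a10,
        a11, cvec, writeReal_real, writeReal_reg]
      rcases Nat.lt_or_ge i (2 * k) with hlt | hge
      · have := hI.2 i hlt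
        simp only [cvec] at this
        simp [show i ≠ k + k by omega, show i ≠ k + k + 1 by omega, this]
      · rcases Nat.lt_or_ge i (2 * k + 1) with hlt | hge'
        · obtain rfl : i = k + k := by omega
          rw [fwdStep_even, ← htw]
          apply Complex.ext <;> simp [cvec]
        · obtain rfl : i = k + k + 1 := by omega
          rw [fwdStep_odd, ← htw]
          apply Complex.ext <;> simp [cvec]
    refine (hbf.seq (T' := 20) fun s'' hf' hs'' => (runs_nextTwiddle (k := k) (l := l)
      (by rw [hf'.reg 22 (by decide), hI.1]) (by rw [hf'.reg 23 (by decide), r23])).mono le_rfl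
      fun s₃ _ hs₃ => ⟨by simpa using hs₃.1, fun i hi => ?_⟩).mono (by norm_num) fun _ _ h => h
    rw [← hs'' i hi]
    simp [cvec, hs₃.2]
  · have : 1 ≤ 2 ^ κ := Nat.one_le_two_pow
    omega

/-- The body of `stepBackward`. -/
def inverseButterfly : Prog :=
  .seq (.setReal 8 (.reg 21) (.div (.add (.get 6 (.add (.reg 21) (.reg 21)))
      (.get 6 (.add (.add (.reg 21) (.reg 21)) (.const 1)))) (.const 2)))
  (.seq (.setReal 9 (.reg 21) (.div (.add (.get 7 (.add (.reg 21) (.reg 21)))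
      (.get 7 (.add (.add (.reg 21) (.reg 21)) (.const 1)))) (.const 2)))
  (.seq (.setReal 8 upperHalf (.div (.add
      (.mul (.sub (.get 6 (.add (.reg 21) (.reg 21)))
        (.get 6 (.add (.add (.reg 21) (.reg 21)) (.const 1)))) (.get 10 (.reg 22)))
      (.mul (.sub (.get 7 (.add (.reg 21) (.reg 21)))
        (.get 7 (.add (.add (.reg 21) (.reg 21)) (.const 1)))) (.get 11 (.reg 22)))) (.const 2)))
  (.setReal 9 upperHalf (.div (.sub
      (.mul (.sub (.get 7 (.add (.reg 21) (.reg 21)))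
        (.get 7 (.add (.add (.reg 21) (.reg 21)) (.const 1)))) (.get 10 (.reg 22)))
      (.mul (.sub (.get 6 (.add (.reg 21) (.reg 21)))
        (.get 6 (.add (.add (.reg 21) (.reg 21)) (.const 1)))) (.get 11 (.reg 22)))) (.const 2)))))

/-- One step of the inverse transform; register `23` holds the number of blocks. -/
def stepBackward : Prog :=
  .seq (.setReg 22 (.reg 23)) (forZero 21 6 (.seq inverseButterfly nextTwiddle))

theorem runs_stepBackward {m κ l : ℕ} {s : Store} (h : Ready m κ s) (hl : l ≤ κ)
    (h23 : s.reg 23 = 2 ^ l) :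
    Runs stepBackward s (100 * 2 ^ (κ + 1)) fun s' => ∀ i < 2 ^ (κ + 1),
      cvec 8 9 s' i = invStep (2 ^ κ) l (cvec 6 7 s) i := by
  have h1 : Runs (.setReg 22 (.reg 23)) s 2 (fun s' => s' = s.writeReg 22 (2 ^ l)) :=
    Runs.of_run rfl le_rfl (by simp [Prog.run, NExpr.eval, h23])
  have hN : 2 ^ (κ + 1) = 2 * 2 ^ κ := by rw [pow_succ]; ring
  refine (h1.seq (T' := 2 ^ κ * (150 + 9) + 7) (Q := fun s' => ∀ i < 2 ^ (κ + 1),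
      cvec 8 9 s' i = invStep (2 ^ κ) l (cvec 6 7 s) i) fun s' _ hs' => ?_).mono ?_ fun _ _ h => h
  · subst hs'
    -- Here iteration k writes the entries k and k + H, so the invariant fills both halves of the
    -- vector at the same time.
    refine (Runs.forZero 150 (fun k s' => s'.reg 22 = 2 ^ l + k % 2 ^ l ∧ ∀ i < k,
      cvec 8 9 s' i = invStep (2 ^ κ) l (cvec 6 7 s) i ∧
      cvec 8 9 s' (i + 2 ^ κ) = invStep (2 ^ κ) l (cvec 6 7 s) (i + 2 ^ κ))
      (by decide) (by decide) (by decide)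
      (by simp [h.half]) (by simp) ?_).mono le_rfl fun s' _ h i hi => ?_
    · intro k hk s' hf h21 hI
      have r6 : s'.reg 6 = 2 ^ κ := by rw [hf.reg 6 (by decide)]; simp [h.half]
      have r23 : s'.reg 23 = 2 ^ l := by rw [hf.reg 23 (by decide)]; simp [h23]
      have a6 : s'.real 6 = s.real 6 := by rw [hf.real 6 (by decide)]; rfl
      have a7 : s'.real 7 = s.real 7 := by rw [hf.real 7 (by decide)]; rfl
      have a10 : s'.real 10 = s.real 10 := by rw [hf.real 10 (by decide)]; rfl
      have a11 : s'.real 11 = s.real 11 := by rw [hf.real 11 (by decide)]; rfl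
      have htw := h.table (2 ^ l + k % 2 ^ l)
        (by have : 0 < 2 ^ l := by positivity
            omega) (twiddle_index_lt hl)
      have hbf : Runs inverseButterfly s' 130 fun s'' => ∀ i < k + 1,
          cvec 8 9 s'' i = invStep (2 ^ κ) l (cvec 6 7 s) i ∧
          cvec 8 9 s'' (i + 2 ^ κ) = invStep (2 ^ κ) l (cvec 6 7 s) (i + 2 ^ κ) := by
        refine Runs.of_run rfl (by decide) ?_
        intro i hi
        simp only [inverseButterfly, upperHalf, Prog.run, NExpr.eval, RExpr.eval, h21, hI.1, r6, a6,
          a7, a10, a11, cvec, writeReal_real, writeReal_reg]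
        rcases Nat.lt_succ_iff_lt_or_eq.1 hi with hlt | rfl
        · have := hI.2 i hlt
          simp only [cvec] at this
          simp [show i ≠ k by omega, show i ≠ k + 2 ^ κ by omega, show i + 2 ^ κ ≠ k by omega, this]
        · constructor
          · rw [invStep, if_pos hk]
            apply Complex.ext <;> simp [cvec, two_mul]
          · rw [invStep, if_neg (by omega), Nat.add_sub_cancel, ← htw]
            apply Complex.ext <;> simp [cvec, two_mul] <;> ring
      refine (hbf.seq (T' := 20) fun s'' hf' hs'' => (runs_nextTwiddle (k := k) (l := l)
        (by rw [hf'.reg 22 (by decide), hI.1]) (by rw [hf'.reg 23 (by decide), r23])).mono le_rfl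
        fun s₃ _ hs₃ => ⟨by simpa using hs₃.1, fun i hi => ?_⟩).mono (by norm_num) fun _ _ h => h
      have := hs'' i hi
      simp only [cvec, hs₃.2, writeReg_real] at this ⊢
      exact this
    · rcases Nat.lt_or_ge i (2 ^ κ) with hlt | hge
      · exact (h.2 i hlt).1
      · have := (h.2 (i - 2 ^ κ) (by omega)).2
        rwa [Nat.sub_add_cancel hge] at this
  · have : 1 ≤ 2 ^ κ := Nat.one_le_two_pow
    omega

/-- The specifications of the steps determine only the entries below the length; these congruences
allow them to be chained. -/
theorem fwdStep_congr {H k : ℕ} {a a' : ℕ → ℂ} (h : ∀ i < 2 * H, a i = a' i) :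
    ∀ i < 2 * H, fwdStep H k a i = fwdStep H k a' i := by
  intro i hi
  rw [fwdStep, fwdStep, h (i / 2) (by omega), h (i / 2 + H) (by omega)]

theorem invStep_congr {H k : ℕ} {a a' : ℕ → ℂ} (h : ∀ i < 2 * H, a i = a' i) :
    ∀ i < 2 * H, invStep H k a i = invStep H k a' i := by
  intro i hi
  rw [invStep, invStep]
  split_ifs with hH
  · rw [h (2 * i) (by omega), h (2 * i + 1) (by omega)]
  · rw [h (2 * (i - H)) (by omega), h (2 * (i - H) + 1) (by omega)]

theorem inv_congr {H : ℕ} (k : ℕ) {a a' : ℕ → ℂ} (h : ∀ i < 2 * H, a i = a' i) :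
    ∀ i < 2 * H, inv H k a i = inv H k a' i := by
  induction k generalizing a a' with
  | zero => exact h
  | succ k ih => exact ih (invStep_congr h)

/-- The transform. -/
def forward : Prog :=
  .seq (.setReg 23 (.const 1)) (forZero 24 8
    (.seq stepForward (.seq copyBack (.setReg 23 (.add (.reg 23) (.reg 23))))))

theorem runs_forward {m κ : ℕ} {s : Store} (h : Ready m κ s) :
    Runs forward s (150 * 2 ^ (κ + 1) * (κ + 1)) fun s' => s'.reg 23 = 2 ^ (κ + 1) ∧
      ∀ i < 2 ^ (κ + 1), cvec 6 7 s' i = fwd (2 ^ κ) (cvec 6 7 s) (κ + 1) i := by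
  have hN : 2 ^ (κ + 1) = 2 * 2 ^ κ := by rw [pow_succ]; ring
  have h1 : Runs (.setReg 23 (.const 1)) s 2 (fun s' => s' = s.writeReg 23 1) :=
    Runs.of_run rfl le_rfl rfl
  refine (h1.seq (T' := (κ + 1) * (128 * 2 ^ (κ + 1) + 9) + 7) (Q := fun s' =>
    s'.reg 23 = 2 ^ (κ + 1) ∧ ∀ i < 2 ^ (κ + 1), cvec 6 7 s' i =
      fwd (2 ^ κ) (cvec 6 7 s) (κ + 1) i) fun s' hf0 hs' => ?_).mono ?_ fun _ _ h => h
  · subst hs'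
    have hr0 := h.of_frame hf0 (by decide) (by decide) (by decide) (by decide) (by decide)
      (by decide)
    refine Runs.forZero (128 * 2 ^ (κ + 1)) (fun k s' => s'.reg 23 = 2 ^ k ∧ ∀ i < 2 ^ (κ + 1),
      cvec 6 7 s' i = fwd (2 ^ κ) (cvec 6 7 s) k i) (by decide) (by decide) (by decide)
      hr0.levels ⟨by simp, fun i _ => rfl⟩ ?_
    intro k hk s' hf _ hI
    have hr := hr0.of_frame hf (by decide) (by decide) (by decide) (by decide) (by decide)
      (by decide)
    refine ((runs_stepForward hr (by omega) hI.1).seq (T' := 24 * 2 ^ (κ + 1) + 4)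
      fun s₁ hf₁ h₁ => ?_).mono ?_ fun _ _ h => h
    · have hr₁ := hr.of_frame hf₁ (by decide) (by decide) (by decide) (by decide) (by decide)
        (by decide)
      refine (runs_copyBack hr₁).seq fun s₂ hf₂ h₂ => Runs.of_run rfl le_rfl ?_
      have r23 : s₂.reg 23 = 2 ^ k := by
        rw [hf₂.reg 23 (by decide), hf₁.reg 23 (by decide), hI.1]
      refine ⟨?_, fun i hi => ?_⟩
      · simp only [Prog.run, NExpr.eval, writeReg_reg, r23]
        simp [pow_succ, mul_two]
      · have e : cvec 6 7 ((Prog.run (.setReg 23 (.add (.reg 23) (.reg 23))) s₂).writeReg 24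
          (k + 1)) i = cvec 6 7 s₂ i := rfl
        rw [e, h₂ i hi, h₁ i hi, fwd]
        rw [hN] at hi hI
        exact fwdStep_congr hI.2 i hi
    · have : 1 ≤ 2 ^ (κ + 1) := Nat.one_le_two_pow
      omega
  · have : 1 ≤ 2 ^ (κ + 1) := Nat.one_le_two_pow
    nlinarith

/-- The inverse transform. -/
def backward : Prog :=
  forZero 24 8 (.seq (.setReg 23 (.half (.reg 23))) (.seq stepBackward copyBack))

theorem runs_backward {m κ : ℕ} {s : Store} (h : Ready m κ s) (h23 : s.reg 23 = 2 ^ (κ + 1)) :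
    Runs backward s (150 * 2 ^ (κ + 1) * (κ + 1)) fun s' =>
      ∀ i < 2 ^ (κ + 1), cvec 6 7 s' i = inv (2 ^ κ) (κ + 1) (cvec 6 7 s) i := by
  have hN : 2 ^ (κ + 1) = 2 * 2 ^ κ := by rw [pow_succ]; ring
  -- The invariant says that the remaining inverse levels, applied to the current vector, give the
  -- full inverse of the initial one.
  refine (Runs.forZero (128 * 2 ^ (κ + 1)) (fun k s' => s'.reg 23 = 2 ^ (κ + 1 - k) ∧
    ∀ i < 2 ^ (κ + 1), inv (2 ^ κ) (κ + 1 - k) (cvec 6 7 s') i =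
      inv (2 ^ κ) (κ + 1) (cvec 6 7 s) i) (by decide) (by decide) (by decide)
    h.levels ⟨by simpa using h23, fun i _ => rfl⟩ ?_).mono ?_ ?_
  · intro k hk s' hf _ hI
    have hr := h.of_frame hf (by decide) (by decide) (by decide) (by decide) (by decide)
      (by decide)
    obtain ⟨l, hl⟩ : ∃ l, κ + 1 - k = l + 1 := ⟨κ - k, by omega⟩
    have hl' : κ + 1 - (k + 1) = l := by omega
    rw [hl] at hI
    rw [hl']
    have h0 : Runs (.setReg 23 (.half (.reg 23))) s' 3 (fun s'' => s'' = s'.writeReg 23 (2 ^ l)) := by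
      refine Runs.of_run rfl le_rfl ?_
      simp only [Prog.run, NExpr.eval, hI.1]
      rw [pow_succ, Nat.mul_div_cancel _ two_pos]
    refine (h0.seq (T' := 100 * 2 ^ (κ + 1) + 24 * 2 ^ (κ + 1)) fun s₁ hf₁ h₁ => ?_).mono ?_
      fun _ _ h => h
    · have hr₁ := hr.of_frame hf₁ (by decide) (by decide) (by decide) (by decide) (by decide)
        (by decide)
      have r₁ : s₁.reg 23 = 2 ^ l := by rw [h₁]; simp
      refine (runs_stepBackward hr₁ (by omega) r₁).seq fun s₂ hf₂ h₂ => ?_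
      have hr₂ := hr₁.of_frame hf₂ (by decide) (by decide) (by decide) (by decide) (by decide)
        (by decide)
      refine (runs_copyBack hr₂).mono le_rfl fun s₃ hf₃ h₃ => ⟨?_, fun i hi => ?_⟩
      · rw [writeReg_reg, if_neg (by decide), hf₃.reg 23 (by decide), hf₂.reg 23 (by decide), r₁]
      · rw [← hI.2 i hi, inv]
        rw [hN] at hi h₂ h₃
        refine inv_congr l (fun e he => ?_) i hi
        change cvec 6 7 s₃ e = _
        rw [h₃ e he, h₂ e he, h₁]
        rfl
    · have : 1 ≤ 2 ^ (κ + 1) := Nat.one_le_two_pow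
      omega
  · have : 1 ≤ 2 ^ (κ + 1) := Nat.one_le_two_pow
    nlinarith
  · intro s' _ hI i hi
    have := hI.2 i hi
    simpa [inv] using this

/-- Square the entries of the complex vector. -/
def square : Prog :=
  .seq (forZero 20 7
    (.seq (.setReal 8 (.reg 20) (.sub (.mul (.get 6 (.reg 20)) (.get 6 (.reg 20)))
        (.mul (.get 7 (.reg 20)) (.get 7 (.reg 20)))))
      (.setReal 9 (.reg 20) (.add (.mul (.get 6 (.reg 20)) (.get 7 (.reg 20)))
        (.mul (.get 7 (.reg 20)) (.get 6 (.reg 20))))))) copyBack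

theorem runs_square {m κ : ℕ} {s : Store} (h : Ready m κ s) :
    Runs square s (80 * 2 ^ (κ + 1)) fun s' =>
      ∀ i < 2 ^ (κ + 1), cvec 6 7 s' i = cvec 6 7 s i ^ 2 := by
  have h1 : 1 ≤ 2 ^ (κ + 1) := Nat.one_le_two_pow
  refine ((Runs.forZero 40 (fun k s' => ∀ i < k, cvec 8 9 s' i = cvec 6 7 s i ^ 2) (by decide)
    (by decide) (by decide) h.length (by simp) ?_).seq (T' := 24 * 2 ^ (κ + 1))
    fun s' hf hs' => ?_).mono (by omega) fun _ _ h => h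
  · intro k _ s' hf hk hI
    refine Runs.of_run rfl (by decide) ?_
    intro i hi
    have h6 := hf.real 6 (by decide)
    have h7 := hf.real 7 (by decide)
    simp only [cvec, Prog.run, NExpr.eval, RExpr.eval, hk, h6, h7, writeReg_real,
      writeReal_real, writeReal_reg] at hI ⊢
    rcases Nat.lt_succ_iff_lt_or_eq.1 hi with h | rfl
    · simpa [h.ne] using hI i h
    · apply Complex.ext <;> simp [pow_two]
  · have hr := h.of_frame hf (by decide) (by decide) (by decide) (by decide) (by decide) (by decide)
    refine (runs_copyBack hr).mono le_rfl fun s'' _ h'' i hi => ?_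
    rw [h'' i hi, hs' i hi]

/-- Clear the complex vector. -/
def clear : Prog :=
  forZero 20 7 (.seq (.setReal 6 (.reg 20) (.const 0)) (.setReal 7 (.reg 20) (.const 0)))

theorem runs_clear {m κ : ℕ} {s : Store} (h : Ready m κ s) :
    Runs clear s (24 * 2 ^ (κ + 1)) fun s' =>
      ∀ i < 2 ^ (κ + 1), s'.real 6 i = 0 ∧ s'.real 7 i = 0 := by
  have h1 : 1 ≤ 2 ^ (κ + 1) := Nat.one_le_two_pow
  refine (Runs.forZero 8 (fun k s' => ∀ i < k, s'.real 6 i = 0 ∧ s'.real 7 i = 0) (by decide)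
    (by decide) (by decide) h.length (by simp) ?_).mono (by omega) fun _ _ h => h
  intro k _ s' hf hk hI
  refine Runs.of_run rfl (by decide) ?_
  intro i hi
  simp only [Prog.run, NExpr.eval, RExpr.eval, hk, writeReg_real, writeReal_real, writeReal_reg]
    at hI ⊢
  rcases Nat.lt_succ_iff_lt_or_eq.1 hi with h | rfl
  · simpa [h.ne] using hI i h
  · simp

/-- The address of an entry of the tables of the present node. -/
def nodeEntry : NExpr := .add (.reg 18) (.reg 20)

/-- The address of an entry of the vector at the left child of the present node. -/
def leftEntry : NExpr := .add (.add (.reg 18) (.reg 18)) (.reg 20)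

/-- Hash the vectors at the two children into the two parts of the complex vector; register `18`
holds the address of the present node. -/
def scatter : Prog :=
  forZero 20 3 (.seq
    (.setReal 6 (.get 3 nodeEntry) (.add (.get 6 (.get 3 nodeEntry))
      (.mul (.get 2 nodeEntry) (.get 5 leftEntry))))
    (.setReal 7 (.get 4 nodeEntry) (.add (.get 7 (.get 4 nodeEntry))
      (.mul (.get 3 nodeEntry) (.get 5 (.add leftEntry (.reg 3)))))))

/-- Node t has address o = t m in heap order, so its children start at o + o and o + o + m and no
multiplication is needed. -/
theorem runs_scatter {m κ o : ℕ} {s : Store} (h : Ready m κ s) (h18 : s.reg 18 = o) :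
    Runs scatter s (60 * m + 7) fun s' => ∀ i,
      s'.real 6 i = s.real 6 i + ∑ a ∈ Finset.range m,
        (if s.nat 3 (o + a) = i then s.real 2 (o + a) * s.real 5 (o + o + a) else 0) ∧
      s'.real 7 i = s.real 7 i + ∑ a ∈ Finset.range m,
        (if s.nat 4 (o + a) = i then s.real 3 (o + a) * s.real 5 (o + o + a + m) else 0) := by
  refine (Runs.forZero 51 (fun k s' => ∀ i,
      s'.real 6 i = s.real 6 i + ∑ a ∈ Finset.range k,
        (if s.nat 3 (o + a) = i then s.real 2 (o + a) * s.real 5 (o + o + a) else 0) ∧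
      s'.real 7 i = s.real 7 i + ∑ a ∈ Finset.range k,
        (if s.nat 4 (o + a) = i then s.real 3 (o + a) * s.real 5 (o + o + a + m) else 0))
    (by decide) (by decide) (by decide) h.size (by simp) ?_).mono (by omega) fun _ _ h => h
  intro k _ s' hf hk hI
  refine Runs.of_run rfl (by decide) ?_
  intro i
  have r18 : s'.reg 18 = o := by rw [hf.reg 18 (by decide), h18]
  have r3 : s'.reg 3 = m := by rw [hf.reg 3 (by decide), h.size]
  have n3 := hf.nat 3 (by decide)
  have n4 := hf.nat 4 (by decide)
  have a2 := hf.real 2 (by decide)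
  have a3 := hf.real 3 (by decide)
  have a5 := hf.real 5 (by decide)
  simp only [nodeEntry, leftEntry, Prog.run, NExpr.eval, RExpr.eval, hk, r18, r3, n3, n4, a2, a3,
    a5, writeReg_real, writeReal_real, writeReal_reg, writeReal_nat, Finset.sum_range_succ]
  constructor
  · by_cases hi : i = s.nat 3 (o + k)
    · subst hi
      simp [(hI _).1, add_assoc]
    · simp [hi, Ne.symm hi, (hI _).1]
  · by_cases hi : i = s.nat 4 (o + k)
    · subst hi
      simp [(hI _).2, add_assoc]
    · simp [hi, Ne.symm hi, (hI _).2]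

/-- Reduce the convolution modulo `m` and store it at the present node. -/
def fold : Prog :=
  forZero 20 3 (.setReal 5 nodeEntry
    (.div (.add (.get 7 (.reg 20)) (.get 7 (.add (.reg 20) (.reg 3)))) (.const 2)))

/-- Adding positions r and r + m makes the convolution cyclic, and halving removes the factor two in
the imaginary part of a complex square. -/
theorem runs_fold {m κ o : ℕ} {s : Store} (h : Ready m κ s) (h18 : s.reg 18 = o) :
    Runs fold s (24 * m + 7) fun s' =>
      (∀ r < m, s'.real 5 (o + r) = (s.real 7 r + s.real 7 (r + m)) / 2) ∧
      ∀ x, x < o ∨ o + m ≤ x → s'.real 5 x = s.real 5 x := by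
  refine (Runs.forZero 15 (fun k s' =>
      (∀ r < k, s'.real 5 (o + r) = (s.real 7 r + s.real 7 (r + m)) / 2) ∧
      ∀ x, x < o ∨ o + k ≤ x → s'.real 5 x = s.real 5 x)
    (by decide) (by decide) (by decide) h.size (by simp) ?_).mono (by omega) fun _ _ h => h
  intro k _ s' hf hk hI
  refine Runs.of_run rfl (by decide) ?_
  have r18 : s'.reg 18 = o := by rw [hf.reg 18 (by decide), h18]
  have r3 : s'.reg 3 = m := by rw [hf.reg 3 (by decide), h.size]
  have a7 := hf.real 7 (by decide)
  simp only [nodeEntry, Prog.run, NExpr.eval, RExpr.eval, hk, r18, r3, a7, writeReg_real,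
    writeReal_real, true_and]
  refine ⟨fun r hr => ?_, fun x hx => ?_⟩
  · rcases Nat.lt_succ_iff_lt_or_eq.1 hr with h | rfl
    · rw [if_neg (by omega)]
      exact hI.1 r h
    · simp
  · rw [if_neg (by omega)]
    exact hI.2 x (by omega)

/-- The tables of the node with address `o`. -/
structure NodeTables {m : ℕ} (v : TensorSketchSeed m m) (o : ℕ) (s : Store) : Prop where
  hash₁ : ∀ i : Fin m, s.nat 3 (o + i) = (v.1.1 i : ℕ)
  hash₂ : ∀ i : Fin m, s.nat 4 (o + i) = (v.1.2 i : ℕ)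
  sign₁ : ∀ i : Fin m, s.real 2 (o + i) = sgn (v.2.1 i)
  sign₂ : ∀ i : Fin m, s.real 3 (o + i) = sgn (v.2.2 i)

/-- Compute the vector at the node before the present one from the vectors at its children. -/
def nodeStep : Prog :=
  .seq (.setReg 18 (.sub (.reg 18) (.reg 3))) (.seq clear (.seq scatter (.seq forward
    (.seq square (.seq backward fold)))))

theorem hashSum_eq_zero {m d : ℕ} (h : Fin d → Fin m) (σ : Fin d → Bool) (v : Fin d → ℝ) {r : ℕ}
    (hr : m ≤ r) : hashSum h σ v r = 0 := by
  refine Finset.sum_eq_zero fun i _ => ?_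
  have := (h i).2
  rw [if_neg (by omega)]

/-- The correctness combines `im_inv_sq_fwd`, for the passage through the transform, with
`tensorSketch_mulVec`, for the folding. The transform is long enough because m ≤ 2^κ. -/
theorem runs_nodeStep {m κ o : ℕ} {s : Store} (h : Ready m κ s) (hm : m ≤ 2 ^ κ)
    (h18 : s.reg 18 = o + m) :
    Runs nodeStep s (550 * 2 ^ (κ + 1) * (κ + 1)) fun s' => s'.reg 18 = o ∧
      (∀ v : TensorSketchSeed m m, NodeTables v o s → ∀ r : Fin m,
        s'.real 5 (o + r) = (tensorSketch v *ᵥ fun ab => s.real 5 (o + o + ab.1) *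
          s.real 5 (o + o + m + ab.2)) r) ∧
      ∀ x, x < o ∨ o + m ≤ x → s'.real 5 x = s.real 5 x := by
  have hN : 2 ^ (κ + 1) = 2 * 2 ^ κ := by rw [pow_succ]; ring
  have h0 : Runs (.setReg 18 (.sub (.reg 18) (.reg 3))) s 4 (fun s' => s' = s.writeReg 18 o) := by
    refine Runs.of_run rfl le_rfl ?_
    simp [Prog.run, NExpr.eval, h18, h.size]
  refine (h0.seq fun s₀ f₀ h₀ => ?_).mono (T := 4 + (24 * 2 ^ (κ + 1) + ((60 * m + 7) +
    (150 * 2 ^ (κ + 1) * (κ + 1) + (80 * 2 ^ (κ + 1) + (150 * 2 ^ (κ + 1) * (κ + 1) +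
    (24 * m + 7))))))) ?_ fun _ _ h => h
  · have g₀ := h.of_frame f₀ (by decide) (by decide) (by decide) (by decide) (by decide) (by decide)
    refine (runs_clear g₀).seq fun s₁ f₁ h₁ => ?_
    have g₁ := g₀.of_frame f₁ (by decide) (by decide) (by decide) (by decide) (by decide)
      (by decide)
    have o₁ : s₁.reg 18 = o := by
      rw [f₁.reg 18 (by decide), h₀]
      simp
    refine (runs_scatter g₁ o₁).seq fun s₂ f₂ h₂ => ?_
    have g₂ := g₁.of_frame f₂ (by decide) (by decide) (by decide) (by decide) (by decide)
      (by decide)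
    refine (runs_forward g₂).seq fun s₃ f₃ h₃ => ?_
    have g₃ := g₂.of_frame f₃ (by decide) (by decide) (by decide) (by decide) (by decide)
      (by decide)
    refine (runs_square g₃).seq fun s₄ f₄ h₄ => ?_
    have g₄ := g₃.of_frame f₄ (by decide) (by decide) (by decide) (by decide) (by decide)
      (by decide)
    refine (runs_backward g₄ (by rw [f₄.reg 23 (by decide), h₃.1])).seq fun s₅ f₅ h₅ => ?_
    have g₅ := g₄.of_frame f₅ (by decide) (by decide) (by decide) (by decide) (by decide)
      (by decide)
    have o₅ : s₅.reg 18 = o := by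
      rw [f₅.reg 18 (by decide), f₄.reg 18 (by decide), f₃.reg 18 (by decide),
        f₂.reg 18 (by decide), o₁]
    have y₅ : s₅.real 5 = s.real 5 := by
      rw [f₅.real 5 (by decide), f₄.real 5 (by decide), f₃.real 5 (by decide),
        f₂.real 5 (by decide), f₁.real 5 (by decide), h₀]
      rfl
    refine (runs_fold g₅ o₅).mono le_rfl fun s₆ f₆ h₆ =>
      ⟨?_, fun v hv r => ?_, fun x hx => ?_⟩
    · rw [f₆.reg 18 (by decide), o₅]
    · set u : Fin m → ℝ := fun a => s.real 5 (o + o + a) with hu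
      set w : Fin m → ℝ := fun b => s.real 5 (o + o + m + b) with hw
      -- After clearing and scattering, the vector is the hash sum of u plus i times that of w; it
      -- vanishes from position m on because hash values are below m.
      have hf : ∀ i < 2 ^ (κ + 1), cvec 6 7 s₂ i =
          if i < m then ⟨hashSum v.1.1 v.2.1 u i, hashSum v.1.2 v.2.2 w i⟩ else 0 := by
        intro i hi
        have n3 : s₁.nat 3 = s.nat 3 := by rw [f₁.nat 3 (by decide), h₀]; rfl
        have n4 : s₁.nat 4 = s.nat 4 := by rw [f₁.nat 4 (by decide), h₀]; rfl
        have a2 : s₁.real 2 = s.real 2 := by rw [f₁.real 2 (by decide), h₀]; rfl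
        have a3 : s₁.real 3 = s.real 3 := by rw [f₁.real 3 (by decide), h₀]; rfl
        have a5 : s₁.real 5 = s.real 5 := by rw [f₁.real 5 (by decide), h₀]; rfl
        have e1 : s₂.real 6 i = hashSum v.1.1 v.2.1 u i := by
          rw [(h₂ i).1, (h₁ i hi).1, zero_add, Finset.sum_range, hashSum]
          refine Finset.sum_congr rfl fun a _ => ?_
          rw [n3, a2, a5, hv.hash₁, hv.sign₁]
        have e2 : s₂.real 7 i = hashSum v.1.2 v.2.2 w i := by
          rw [(h₂ i).2, (h₁ i hi).2, zero_add, Finset.sum_range, hashSum]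
          refine Finset.sum_congr rfl fun a _ => ?_
          rw [n4, a3, a5, hv.hash₂, hv.sign₂, hw, add_right_comm (o + o)]
        rw [cvec, e1, e2]
        split_ifs with him
        · rfl
        · rw [hashSum_eq_zero _ _ _ (by omega), hashSum_eq_zero _ _ _ (by omega)]
          rfl
      have hc : ∀ k < 2 ^ (κ + 1), s₅.real 7 k / 2 =
          conv m (hashSum v.1.1 v.2.1 u) (hashSum v.1.2 v.2.2 w) k := by
        intro k hk
        rw [← im_inv_sq_fwd (o := cvec 6 7 s₄) (by omega) hf (fun i hi => by rw [h₄ i hi, h₃.2 i hi]) hk,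
          ← h₅ k hk]
        rfl
      rw [h₆.1 r r.2, add_div, hc r (by have := r.2; omega), hc (r + m) (by have := r.2; omega)]
      exact (tensorSketch_mulVec v u w r).symm
    · rw [h₆.2 x hx, y₅]
  · have h1 : 1 ≤ 2 ^ (κ + 1) := Nat.one_le_two_pow
    have h2 : 2 ^ (κ + 1) ≤ 2 ^ (κ + 1) * (κ + 1) := Nat.le_mul_of_pos_right _ (by omega)
    have h3 : 1 ≤ 2 ^ (κ + 1) * (κ + 1) := h1.trans h2
    rw [mul_assoc, mul_assoc]
    omega

/-! ### The program -/

/-- The program writes neither to its input nor to the sizes and twiddle factors. -/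
abbrev Prog.Preserves (c : Prog) : Prop :=
  c.nats = [] ∧ (∀ i ∈ List.range 9, i ∉ c.regs) ∧ ∀ a ∈ [0, 1, 2, 3, 10, 11], a ∉ c.reals

theorem Loaded.of_frame {n p d m : ℕ} {seed : Seed (depth p) d m} {X : Matrix (Fin d) (Fin n) ℝ}
    {s s' : Store} (h : Loaded seed X s) {c : Prog} (hf : Frame c s s') (hn : c.nats = [])
    (hr : ∀ i ∈ List.range 4, i ∉ c.regs) (ha : ∀ a ∈ List.range 4, a ∉ c.reals) :
    Loaded seed X s' := by
  have en : s'.nat = s.nat := by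
    funext a
    exact hf.nat a (by simp [hn])
  have r0 := hf.reg 0 (hr 0 (by decide))
  have r1 := hf.reg 1 (hr 1 (by decide))
  have r2 := hf.reg 2 (hr 2 (by decide))
  have r3 := hf.reg 3 (hr 3 (by decide))
  have a0 := hf.real 0 (ha 0 (by decide))
  have a1 := hf.real 1 (ha 1 (by decide))
  have a2 := hf.real 2 (ha 2 (by decide))
  have a3 := hf.real 3 (ha 3 (by decide))
  exact ⟨r0 ▸ h.reg_n, r1 ▸ h.reg_p, r2 ▸ h.reg_d, r3 ▸ h.reg_m, en ▸ h.ptr_zero, en ▸ h.ptr_mono,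
    en ▸ h.rows, by rw [en, a0]; exact h.vals, en ▸ h.leafHash, a1 ▸ h.leafSign, en ▸ h.nodeHash₁,
    en ▸ h.nodeHash₂, a2 ▸ h.nodeSign₁, a3 ▸ h.nodeSign₂⟩

/-- The input, the sizes and the twiddle factors are available. -/
structure Prepared {n p d m : ℕ} (seed : Seed (depth p) d m) (X : Matrix (Fin d) (Fin n) ℝ)
    (κ : ℕ) (s : Store) : Prop where
  loaded : Loaded seed X s
  ready : Ready m κ s
  leaves : s.reg 4 = 2 ^ depth p
  base : s.reg 5 = 2 ^ depth p * m

theorem Prepared.of_frame {n p d m κ : ℕ} {seed : Seed (depth p) d m}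
    {X : Matrix (Fin d) (Fin n) ℝ} {s s' : Store} (h : Prepared seed X κ s) {c : Prog}
    (hf : Frame c s s') (hc : c.Preserves) : Prepared seed X κ s' := by
  refine ⟨h.loaded.of_frame hf hc.1 (fun i hi => hc.2.1 i ?_) fun a ha => hc.2.2 a ?_,
    h.ready.of_frame hf (hc.2.1 3 (by decide)) (hc.2.1 6 (by decide)) (hc.2.1 7 (by decide))
      (hc.2.1 8 (by decide)) (hc.2.2 10 (by decide)) (hc.2.2 11 (by decide)),
    (hf.reg 4 (hc.2.1 4 (by decide))).trans h.leaves,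
    (hf.reg 5 (hc.2.1 5 (by decide))).trans h.base⟩
  · rw [List.mem_range] at hi ⊢
    omega
  · rw [List.mem_range] at ha
    interval_cases a <;> decide

/-! #### The leaves -/

/-- Clear the vector whose address is in register `12`. -/
def clearLeaf : Prog := forZero 14 3 (.setReal 5 (.add (.reg 12) (.reg 14)) (.const 0))

theorem runs_clearLeaf {m y : ℕ} {s : Store} (h3 : s.reg 3 = m) (h12 : s.reg 12 = y) :
    Runs clearLeaf s (14 * m + 7) fun s' => ∀ x,
      s'.real 5 x = if y ≤ x ∧ x < y + m then 0 else s.real 5 x := by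
  refine (Runs.forZero 5 (fun k s' => ∀ x,
      s'.real 5 x = if y ≤ x ∧ x < y + k then 0 else s.real 5 x)
    (by decide) (by decide) (by decide) h3 ?_ ?_).mono (by omega) fun _ _ h => h
  · intro x
    rw [if_neg (by omega)]
    rfl
  · intro k _ s' hf hk hI
    refine Runs.of_run rfl (by decide) ?_
    intro x
    have r12 : s'.reg 12 = y := by rw [hf.reg 12 (by decide), h12]
    simp only [Prog.run, NExpr.eval, RExpr.eval, hk, r12, writeReg_real, writeReal_real, true_and,
      hI x, Int.cast_zero]
    split_ifs <;> first | rfl | omega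

/-- The address of the function values at the row of the present entry of `X`. -/
def rowEntry : NExpr := .add (.reg 13) (.get 1 (.reg 15))

/-- The address in which the present entry of `X` is accumulated. -/
def targetEntry : NExpr := .add (.reg 12) (.get 2 rowEntry)

/-- Hash the entries of `X` from register `15` to register `16` into the vector whose address is in
register `12`; register `13` holds the address of the tables of the leaf. -/
def hashEntries : Prog :=
  forUp 15 16 (.setReal 5 targetEntry
    (.add (.get 5 targetEntry) (.mul (.get 1 rowEntry) (.get 0 (.reg 15)))))

theorem runs_hashEntries {y tb lo hi : ℕ} {s : Store} (h12 : s.reg 12 = y) (h13 : s.reg 13 = tb)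
    (h15 : s.reg 15 = lo) (h16 : s.reg 16 = hi) (hle : lo ≤ hi) :
    Runs hashEntries s (40 * (hi - lo) + 5) fun s' => ∀ x,
      s'.real 5 x = s.real 5 x + ∑ k ∈ Finset.Ico lo hi,
        if y + s.nat 2 (tb + s.nat 1 k) = x then s.real 1 (tb + s.nat 1 k) * s.real 0 k else 0 := by
  refine (Runs.forUp_const 30 (fun l s' => ∀ x,
      s'.real 5 x = s.real 5 x + ∑ k ∈ Finset.Ico lo l,
        if y + s.nat 2 (tb + s.nat 1 k) = x then s.real 1 (tb + s.nat 1 k) * s.real 0 k else 0)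
    (by decide) (by decide) (by decide) h15 h16 hle (by simp) ?_).mono (by omega) fun _ _ h => h
  intro k hk _ s' hf hk' hI
  refine Runs.of_run rfl (by decide) ?_
  intro x
  have r12 : s'.reg 12 = y := by rw [hf.reg 12 (by decide), h12]
  have r13 : s'.reg 13 = tb := by rw [hf.reg 13 (by decide), h13]
  have n1 := hf.nat 1 (by decide)
  have n2 := hf.nat 2 (by decide)
  have a0 := hf.real 0 (by decide)
  have a1 := hf.real 1 (by decide)
  rw [Finset.sum_Ico_succ_top hk]
  simp only [targetEntry, rowEntry, Prog.run, NExpr.eval, RExpr.eval, hk', r12, r13, n1, n2, a0, a1,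
    writeReg_real, writeReal_real, true_and, hI]
  by_cases hx : x = y + s.nat 2 (tb + s.nat 1 k)
  · subst hx
    simp [add_assoc]
  · simp [hx, Ne.symm hx]

/-- Sketch a column of `X` or the first unit vector at the leaf with number in register `11`. The
column has its number in register `10`. -/
def leafStep : Prog :=
  .seq clearLeaf (.seq
    (.branch (.natLE (.add (.reg 11) (.const 1)) (.reg 1))
      (.seq (.seq (.setReg 15 (.get 0 (.reg 10))) (.setReg 16 (.get 0 (.add (.reg 10) (.const 1)))))
        hashEntries)
      (.setReal 5 (.add (.reg 12) (.get 2 (.reg 13))) (.get 1 (.reg 13))))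
    (.seq (.setReg 12 (.add (.reg 12) (.reg 3))) (.setReg 13 (.add (.reg 13) (.reg 2)))))

/-- A hashed sparse column. -/
theorem Loaded.sum_eq_hashSum {n p d m : ℕ} {seed : Seed (depth p) d m}
    {X : Matrix (Fin d) (Fin n) ℝ} {s : Store} (h : Loaded seed X s) (c : Fin n)
    (j : Fin (2 ^ depth p)) (y r : ℕ) :
    ∑ k ∈ Finset.Ico (s.nat 0 c) (s.nat 0 ((c : ℕ) + 1)),
      (if y + s.nat 2 ((j : ℕ) * d + s.nat 1 k) = y + r then
        s.real 1 ((j : ℕ) * d + s.nat 1 k) * s.real 0 k else 0) =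
    hashSum (seed.1 j).1 (seed.1 j).2 (fun a => X a c) r := by
  have hrow := h.rows c
  rw [hashSum, ← Finset.sum_coe_sort Finset.univ]
  -- Row indices are plain natural numbers in memory, so the sum over rows is moved to a range.
  have hG : ∑ i : Fin d, (if ((seed.1 j).1 i : ℕ) = r then sgn ((seed.1 j).2 i) * X i c else 0) =
      ∑ a ∈ Finset.range d, if ha : a < d then
        (if ((seed.1 j).1 ⟨a, ha⟩ : ℕ) = r then sgn ((seed.1 j).2 ⟨a, ha⟩) * X ⟨a, ha⟩ c else 0)
        else 0 := by
    rw [Finset.sum_range]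
    simp
  rw [Finset.sum_coe_sort Finset.univ fun i : Fin d =>
    (if ((seed.1 j).1 i : ℕ) = r then sgn ((seed.1 j).2 i) * X i c else 0), hG]
  -- The stored positions of the column correspond bijectively to its nonzero rows; all other rows
  -- contribute zero.
  refine Finset.sum_of_injOn (s.nat 1) ?_ ?_ ?_ ?_
  · rw [Finset.coe_Ico]
    exact hrow.injOn
  · intro k hk
    rw [Finset.coe_Ico] at hk
    obtain ⟨i, hi, -⟩ := hrow.mapsTo hk
    simp [← hi]
  · intro a ha hna
    rw [Finset.mem_range] at ha
    rw [dif_pos ha]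
    have : X ⟨a, ha⟩ c = 0 := by
      by_contra hne
      apply hna
      rw [Finset.coe_Ico]
      exact hrow.surjOn ⟨⟨a, ha⟩, rfl, hne⟩
    simp [this]
  · intro k hk
    rw [← Finset.mem_coe, Finset.coe_Ico] at hk
    obtain ⟨i, hi, -⟩ := hrow.mapsTo hk
    rw [h.vals c k hk i hi.symm, ← hi, dif_pos i.2, h.leafHash, h.leafSign]
    simp

theorem hashSum_single {m d : ℕ} [NeZero d] (h : Fin d → Fin m) (σ : Fin d → Bool) (r : ℕ) :
    hashSum h σ (Pi.single 0 1) r = if (h 0 : ℕ) = r then sgn (σ 0) else 0 := by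
  rw [hashSum, Finset.sum_eq_single 0]
  · simp
  · intro i _ hi
    simp [hi]
  · simp

/-- Registers `12` and `13` advance by m and d from leaf to leaf, which replaces multiplications.
The clause on x < y preserves the leaves already done. Only stored entries of the column are
visited, so the time is O(m + nnz of the column). -/
theorem runs_leafStep {n p d m κ y : ℕ} [NeZero d] {seed : Seed (depth p) d m}
    {X : Matrix (Fin d) (Fin n) ℝ} {s : Store} (h : Prepared seed X κ s) (hm : 0 < m)
    (c : Fin n) (h10 : s.reg 10 = c) (j : Fin (2 ^ depth p)) (h11 : s.reg 11 = j)
    (h12 : s.reg 12 = y) (h13 : s.reg 13 = j * d) :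
    Runs leafStep s (70 * (m + (s.nat 0 ((c : ℕ) + 1) - s.nat 0 c))) fun s' =>
      s'.reg 12 = y + m ∧ s'.reg 13 = (j + 1) * d ∧
      (∀ r : Fin m, s'.real 5 (y + r) =
        (countSketch (seed.1 j) *ᵥ (if (j : ℕ) < p then fun a => X a c else Pi.single 0 1)) r) ∧
      ∀ x < y, s'.real 5 x = s.real 5 x := by
  set cnt := s.nat 0 ((c : ℕ) + 1) - s.nat 0 c with hcnt
  refine ((runs_clearLeaf h.ready.size h12).seq (T' := (5 + (8 + (40 * cnt + 5))) + 8)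
    fun s₁ f₁ h₁ => ?_).mono (by omega) fun _ _ h => h
  have g₁ := h.of_frame f₁ (by decide)
  have r10 : s₁.reg 10 = c := by rw [f₁.reg 10 (by decide), h10]
  have r11 : s₁.reg 11 = j := by rw [f₁.reg 11 (by decide), h11]
  have r12 : s₁.reg 12 = y := by rw [f₁.reg 12 (by decide), h12]
  have r13 : s₁.reg 13 = j * d := by rw [f₁.reg 13 (by decide), h13]
  have n0 : s₁.nat 0 = s.nat 0 := f₁.nat 0 (by decide)
  have hmid : Runs (.branch (.natLE (.add (.reg 11) (.const 1)) (.reg 1))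
      (.seq (.seq (.setReg 15 (.get 0 (.reg 10))) (.setReg 16 (.get 0 (.add (.reg 10) (.const 1)))))
        hashEntries)
      (.setReal 5 (.add (.reg 12) (.get 2 (.reg 13))) (.get 1 (.reg 13)))) s₁
      (5 + (8 + (40 * cnt + 5))) fun s₂ =>
      (∀ r : Fin m, s₂.real 5 (y + r) =
        (countSketch (seed.1 j) *ᵥ (if (j : ℕ) < p then fun a => X a c else Pi.single 0 1)) r) ∧
      ∀ x < y, s₂.real 5 x = s.real 5 x := by
    refine Runs.branch (fun hb => ?_) fun hb => ?_
    · simp only [Test.holds, NExpr.eval, r11, g₁.loaded.reg_p] at hb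
      have hptr : Runs (.seq (.setReg 15 (.get 0 (.reg 10)))
          (.setReg 16 (.get 0 (.add (.reg 10) (.const 1))))) s₁ 8 fun s₂ =>
          s₂.reg 15 = s.nat 0 c ∧ s₂.reg 16 = s.nat 0 ((c : ℕ) + 1) ∧ s₂.real = s₁.real := by
        refine Runs.of_run rfl (by decide) ?_
        simp [Prog.run, NExpr.eval, r10, n0]
      refine hptr.seq fun s₂ f₂ h₂ => ?_
      have g₂ := g₁.of_frame f₂ (by decide)
      refine (runs_hashEntries (by rw [f₂.reg 12 (by decide), r12])
        (by rw [f₂.reg 13 (by decide), r13]) h₂.1 h₂.2.1 (h.loaded.ptr_mono c)).mono le_rfl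
        fun s₃ f₃ h₃ => ⟨fun r => ?_, fun x hx => ?_⟩
      · have hr := r.2
        have hsum := g₂.loaded.sum_eq_hashSum c j y r
        rw [f₂.nat 0 (by decide), n0] at hsum
        rw [h₃, hsum, h₂.2.2, h₁, if_pos (by omega), zero_add, countSketch_mulVec, if_pos (by omega)]
      · rw [h₃, h₂.2.2, h₁, if_neg (by omega), Finset.sum_eq_zero, add_zero]
        intro k _
        rw [if_neg (by omega)]
    · simp only [Test.holds, NExpr.eval, r11, g₁.loaded.reg_p] at hb
      refine Runs.of_run rfl ?_ ?_
      · have : Prog.bound (.setReal 5 (.add (.reg 12) (.get 2 (.reg 13))) (.get 1 (.reg 13))) = 7 :=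
          rfl
        omega
      · have hh := g₁.loaded.leafHash j 0
        have hs := g₁.loaded.leafSign j 0
        simp only [Fin.val_zero, add_zero] at hh hs
        simp only [Prog.run, NExpr.eval, RExpr.eval, r12, r13, hh, hs, writeReal_real, true_and]
        refine ⟨fun r => ?_, fun x hx => ?_⟩
        · have hr := r.2
          rw [h₁, if_pos (show y ≤ y + (r : ℕ) ∧ y + (r : ℕ) < y + m by omega), countSketch_mulVec,
            if_neg (show ¬ (j : ℕ) < p by omega), hashSum_single]
          by_cases he : ((seed.1 j).1 0 : ℕ) = r
          · rw [if_pos (by omega), if_pos he]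
          · rw [if_neg (by omega), if_neg he]
        · rw [if_neg (show ¬ x = y + ((seed.1 j).1 0 : ℕ) by omega), h₁,
            if_neg (show ¬ (y ≤ x ∧ x < y + m) by omega)]
  refine (hmid.seq (T' := 8) fun s₂ f₂ h₂ => Runs.of_run rfl (by decide) ?_).mono (by omega)
    fun _ _ h => h
  have g₂ := g₁.of_frame f₂ (by decide)
  have e12 : s₂.reg 12 = y := by rw [f₂.reg 12 (by decide), r12]
  have e13 : s₂.reg 13 = j * d := by rw [f₂.reg 13 (by decide), r13]
  refine ⟨?_, ?_, h₂⟩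
  · simp [Prog.run, NExpr.eval, e12, g₂.ready.size]
  · simp [Prog.run, NExpr.eval, e13, g₂.loaded.reg_d, add_mul]

/-- Sketch a column of `X` at all leaves. -/
def leafPhase : Prog :=
  .seq (.seq (.setReg 12 (.reg 5)) (.setReg 13 (.const 0))) (forZero 11 4 leafStep)

theorem block_le {a b m r : ℕ} (hab : a < b) (hr : r < m) : a * m + r < b * m := by
  have := Nat.mul_le_mul_right m hab
  rw [Nat.succ_mul] at this
  omega

theorem runs_leafPhase {n p d m κ : ℕ} [NeZero d] {seed : Seed (depth p) d m}
    {X : Matrix (Fin d) (Fin n) ℝ} {s : Store} (h : Prepared seed X κ s) (hm : 0 < m)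
    (c : Fin n) (h10 : s.reg 10 = c) :
    Runs leafPhase s (100 * (2 ^ depth p * (m + (s.nat 0 ((c : ℕ) + 1) - s.nat 0 c)))) fun s' =>
      ∀ (j : Fin (2 ^ depth p)) (r : Fin m), s'.real 5 ((2 ^ depth p + j) * m + r) =
        (countSketch (seed.1 j) *ᵥ (if (j : ℕ) < p then fun a => X a c else Pi.single 0 1)) r := by
  set cnt := s.nat 0 ((c : ℕ) + 1) - s.nat 0 c with hcnt
  set q := 2 ^ depth p with hq
  have hinit : Runs (.seq (.setReg 12 (.reg 5)) (.setReg 13 (.const 0))) s 4 fun s' =>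
      s'.reg 12 = q * m ∧ s'.reg 13 = 0 := by
    refine Runs.of_run rfl (by decide) ?_
    simp [Prog.run, NExpr.eval, h.base, hq]
  refine (hinit.seq (T' := q * (70 * (m + cnt) + 9) + 7) fun s₁ f₁ h₁ => ?_).mono ?_
    fun _ _ h => h
  · have g₁ := h.of_frame f₁ (by decide)
    refine (Runs.forZero (70 * (m + cnt)) (fun k s' => s'.reg 12 = (q + k) * m ∧
      s'.reg 13 = k * d ∧ ∀ j : Fin q, (j : ℕ) < k → ∀ r : Fin m,
        s'.real 5 ((q + j) * m + r) = (countSketch (seed.1 j) *ᵥ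
          (if (j : ℕ) < p then fun a => X a c else Pi.single 0 1)) r) (by decide) (by decide)
      (by decide) g₁.leaves (by simp [h₁]) ?_).mono le_rfl fun s' _ h' j r => h'.2.2 j j.2 r
    intro k hk s' hf hk' hI
    have g := g₁.of_frame hf (by decide)
    have n0 : s'.nat 0 = s.nat 0 := by rw [hf.nat 0 (by decide), f₁.nat 0 (by decide)]
    have r10 : s'.reg 10 = c := by rw [hf.reg 10 (by decide), f₁.reg 10 (by decide), h10]
    have := runs_leafStep g hm c r10 ⟨k, hk⟩ hk' hI.1 hI.2.1
    rw [n0] at this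
    refine this.mono le_rfl fun s'' _ h'' => ⟨?_, ?_, fun j hj r => ?_⟩
    · simp only [writeReg_reg]
      rw [if_neg (by decide), h''.1]
      ring
    · simpa using h''.2.1
    · rw [writeReg_real]
      rcases Nat.lt_succ_iff_lt_or_eq.1 hj with hlt | heq
      · rw [h''.2.2.2 _ (block_le (by omega) r.2)]
        exact hI.2.2 j hlt r
      · obtain rfl : j = ⟨k, hk⟩ := Fin.ext heq
        exact h''.2.2.1 r
  · rw [← hq]
    have hq1 : 1 ≤ q := Nat.one_le_two_pow
    have h1 : q * 1 ≤ q * (m + cnt) := Nat.mul_le_mul_left q (by omega)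
    have e : q * (70 * (m + cnt) + 9) = 70 * (q * (m + cnt)) + 9 * q := by ring
    omega

/-! #### The internal nodes -/

/-- Compute the vectors at all internal nodes, from the last to the root. -/
def nodePhase : Prog :=
  .seq (.seq (.setReg 18 (.reg 5)) (.setReg 17 (.const 1))) (forUp 17 4 nodeStep)

theorem Loaded.nodeTables {n p d m : ℕ} {seed : Seed (depth p) d m} {X : Matrix (Fin d) (Fin n) ℝ}
    {s : Store} (h : Loaded seed X s) (v : Node (depth p)) :
    NodeTables (seed.2 v) ((2 ^ (v.1 : ℕ) + (v.2 : ℕ)) * m) s :=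
  ⟨h.nodeHash₁ v, h.nodeHash₂ v, h.nodeSign₁ v, h.nodeSign₂ v⟩

/-- Nodes are treated in decreasing heap order: the children 2t and 2t + 1 of node t are finished
before it and are never overwritten afterwards, so the final memory satisfies the recursion of
`combine_eq_root`. -/
theorem runs_nodePhase {n p d m κ : ℕ} {seed : Seed (depth p) d m}
    {X : Matrix (Fin d) (Fin n) ℝ} {s : Store} (h : Prepared seed X κ s) (hm : m ≤ 2 ^ κ) :
    Runs nodePhase s (570 * (2 ^ depth p * (2 ^ (κ + 1) * (κ + 1)))) fun s' => ∀ r : Fin m,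
      s'.real 5 (m + r) = combine (depth p) (fun k j => tensorSketch (seed.2 ⟨k, j⟩))
        (fun j r => s.real 5 ((2 ^ depth p + j) * m + r)) r := by
  set q := 2 ^ depth p with hq
  have hq1 : 1 ≤ q := Nat.one_le_two_pow
  have hinit : Runs (.seq (.setReg 18 (.reg 5)) (.setReg 17 (.const 1))) s 4 fun s' =>
      s'.reg 18 = q * m ∧ s'.reg 17 = 1 ∧ s'.real = s.real := by
    refine Runs.of_run rfl (by decide) ?_
    simp [Prog.run, NExpr.eval, h.base, hq]
  refine (hinit.seq (T' := (q - 1) * (550 * 2 ^ (κ + 1) * (κ + 1) + 9) + 5)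
    fun s₁ f₁ h₁ => ?_).mono ?_ fun _ _ h => h
  · have g₁ := h.of_frame f₁ (by decide)
    -- The counter e ascends while q + 1 - e, the last node finished, descends. It starts at q, the
    -- first leaf, so no internal node is claimed initially.
    refine (Runs.forUp_const (550 * 2 ^ (κ + 1) * (κ + 1)) (fun e s' =>
      s'.reg 18 = (q + 1 - e) * m ∧
      (∀ x, q * m ≤ x → s'.real 5 x = s.real 5 x) ∧
      ∀ (k : Fin (depth p)) (j : Fin (2 ^ (k : ℕ))), q + 1 - e ≤ 2 ^ (k : ℕ) + j → ∀ r : Fin m,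
        s'.real 5 ((2 ^ (k : ℕ) + j) * m + r) = (tensorSketch (seed.2 ⟨k, j⟩) *ᵥ fun ab =>
          s'.real 5 (2 * (2 ^ (k : ℕ) + j) * m + ab.1) *
          s'.real 5 ((2 * (2 ^ (k : ℕ) + j) + 1) * m + ab.2)) r)
      (by decide) (by decide) (by decide) h₁.2.1 g₁.leaves hq1 ?_ ?_).mono le_rfl ?_
    · refine ⟨by simpa using h₁.1, fun x _ => by rw [h₁.2.2], fun k j hkj => ?_⟩
      exfalso
      have hj := j.2
      have h2 : 2 ^ ((k : ℕ) + 1) ≤ q := Nat.pow_le_pow_right two_pos k.2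
      rw [pow_succ] at h2
      omega
    · intro e he1 heq s' hf _ hI
      have g := g₁.of_frame hf (by decide)
      obtain ⟨t, ht⟩ : ∃ t, q + 1 - e = t + 1 := ⟨q - e, by omega⟩
      have ht' : q + 1 - (e + 1) = t := by omega
      rw [ht] at hI
      rw [ht']
      refine (runs_nodeStep (o := t * m) g.ready hm (by rw [hI.1]; ring)).mono le_rfl
        fun s'' _ h'' => ⟨by simpa using h''.1, fun x hx => ?_, fun k j hkj r => ?_⟩
      · rw [writeReg_real, h''.2.2 x, hI.2.1 x hx]
        right
        have : (t + 1) * m ≤ q * m := Nat.mul_le_mul_right m (by omega)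
        rw [Nat.succ_mul] at this
        omega
      · simp only [writeReg_real]
        -- Writing the vector of node t leaves all nodes with larger numbers unchanged, in
        -- particular its children.
        have hunch : ∀ t' r', t < t' → s''.real 5 (t' * m + r') = s'.real 5 (t' * m + r') := by
          intro t' r' htt
          refine h''.2.2 _ (Or.inr ?_)
          have : (t + 1) * m ≤ t' * m := Nat.mul_le_mul_right m htt
          rw [Nat.succ_mul] at this
          omega
        have hpos : 0 < 2 ^ (k : ℕ) := by positivity
        simp only [hunch (2 * (2 ^ (k : ℕ) + (j : ℕ))) _ (by omega),
          hunch (2 * (2 ^ (k : ℕ) + (j : ℕ)) + 1) _ (by omega)]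
        rcases hkj.eq_or_lt with heq | hlt
        · have := h''.2.1 (seed.2 ⟨k, j⟩) (by rw [heq]; exact g.loaded.nodeTables ⟨k, j⟩) r
          rw [← heq, this]
          have e1 : 2 * t * m = t * m + t * m := by ring
          have e2 : (2 * t + 1) * m = t * m + t * m + m := by ring
          rw [e1, e2]
        · rw [hunch _ _ hlt]
          exact hI.2.2 k j hlt r
    · intro s' _ hI r
      have := combine_eq_root (depth p) (fun k j => tensorSketch (seed.2 ⟨k, j⟩))
        (fun t r => s'.real 5 (t * m + r)) (fun k j => by
          funext r
          refine hI.2.2 k j ?_ r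
          have : 0 < 2 ^ (k : ℕ) := by positivity
          omega)
      have hl : (fun (j : Fin (2 ^ depth p)) (r : Fin m) =>
          s'.real 5 ((2 ^ depth p + (j : ℕ)) * m + r)) =
          fun (j : Fin (2 ^ depth p)) (r : Fin m) =>
          s.real 5 ((2 ^ depth p + (j : ℕ)) * m + r) := by
        funext j r
        refine hI.2.1 _ ?_
        have : q * m ≤ (q + j) * m := Nat.mul_le_mul_right m (by omega)
        exact this.trans (Nat.le_add_right _ _)
      rw [hl] at this
      rw [this, one_mul]
  · rw [← hq]
    have h1 : 1 ≤ 2 ^ (κ + 1) * (κ + 1) :=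
      Nat.one_le_two_pow.trans (Nat.le_mul_of_pos_right _ (by omega))
    set E := 2 ^ (κ + 1) * (κ + 1) with hE
    have e : 550 * 2 ^ (κ + 1) * (κ + 1) = 550 * E := by rw [hE]; ring
    rw [e]
    have e1 : (q - 1) * (550 * E + 9) ≤ q * (559 * E) := Nat.mul_le_mul (by omega) (by omega)
    have e2 : q * (559 * E) = 559 * (q * E) := by ring
    have e3 : 1 ≤ q * E := Nat.mul_pos hq1 h1
    omega

/-! #### One column -/

/-- Write the vector at the root to the output. -/
def outputColumn : Prog :=
  .seq (forZero 20 3 (.setReal 4 (.add (.reg 30) (.reg 20)) (.get 5 (.add (.reg 3) (.reg 20)))))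
    (.setReg 30 (.add (.reg 30) (.reg 3)))

theorem runs_outputColumn {m o : ℕ} {s : Store} (h3 : s.reg 3 = m) (h30 : s.reg 30 = o) :
    Runs outputColumn s (20 * m + 11) fun s' => s'.reg 30 = o + m ∧
      (∀ r < m, s'.real 4 (o + r) = s.real 5 (m + r)) ∧ ∀ x < o, s'.real 4 x = s.real 4 x := by
  refine ((Runs.forZero 8 (fun k s' => (∀ r < k, s'.real 4 (o + r) = s.real 5 (m + r)) ∧
    ∀ x < o, s'.real 4 x = s.real 4 x) (by decide) (by decide) (by decide) h3 (by simp) ?_).seq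
    (T' := 4) fun s' hf h' => Runs.of_run rfl (by decide) ?_).mono (by omega) fun _ _ h => h
  · intro k _ s' hf hk hI
    refine Runs.of_run rfl (by decide) ?_
    have r30 : s'.reg 30 = o := by rw [hf.reg 30 (by decide), h30]
    have r3 : s'.reg 3 = m := by rw [hf.reg 3 (by decide), h3]
    have a5 := hf.real 5 (by decide)
    simp only [Prog.run, NExpr.eval, RExpr.eval, hk, r30, r3, a5, writeReg_real, writeReal_real,
      true_and]
    refine ⟨fun r hr => ?_, fun x hx => ?_⟩
    · rcases Nat.lt_succ_iff_lt_or_eq.1 hr with h | rfl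
      · rw [if_neg (by omega)]
        exact hI.1 r h
      · simp
    · rw [if_neg (by omega)]
      exact hI.2 x hx
  · refine ⟨?_, h'⟩
    have r30 : s'.reg 30 = o := by rw [hf.reg 30 (by decide), h30]
    have r3 : s'.reg 3 = m := by rw [hf.reg 3 (by decide), h3]
    simp [Prog.run, NExpr.eval, r30, r3]

/-- Compute a column of the output. -/
def columnStep : Prog := .seq leafPhase (.seq nodePhase outputColumn)

theorem runs_columnStep {n p d m κ : ℕ} [NeZero d] {seed : Seed (depth p) d m}
    {X : Matrix (Fin d) (Fin n) ℝ} {s : Store} (h : Prepared seed X κ s) (hm : 0 < m)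
    (hmκ : m ≤ 2 ^ κ) (c : Fin n) (h10 : s.reg 10 = c) (h30 : s.reg 30 = c * m) :
    Runs columnStep s (800 * (2 ^ depth p * (2 ^ (κ + 1) * (κ + 1))) +
        100 * (2 ^ depth p * (s.nat 0 ((c : ℕ) + 1) - s.nat 0 c))) fun s' =>
      s'.reg 30 = (c + 1) * m ∧
      (∀ r : Fin m, s'.real 4 (c * m + r) = algorithm seed (fun a => X a c) r) ∧
      ∀ x < c * m, s'.real 4 x = s.real 4 x := by
  set cnt := s.nat 0 ((c : ℕ) + 1) - s.nat 0 c with hcnt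
  refine ((runs_leafPhase h hm c h10).seq fun s₁ f₁ h₁ => ?_).mono
    (T := 100 * (2 ^ depth p * (m + cnt)) + (570 * (2 ^ depth p * (2 ^ (κ + 1) * (κ + 1))) +
      (20 * m + 11))) ?_ fun _ _ h => h
  · have g₁ := h.of_frame f₁ (by decide)
    refine (runs_nodePhase g₁ hmκ).seq fun s₂ f₂ h₂ => ?_
    have g₂ := g₁.of_frame f₂ (by decide)
    refine (runs_outputColumn (o := c * m) g₂.ready.size
      (by rw [f₂.reg 30 (by decide), f₁.reg 30 (by decide), h30])).mono le_rfl
      fun s₃ _ h₃ => ⟨?_, fun r => ?_, fun x hx => ?_⟩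
    · rw [h₃.1]
      ring
    · rw [h₃.2.1 r r.2, h₂, algorithm]
      congr 2
      funext j r
      exact h₁ j r
    · rw [h₃.2.2 x hx, f₂.real 4 (by decide), f₁.real 4 (by decide)]
  · set q := 2 ^ depth p with hq
    set E := 2 ^ (κ + 1) * (κ + 1) with hE
    have hq1 : 1 ≤ q := Nat.one_le_two_pow
    have hmE : m ≤ E := by
      have h1 : 2 ^ κ ≤ 2 ^ (κ + 1) := Nat.pow_le_pow_right two_pos (by omega)
      exact hmκ.trans (h1.trans (Nat.le_mul_of_pos_right _ (by omega)))
    have e1 : q * m ≤ q * E := Nat.mul_le_mul_left q hmE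
    have e2 : m ≤ q * m := Nat.le_mul_of_pos_left m hq1
    have e3 : q * (m + cnt) = q * m + q * cnt := by ring
    omega

/-! #### The whole program -/

/-- Compute the number of leaves in register `4` and the address of the first leaf vector in
register `5`. -/
def setupLeaves : Prog :=
  .seq (.seq (.setReg 4 (.const 1)) (.setReg 5 (.reg 3)))
    (.loop (.natLE (.add (.reg 4) (.const 1)) (.reg 1))
      (.seq (.setReg 4 (.add (.reg 4) (.reg 4))) (.setReg 5 (.add (.reg 5) (.reg 5)))))

theorem clog_two_le (p : ℕ) : Nat.clog 2 p ≤ p :=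
  Nat.clog_le_of_le_pow Nat.lt_two_pow_self.le

/-- Doubling register `5` along with register `4` produces q m without multiplication. The loop
stops at the first power of two that is at least p, and the crude bound ⌈log₂ p⌉ ≤ p on the number
of rounds suffices. -/
theorem runs_setupLeaves {p m : ℕ} {s : Store} (h1 : s.reg 1 = p) (h3 : s.reg 3 = m) :
    Runs setupLeaves s (20 * p + 10) fun s' =>
      s'.reg 4 = 2 ^ depth p ∧ s'.reg 5 = 2 ^ depth p * m := by
  have hinit : Runs (.seq (.setReg 4 (.const 1)) (.setReg 5 (.reg 3))) s 4 fun s' =>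
      s'.reg 4 = 1 ∧ s'.reg 5 = m := by
    refine Runs.of_run rfl (by decide) ?_
    simp [Prog.run, NExpr.eval, h3]
  refine (hinit.seq fun s₁ f₁ h₁ => Runs.loop (depth p) (fun _ => 8)
    (fun k s' => s'.reg 4 = 2 ^ k ∧ s'.reg 5 = 2 ^ k * m) (by simpa using h₁) ?_ ?_).mono ?_
    fun _ _ h => h
  · intro s' hf hI
    have r1 : s'.reg 1 = p := by rw [hf.reg 1 (by decide), f₁.reg 1 (by decide), h1]
    simp only [Test.holds, NExpr.eval, hI.1, r1]
    have : p ≤ 2 ^ depth p := Nat.le_pow_clog one_lt_two p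
    omega
  · intro k hk s' hf hI
    have r1 : s'.reg 1 = p := by rw [hf.reg 1 (by decide), f₁.reg 1 (by decide), h1]
    refine ⟨?_, Runs.of_run rfl (by decide) ?_⟩
    · simp only [Test.holds, NExpr.eval, hI.1, r1]
      exact Nat.pow_lt_of_lt_clog hk
    · simp only [Prog.run, NExpr.eval, hI.1, hI.2, writeReg_reg]
      constructor <;> simp <;> ring
  · have : depth p ≤ p := clog_two_le p
    simp only [Finset.sum_const, Finset.card_range, smul_eq_mul, Test.cost, NExpr.cost]
    omega

/-- Compute the length of the transform and the number of its levels. -/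
def setupLength : Prog :=
  .seq (.seq (.setReg 6 (.const 1)) (.setReg 8 (.const 1)))
    (.seq (.loop (.natLE (.add (.reg 6) (.const 1)) (.reg 3))
      (.seq (.setReg 6 (.add (.reg 6) (.reg 6))) (.setReg 8 (.add (.reg 8) (.const 1)))))
      (.setReg 7 (.add (.reg 6) (.reg 6))))

theorem runs_setupLength {m : ℕ} {s : Store} (h3 : s.reg 3 = m) :
    Runs setupLength s (20 * m + 15) fun s' => s'.reg 6 = 2 ^ Nat.clog 2 m ∧
      s'.reg 7 = 2 ^ (Nat.clog 2 m + 1) ∧ s'.reg 8 = Nat.clog 2 m + 1 := by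
  have hinit : Runs (.seq (.setReg 6 (.const 1)) (.setReg 8 (.const 1))) s 4 fun s' =>
      s'.reg 6 = 1 ∧ s'.reg 8 = 1 := by
    refine Runs.of_run rfl (by decide) ?_
    simp [Prog.run, NExpr.eval]
  refine (hinit.seq fun s₁ f₁ h₁ => (Runs.loop (Nat.clog 2 m) (fun _ => 8)
    (fun k s' => s'.reg 6 = 2 ^ k ∧ s'.reg 8 = k + 1) (by simpa using h₁) ?_ ?_).seq (T' := 4)
      fun s₂ f₂ h₂ => Runs.of_run rfl (by decide) ?_).mono ?_ fun _ _ h => h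
  · intro s' hf hI
    have r3 : s'.reg 3 = m := by rw [hf.reg 3 (by decide), f₁.reg 3 (by decide), h3]
    simp only [Test.holds, NExpr.eval, hI.1, r3]
    have : m ≤ 2 ^ Nat.clog 2 m := Nat.le_pow_clog one_lt_two m
    omega
  · intro k hk s' hf hI
    have r3 : s'.reg 3 = m := by rw [hf.reg 3 (by decide), f₁.reg 3 (by decide), h3]
    refine ⟨?_, Runs.of_run rfl (by decide) ?_⟩
    · simp only [Test.holds, NExpr.eval, hI.1, r3]
      exact Nat.pow_lt_of_lt_clog hk
    · simp only [Prog.run, NExpr.eval, hI.1, hI.2, writeReg_reg]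
      constructor
      · simp
        ring
      · simp
  · simp only [Prog.run, NExpr.eval, h₂.1, h₂.2, writeReg_reg]
    refine ⟨by simp, ?_, by simp⟩
    simp
    ring
  · have := clog_two_le m
    simp only [Finset.sum_const, Finset.card_range, smul_eq_mul, Test.cost, NExpr.cost]
    omega

/-- Compute the children of the twiddle factor with number in register `20`. -/
def twiddleStep : Prog :=
  .seq (.setReal 10 (.add (.reg 20) (.reg 20))
    (.sqrt (.div (.add (.const 1) (.get 10 (.reg 20))) (.const 2))))
  (.seq (.setReal 11 (.add (.reg 20) (.reg 20))
    (.sqrt (.div (.sub (.const 1) (.get 10 (.reg 20))) (.const 2))))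
  (.seq (.setReal 10 (.add (.add (.reg 20) (.reg 20)) (.const 1))
    (.sub (.const 0) (.get 11 (.add (.reg 20) (.reg 20)))))
  (.setReal 11 (.add (.add (.reg 20) (.reg 20)) (.const 1)) (.get 10 (.add (.reg 20) (.reg 20))))))

/-- Compute the twiddle factors. -/
def setupTwiddles : Prog :=
  .seq (.seq (.setReg 20 (.const 1))
    (.seq (.setReal 10 (.const 1) (.const 1)) (.setReal 11 (.const 1) (.const 0))))
    (forUp 20 6 twiddleStep)

theorem runs_setupTwiddles {κ : ℕ} {s : Store} (h6 : s.reg 6 = 2 ^ κ) :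
    Runs setupTwiddles s (60 * 2 ^ κ) fun s' =>
      ∀ t, 1 ≤ t → t < 2 ^ (κ + 1) → cvec 10 11 s' t = twiddle t := by
  have hκ : 1 ≤ 2 ^ κ := Nat.one_le_two_pow
  have hinit : Runs (.seq (.setReg 20 (.const 1))
      (.seq (.setReal 10 (.const 1) (.const 1)) (.setReal 11 (.const 1) (.const 0)))) s 8 fun s' =>
      s'.reg 20 = 1 ∧ cvec 10 11 s' 1 = twiddle 1 := by
    refine Runs.of_run rfl (by decide) ?_
    rw [twiddle_one]
    simp [Prog.run, NExpr.eval, RExpr.eval, cvec, Complex.ext_iff]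
  -- Before iteration k all factors below 2k are known, in particular number k itself, from which 2k
  -- and 2k + 1 are computed.
  refine (hinit.seq fun s₁ f₁ h₁ => Runs.forUp_const 46
    (fun k s' => ∀ t, 1 ≤ t → t < 2 * k → cvec 10 11 s' t = twiddle t) (by decide) (by decide)
    (by decide) h₁.1 (by rw [f₁.reg 6 (by decide), h6]) hκ ?_ ?_).mono (by omega)
    fun s' _ h => by rwa [pow_succ']
  · intro t ht1 ht2
    obtain rfl : t = 1 := by omega
    exact h₁.2
  · intro k hk _ s' hf hk' hI
    refine Runs.of_run rfl (by decide) ?_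
    intro t ht1 ht2
    have hIk := hI k hk (by omega)
    have hre : s'.real 10 k = (twiddle k).re := by rw [← hIk]; rfl
    have hne : k ≠ 0 := by omega
    simp only [twiddleStep, cvec, Prog.run, NExpr.eval, RExpr.eval, hk', writeReg_real,
      writeReal_real, writeReal_reg]
    rcases lt_or_ge t (2 * k) with h | h
    · have := hI t ht1 h
      rw [cvec] at this
      simp [show t ≠ k + k by omega, show t ≠ k + k + 1 by omega, this]
    · obtain rfl | rfl : t = 2 * k ∨ t = 2 * k + 1 := by omega
      · rw [twiddle_even hk, halfAngle]
        simp [two_mul, hre, hne]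
      · rw [twiddle_odd hk, halfAngle]
        simp [two_mul, hre, hne, Complex.ext_iff]

/-- Compute the sizes and the twiddle factors. -/
def setup : Prog := .seq setupLeaves (.seq setupLength setupTwiddles)

theorem runs_setup {n p d m : ℕ} {seed : Seed (depth p) d m} {X : Matrix (Fin d) (Fin n) ℝ}
    {s : Store} (h : Loaded seed X s) :
    Runs setup s (20 * p + 20 * m + 60 * 2 ^ Nat.clog 2 m + 25) (Prepared seed X (Nat.clog 2 m)) := by
  refine ((runs_setupLeaves h.reg_p h.reg_m).seq fun s₁ f₁ h₁ => (runs_setupLength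
    (by rw [f₁.reg 3 (by decide), h.reg_m])).seq fun s₂ f₂ h₂ =>
    (runs_setupTwiddles h₂.1).mono le_rfl fun s₃ f₃ h₃ => ?_).mono (by omega) fun _ _ h => h
  have g := ((h.of_frame f₁ (by decide) (by decide) (by decide)).of_frame f₂ (by decide) (by decide)
    (by decide)).of_frame f₃ (by decide) (by decide) (by decide)
  refine ⟨g, ⟨g.reg_m, ?_, ?_, ?_, h₃⟩, ?_, ?_⟩
  · rw [f₃.reg 6 (by decide), h₂.1]
  · rw [f₃.reg 7 (by decide), h₂.2.1]
  · rw [f₃.reg 8 (by decide), h₂.2.2]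
  · rw [f₃.reg 4 (by decide), f₂.reg 4 (by decide), h₁.1]
  · rw [f₃.reg 5 (by decide), f₂.reg 5 (by decide), h₁.2]

/-- Compute the sketch of the self-tensored columns of `X`. -/
def sketchProg : Prog :=
  .seq setup (.seq (.seq (.setReg 30 (.const 0)) (.setReg 10 (.const 0))) (forUp 10 0 columnStep))

theorem runs_sketchProg {n p d m : ℕ} [NeZero d] {seed : Seed (depth p) d m}
    {X : Matrix (Fin d) (Fin n) ℝ} {s : Store} (h : Loaded seed X s) (hm : 0 < m) :
    Runs sketchProg s (20 * p + 20 * m + 60 * 2 ^ Nat.clog 2 m + 34 +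
        ∑ c ∈ Finset.range n,
          (800 * (2 ^ depth p * (2 ^ (Nat.clog 2 m + 1) * (Nat.clog 2 m + 1))) +
            100 * (2 ^ depth p * (s.nat 0 (c + 1) - s.nat 0 c)) + 9))
      fun s' => ∀ (c : Fin n) (r : Fin m),
        s'.real 4 (c * m + r) = algorithm seed (fun a => X a c) r := by
  have hinit : ∀ s, Runs (.seq (.setReg 30 (.const 0)) (.setReg 10 (.const 0))) s 4 fun s' =>
      s'.reg 30 = 0 ∧ s'.reg 10 = 0 := by
    intro s
    refine Runs.of_run rfl (by decide) ?_
    simp [Prog.run, NExpr.eval]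
  refine ((runs_setup h).seq fun s₁ f₁ h₁ => (hinit s₁).seq fun s₂ f₂ h₂ =>
    Runs.forUp (fun c => 800 * (2 ^ depth p * (2 ^ (Nat.clog 2 m + 1) * (Nat.clog 2 m + 1))) +
      100 * (2 ^ depth p * (s.nat 0 (c + 1) - s.nat 0 c)))
    (fun k s' => s'.reg 30 = k * m ∧ ∀ c : Fin n, (c : ℕ) < k → ∀ r : Fin m,
      s'.real 4 (c * m + r) = algorithm seed (fun a => X a c) r)
    (by decide) (by decide) (by decide) h₂.2
    (h₁.of_frame f₂ (by decide)).loaded.reg_n (Nat.zero_le n) (by simp [h₂.1]) ?_).mono ?_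
    fun s' _ h' c r => h'.2 c c.2 r
  · intro c _ hc s' hf hk hI
    have g := (h₁.of_frame f₂ (by decide)).of_frame hf (by decide)
    have n0 : s'.nat 0 = s.nat 0 := by
      rw [hf.nat 0 (by decide), f₂.nat 0 (by decide), f₁.nat 0 (by decide)]
    have := runs_columnStep g hm (Nat.le_pow_clog one_lt_two m) ⟨c, hc⟩ hk hI.1
    rw [n0] at this
    refine this.mono le_rfl fun s'' _ h'' => ⟨by simpa using h''.1, fun c' hc' r => ?_⟩
    rw [writeReg_real]
    rcases Nat.lt_succ_iff_lt_or_eq.1 hc' with hlt | heq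
    · have hb := block_le hlt r.2
      rw [h''.2.2 _ hb]
      exact hI.2 c' hlt r
    · obtain rfl : c' = ⟨c, hc⟩ := Fin.ext heq
      exact h''.2.1 r
  · rw [Finset.range_eq_Ico]
    omega

/-- The number of stored entries. -/
theorem Loaded.sum_ptr {n p d m : ℕ} {seed : Seed (depth p) d m} {X : Matrix (Fin d) (Fin n) ℝ}
    {s : Store} (h : Loaded seed X s) :
    ∑ c ∈ Finset.range n, (s.nat 0 (c + 1) - s.nat 0 c) = nnz X := by
  classical
  -- The nonzero positions are counted column by column; within a column, the row index array is a
  -- bijection from the stored range.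
  rw [Finset.sum_range, nnz, Set.ncard_eq_toFinset_card', Set.toFinset_ofPred,
    ← Finset.card_map (Equiv.prodComm (Fin d) (Fin n)).toEmbedding,
    Finset.card_eq_sum_card_fiberwise (f := Prod.fst) (t := Finset.univ) (by simp)]
  refine Finset.sum_congr rfl fun c _ => ?_
  rw [← Nat.card_Ico, ← Set.ncard_coe_finset, ← Set.ncard_coe_finset, Finset.coe_Ico,
    (h.rows c).ncard_eq]
  symm
  refine Set.ncard_congr (fun x _ => (x.2 : ℕ)) ?_ ?_ ?_
  · rintro ⟨c', i⟩ hx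
    simp at hx
    obtain ⟨hx, rfl⟩ := hx
    exact ⟨i, rfl, hx⟩
  · rintro ⟨c₁, i₁⟩ ⟨c₂, i₂⟩ h₁ h₂ he
    simp at h₁ h₂ he
    ext <;> simp [h₁.2, h₂.2, he]
  · rintro a ⟨i, rfl, hi⟩
    exact ⟨(c, i), by simpa using hi, rfl⟩

/-- With l = ⌊log₂ m⌋ + 1, the bounds q < 2p, 2^(κ+1) ≤ 4m and κ + 1 ≤ 2l give 16 p m l for each
column, and 800 · 16 + 9 = 12809. The setup cost does not depend on n and is absorbed because there
is at least one column. -/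
theorem cost_bound {n p m N : ℕ} (hn : 0 < n) (hp : 0 < p) (hm : 0 < m) :
    20 * p + 20 * m + 60 * 2 ^ Nat.clog 2 m + 34 +
        (n * (800 * (2 ^ depth p * (2 ^ (Nat.clog 2 m + 1) * (Nat.clog 2 m + 1))) + 9) +
          100 * (2 ^ depth p * N)) ≤
      20000 * (p * (n * m * (Nat.log 2 m + 1) + N)) := by
  have hq : 2 ^ depth p < 2 * p := two_pow_clog_lt hp
  have hM := two_pow_clog_lt hm
  have hκ : Nat.clog 2 m ≤ Nat.log 2 m + 1 :=
    Nat.clog_le_of_le_pow (Nat.lt_pow_succ_log_self one_lt_two m).le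
  set q := 2 ^ depth p
  set κ := Nat.clog 2 m
  set l := Nat.log 2 m + 1 with hl
  have hE : 2 ^ (κ + 1) * (κ + 1) ≤ (4 * m) * (2 * l) := by
    refine Nat.mul_le_mul ?_ (by omega)
    rw [pow_succ]
    omega
  have hqE : q * (2 ^ (κ + 1) * (κ + 1)) ≤ 16 * (p * (m * l)) :=
    (Nat.mul_le_mul hq.le hE).trans (by nlinarith)
  have hqN : q * N ≤ 2 * (p * N) := (Nat.mul_le_mul_right N hq.le).trans (by nlinarith)
  have hB : p * (n * m * l + N) = n * (p * (m * l)) + p * N := by ring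
  have hml : m ≤ m * l := Nat.le_mul_of_pos_right _ (by omega)
  have hpml : m * l ≤ p * (m * l) := Nat.le_mul_of_pos_left _ hp
  have hppml : p ≤ p * (m * l) := Nat.le_mul_of_pos_right _ (by omega)
  have hnp : p * (m * l) ≤ n * (p * (m * l)) := Nat.le_mul_of_pos_left _ hn
  have hmain : n * (800 * (q * (2 ^ (κ + 1) * (κ + 1))) + 9) ≤ n * (12809 * (p * (m * l))) :=
    Nat.mul_le_mul_left n (by omega)
  have e : n * (12809 * (p * (m * l))) = 12809 * (n * (p * (m * l))) := by ring
  rw [hB]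
  omega

end TreeSketch

end

theorem theorem1 :
    -- `C` is an absolute constant, `K` and `prog` are one constant and one program for all inputs
    ∃ (C : ℝ) (K : ℕ) (prog : TreeSketch.Prog), 0 < C ∧
      ∀ (n p d m : ℕ) [NeZero d], 0 < n → 0 < p → 0 < m →
        -- the sketch distribution exists, and any choice of the hash families works
        Nonempty (TreeSketch.HashLaws d m) ∧
        (∀ (H : TreeSketch.HashLaws d m) (ε sLam : ℝ), 0 < ε → 0 < sLam →
          (C * (p * sLam ^ 2 / ε ^ 2) ≤ m →
            TreeSketch.IsOSE (H.seedLaw (TreeSketch.depth p))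
              (TreeSketch.sketch (p := p) (d := d) (m := m)) ε (1 / 10) sLam n) ∧
          (C * (p / ε ^ 2) ≤ m →
            TreeSketch.HasApproxMatrixProduct (H.seedLaw (TreeSketch.depth p))
              (TreeSketch.sketch (p := p) (d := d) (m := m)) ε (1 / 10))) ∧
        -- for every outcome of the random functions, the sketch of the self-tensored data
        -- is what the algorithm computes column by column, and is computed fast
        (∀ (seed : TreeSketch.Seed (TreeSketch.depth p) d m) (X : Matrix (Fin d) (Fin n) ℝ),
          (∀ (j : Fin n) (r : Fin m),
            (TreeSketch.sketch seed * TreeSketch.selfTensorMatrix p X) r j =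
              TreeSketch.algorithm seed (fun a => X a j) r) ∧
          ∀ s : TreeSketch.Store, TreeSketch.Loaded seed X s →
            ∃ (t : ℕ) (s' : TreeSketch.Store), TreeSketch.Exec prog s t s' ∧
              TreeSketch.HasOutput (TreeSketch.sketch seed * TreeSketch.selfTensorMatrix p X) s' ∧
              t ≤ K * (p * (n * m * (Nat.log 2 m + 1) + TreeSketch.nnz X))) := by
  refine ⟨5000, 20000, TreeSketch.sketchProg, by norm_num, fun n p d m _ hn hp hm =>
    ⟨TreeSketch.nonempty_hashLaws hm, fun H ε sLam hε hs =>
      ⟨fun h => TreeSketch.sketch_isOSE hp hm H hε hs h n,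
        fun h => TreeSketch.sketch_hasApproxMatrixProduct hp hm H hε h⟩,
      fun seed X => ⟨fun j r => TreeSketch.sketch_mul_selfTensorMatrix seed X j r,
        fun s hs => ?_⟩⟩⟩
  obtain ⟨t, s', he, ht, hout⟩ := TreeSketch.runs_sketchProg hs hm
  refine ⟨t, s', he, fun j r => ?_, ht.trans ?_⟩
  · rw [hout, TreeSketch.sketch_mul_selfTensorMatrix]
  · refine le_trans (le_of_eq ?_) (TreeSketch.cost_bound (N := TreeSketch.nnz X) hn hp hm)
    rw [← hs.sum_ptr]
    simp only [Finset.sum_add_distrib, Finset.sum_const, Finset.card_range, smul_eq_mul,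
      Finset.mul_sum]
    ring
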